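/- Let $k\ge 1$ and $\mathbb N=\{1,2,\dots\}$. Let $\Delta_k$ be the simplex of probability vectors of length $k$, $\Delta_k^k$ the set of $k\times k$ transition matrices, $\Delta_k^k(q)$ the set of those with all entries $\ge q$, $\mathcal F$ the set of probability mass functions on $\mathbb N$, and $\Theta=\Delta_k^k\times\mathcal F^k$. For $\theta=(Q,f)\in\Theta$ let $p_\ell^\theta$ be the mass function of $\ell$ consecutive observations $Y_1,\dots,Y_\ell$ of the stationary hidden Markov chain $(X_t,Y_t)$ with transition matrix $Q$ and emission mass functions $f_1,\dots,f_k$ (started from the stationary distribution of $Q$), and let $D_\ell(\theta,\tilde\theta)=\|p_\ell^\theta-p_\ell^{\tilde\theta}\|_{L_1}$ (counting measure on $\mathbb N^\ell$), for a fixed $\ell\ge1$. For positive constants $m,c,K$ let $\mathcal D(m,c,K)$ be the set of positive $f\in\mathcal F$ such that, for some $d,B,N_0$ (depending on $f$), $$f(l)\le d\,e^{-c\,l^m}\ \text{ for all } l\ge1,\qquad \sum_{l\le N}\frac{-\log f(l)}{l}\le B\,N^{K}\ \text{ for all } N\ge N_0 .$$ Let $Y_1,Y_2,\dots$ come from the stationary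 chain with parameter $\theta^*=(Q^*,f^*)$, where $Q^*\in\Delta_k^k(\underline q^*)$ for some $\underline q^*>0$, $f_j^*\in\mathcal D(m,c,K)$ for all $j$, and (I) there is $\delta>0$ such that $\sum_{l\ge N}f_i^*(l)\log^2 f_j^*(l)\lesssim e^{-N^m(c-\delta)}$ for all large $N$ and all $i,j$. Let the prior be $\Pi=\Pi_Q\otimes DP(G)^{\otimes k}$, where $DP(G)$ is the Dirichlet process with finite base measure $G$ on $\mathbb N$ such that (P) $a\,l^{-\alpha}\le G(\{l\})\le A\,l^{-\alpha}$ for all $l\ge1$, for some $0<a\le A$ and $\alpha\ge2$, and where $\Pi_Q$ is a probability measure on $\Delta_k^k$ such that (Q0) $\Pi_Q$ has a density $\pi_Q(Q)=\pi_q(Q_{1,\cdot})\cdots\pi_q(Q_{k,\cdot})$ with respect to Lebesgue measure on $\Delta_k^k$, which is positive and continuous at $Q^*$. Let $t_0\ge\frac12\max(1/m+1,K/m)$ and $t>4t_0$. The posterior is said to concentrate at rate $\epsilon_n$ if, for some $M>0$, $\Pi(\theta: D_\ell(\theta,\theta^*)\ge M\epsilon_n\mid Y_1,\dots,Y_n)\to0$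 in probability under $\theta^*$. 1. If $\pi_q(u)\lesssim\prod_{i}e^{-\alpha_i/u_i}$ on $\Delta_k$ for some $\alpha_i>0$ (Q1), then the posterior concentrates at rate $n^{-1/2}(\log n)^{t+2t_0}$. 2. If $\pi_q(u)\lesssim\prod_{i}\exp(-\beta_i\exp(u_i^{-\alpha_i}))$ on $\Delta_k$ for some $\alpha_i,\beta_i>0$ (Q2), then the posterior concentrates at rate $n^{-1/2}(\log n)^{t}$. 3. If $\Pi_Q(\Delta_k^k(\underline q))=1$ for some $\underline q>0$ (Q3), then the posterior concentrates at rate $n^{-1/2}(\log n)^{t}$. These rates are minimax up to powers of $\log n$: there are $d,B,N_0$ and $c_0>0$ such that the class $\mathcal S$ of all $\theta=(Q,f)$ with $Q\in\Delta_k^k(\underline q^*)$, with $f$ satisfying (I) (for some $\delta>0$), and with each $f_j$ satisfying the two conditions of $\mathcal D(m,c,K)$ with these $d,B,N_0$, contains $\theta^*$ and satisfies, for all $n\ge1$, $$\inf_{T}\sup_{\theta\in\mathcal S}\mathbb E^{\theta}\big\|T(Y_1,\dots,Y_n)-p_\ell^{\theta}\big\|_{L_1}\ \ge\ \frac{c_0}{\sqrt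 n},$$ the infimum being over all estimators $T$ of $p_\ell^\theta$. -/

import Mathlib

open MeasureTheory ProbabilityTheory Filter Topology
open scoped ENNReal NNReal

noncomputable section

namespace BayesHMM

/-! Observations live in `{1, 2, 3, …}`, i.e. `ℕ+`, with the discrete sigma-field and the counting
measure as reference measure; hidden states live in `Fin k`.  Time starts at `0` in the code, so
that the observations `Y_1, …, Y_n` are `Y 0, …, Y (n - 1)`. -/

instance : MeasurableSpace ℕ+ := ⊤

instance : DiscreteMeasurableSpace ℕ+ := ⟨fun _ => trivial⟩

/-! ### Parameters -/

/-- Emission densities: probability mass functions on `ℕ+`, with the sigma-field generated by the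
coordinates. -/
abbrev Emission : Type := {f : ℕ+ → ℝ // (∀ l, 0 ≤ f l) ∧ HasSum f 1}

/-- Transition matrices: each of the `k` rows is a point of the simplex. -/
abbrev TransMat (k : ℕ) : Type := Fin k → stdSimplex ℝ (Fin k)

/-- The entry `Q i j`. -/
abbrev TransMat.entry {k : ℕ} (Q : TransMat k) (i j : Fin k) : ℝ := (Q i).1 j

/-- The parameter `θ = (Q, f)`. -/
abbrev Param (k : ℕ) : Type := TransMat k × (Fin k → Emission)

/-- Transition matrices all of whose entries are at least `q`. -/
def transMatGE (k : ℕ) (q : ℝ) : Set (TransMat k) := {Q | ∀ i j, q ≤ Q.entry i j}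

/-- `μ` is a stationary probability vector of `Q`. -/
def IsStationary {k : ℕ} (Q : TransMat k) (μ : Fin k → ℝ) : Prop :=
  μ ∈ stdSimplex ℝ (Fin k) ∧ ∀ j, ∑ i, μ i * Q.entry i j = μ j

open scoped Classical in
/-- The stationary distribution of `Q` (it is unique as soon as all entries of `Q` are
positive). -/
def statDist {k : ℕ} (Q : TransMat k) : Fin k → ℝ :=
  if h : ∃ μ, IsStationary Q μ then h.choose else 0

/-! ### The hidden Markov model -/

/-- `μ_{x_1} Q_{x_1 x_2} ⋯ Q_{x_{n-1} x_n}`. -/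
def chainWeight {k : ℕ} (μ : Fin k → ℝ) (Q : TransMat k) : (n : ℕ) → (Fin n → Fin k) → ℝ
  | 0, _ => 1
  | n + 1, x => μ (x 0) * ∏ i : Fin n, Q.entry (x i.castSucc) (x i.succ)

/-- Joint mass function of `(X_1, …, X_n, Y_1, …, Y_n)` for initial distribution `μ`. -/
def jointMass {k : ℕ} (μ : Fin k → ℝ) (θ : Param k) (n : ℕ)
    (x : Fin n → Fin k) (y : Fin n → ℕ+) : ℝ :=
  chainWeight μ θ.1 n x * ∏ i, (θ.2 (x i)).1 (y i)

/-- The density `p_n^θ` of `n` consecutive observations of the stationary process, with respect to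
the counting measure. -/
def obsDensity {k : ℕ} (θ : Param k) (n : ℕ) (y : Fin n → ℕ+) : ℝ :=
  ∑ x : Fin n → Fin k, jointMass (statDist θ.1) θ n x y

/-- `(X_t, Y_t)` is, under `P`, a hidden Markov chain with initial distribution `μ` and
parameter `θ`, that is, `P` has the finite-dimensional distributions of `P^{μ,θ}`. -/
structure IsHiddenMarkovChain {Ω : Type*} [MeasurableSpace Ω] (P : Measure Ω) {k : ℕ}
    (X : ℕ → Ω → Fin k) (Y : ℕ → Ω → ℕ+) (μ : Fin k → ℝ) (θ : Param k) : Prop where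
  measurable_state : ∀ t, Measurable (X t)
  measurable_obs : ∀ t, Measurable (Y t)
  law : ∀ (n : ℕ) (x : Fin n → Fin k) (y : Fin n → ℕ+),
    P {ω | ∀ i : Fin n, X i ω = x i ∧ Y i ω = y i} = ENNReal.ofReal (jointMass μ θ n x y)

/-- The pseudo-distance `D_ℓ`: the `L₁` distance between the densities of `ℓ` consecutive
observations. -/
def obsDist {k : ℕ} (ℓ : ℕ) (θ θ' : Param k) : ℝ :=
  ∑' y : Fin ℓ → ℕ+, |obsDensity θ ℓ y - obsDensity θ' ℓ y|

/-! ### Posterior -/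

/-- The posterior probability of `A` given the observations `y = (y_1, …, y_n)`. -/
def posterior {k : ℕ} (prior : Measure (Param k)) (n : ℕ) (y : Fin n → ℕ+)
    (A : Set (Param k)) : ℝ≥0∞ :=
  (∫⁻ θ in A, ENNReal.ofReal (obsDensity θ n y) ∂prior) /
    ∫⁻ θ, ENNReal.ofReal (obsDensity θ n y) ∂prior

/-- The posterior given `Y_1, …, Y_n` concentrates at `θ₀` with rate `ε` for the loss `D_ℓ`: for
some `M > 0` the posterior probability of `{θ | D_ℓ(θ, θ₀) ≥ M ε_n}` tends to `0` in probability. -/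
def ConcentratesAtRate {Ω : Type*} [MeasurableSpace Ω] (P : Measure Ω) {k : ℕ} (Y : ℕ → Ω → ℕ+)
    (prior : Measure (Param k)) (ℓ : ℕ) (θ₀ : Param k) (ε : ℕ → ℝ) : Prop :=
  ∃ M : ℝ, 0 < M ∧
    TendstoInMeasure P
      (fun (n : ℕ) (ω : Ω) =>
        (posterior prior n (fun i : Fin n => Y i ω) {θ | M * ε n ≤ obsDist ℓ θ θ₀}).toReal)
      atTop (fun _ => 0)

/-! ### The Dirichlet process prior on emission densities -/

/-- The Gamma distribution with shape `a` and rate `1`, read as the point mass at `0` if `a = 0`. -/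
def gammaLaw (a : ℝ) : Measure ℝ := if 0 < a then gammaMeasure a 1 else Measure.dirac 0

instance (a : ℝ) : IsProbabilityMeasure (gammaLaw a) := by
  unfold gammaLaw
  split_ifs with h
  · exact isProbabilityMeasure_gammaMeasure h one_pos
  · infer_instance

open scoped Classical in
/-- The probability mass function proportional to a summable nonnegative nonzero family `γ`
(and, by convention, the point mass at `1` for the other families). -/
def normalize (γ : ℕ+ → ℝ) : Emission :=
  if h : (∀ l, 0 ≤ γ l) ∧ Summable γ ∧ 0 < ∑' m, γ m then
    ⟨fun l => γ l / ∑' m, γ m, fun l => div_nonneg (h.1 l) h.2.2.le, by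
      simpa [div_self h.2.2.ne'] using h.2.1.hasSum.div_const (∑' m, γ m)⟩
  else
    ⟨fun l => if l = 1 then 1 else 0, fun l => by
      dsimp only
      split_ifs <;> norm_num, hasSum_ite_eq 1 1⟩

/-- The Dirichlet process `DP(G)` with base measure `G` on `ℕ+`, in Ferguson's construction: the
law of `(γ_l / ∑ m, γ_m)_l` with independent `γ_l ∼ Gamma(G{l}, 1)`.  For every finite partition
`A_1, …, A_r` of `ℕ+`, the vector of probabilities of the `A_i` is therefore
Dirichlet `(G(A_1), …, G(A_r))` distributed. -/
def dirichletProcess (G : Measure ℕ+) : Measure Emission :=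
  (Measure.infinitePi fun l : ℕ+ => gammaLaw (G.real {l})).map normalize

/-- The prior on `θ = (Q, f)`: the product of `priorQ` and of `k` copies of `DP(G)`. -/
def hmmPrior {k : ℕ} (priorQ : Measure (TransMat k)) (G : Measure ℕ+) : Measure (Param k) :=
  priorQ.prod (Measure.pi fun _ : Fin k => dirichletProcess G)

/-- Tail condition on the base measure: `G{l}` decreases like `l ^ (-α)` for some `α ≥ 2`. -/
def PolynomialTail (G : Measure ℕ+) : Prop :=
  ∃ a A α : ℝ, 0 < a ∧ a ≤ A ∧ 2 ≤ α ∧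
    ∀ l : ℕ+, a * (l : ℝ) ^ (-α) ≤ G.real {l} ∧ G.real {l} ≤ A * (l : ℝ) ^ (-α)

/-! ### The prior on transition matrices -/

/-- Lebesgue measure on the simplex `Δ_k`, in the coordinates `u_1, …, u_{k-1}`. -/
def simplexVolume (k : ℕ) : Measure (stdSimplex ℝ (Fin k)) :=
  (volume : Measure (Fin (k - 1) → ℝ)).comap
    fun u i => u.1 (Fin.castLE (Nat.sub_le k 1) i)

/-- Lebesgue measure on the set `Δ_k^k` of transition matrices. -/
def transMatVolume (k : ℕ) : Measure (TransMat k) := Measure.pi fun _ => simplexVolume k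

/-- The product density `π_Q(Q) = π_q(Q_1) ⋯ π_q(Q_k)` formed from the density `πq` of a row. -/
def rowProduct {k : ℕ} (πq : stdSimplex ℝ (Fin k) → ℝ≥0) (Q : TransMat k) : ℝ≥0 :=
  ∏ i, πq (Q i)

/-- `priorQ` has the density `rowProduct πq`, which is continuous and positive at `Q₀`. -/
structure HasRowDensity {k : ℕ} (priorQ : Measure (TransMat k))
    (πq : stdSimplex ℝ (Fin k) → ℝ≥0) (Q₀ : TransMat k) : Prop where
  measurable : Measurable πq
  eq_withDensity : priorQ = (transMatVolume k).withDensity fun Q => (rowProduct πq Q : ℝ≥0∞)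
  pos_at : 0 < rowProduct πq Q₀
  continuousAt : ContinuousAt (rowProduct πq) Q₀

/-- Exponential tail of the row density.  (The boundary of the simplex, where the bound is read as
`0`, is a null set.) -/
def ExpTail {k : ℕ} (πq : stdSimplex ℝ (Fin k) → ℝ≥0) : Prop :=
  ∃ (α : Fin k → ℝ) (C : ℝ), (∀ i, 0 < α i) ∧
    ∀ u : stdSimplex ℝ (Fin k), (∀ i, 0 < u.1 i) →
      (πq u : ℝ) ≤ C * ∏ i, Real.exp (-(α i / u.1 i))

/-- Exponential of exponential tail of the row density. -/
def ExpExpTail {k : ℕ} (πq : stdSimplex ℝ (Fin k) → ℝ≥0) : Prop :=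
  ∃ (α β : Fin k → ℝ) (C : ℝ), (∀ i, 0 < α i) ∧ (∀ i, 0 < β i) ∧
    ∀ u : stdSimplex ℝ (Fin k), (∀ i, 0 < u.1 i) →
      (πq u : ℝ) ≤ C * ∏ i, Real.exp (-(β i * Real.exp (u.1 i ^ (-α i))))

/-- Truncated prior: the entries are almost surely bounded below by a positive constant. -/
def TruncatedPrior {k : ℕ} (priorQ : Measure (TransMat k)) : Prop :=
  ∃ q : ℝ, 0 < q ∧ priorQ (transMatGE k q) = 1

/-! ### The class of true emission densities -/

/-- Positive mass functions with the envelope `d exp(-c l ^ m)` and with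
`∑ l ≤ N, -log (f l) / l ≤ B N ^ K` for all `N ≥ N₀`. -/
def envelopeClass (m c K d B : ℝ) (N₀ : ℕ+) : Set Emission :=
  {f | (∀ l : ℕ+, 0 < f.1 l) ∧
    (∀ l : ℕ+, f.1 l ≤ d * Real.exp (-(c * (l : ℝ) ^ m))) ∧
    ∀ N : ℕ+, N₀ ≤ N →
      ∑ l ∈ Finset.Icc 1 N, -Real.log (f.1 l) / (l : ℝ) ≤ B * (N : ℝ) ^ K}

/-- The class `𝒟(m, c, K)`: the constants `d`, `B`, `N₀` may depend on `f`. -/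
def emissionClass (m c K : ℝ) : Set Emission :=
  {f | ∃ (d B : ℝ) (N₀ : ℕ+), f ∈ envelopeClass m c K d B N₀}

/-- The tails of the emission densities are linked: for some `δ > 0`, all `i`, `j` and all large
`N`, the sum `∑ l ≥ N, f_i(l) log²(f_j(l))` is finite and `≲ exp(-N ^ m (c - δ))`. -/
def LinkedTails {k : ℕ} (m c : ℝ) (f : Fin k → Emission) : Prop :=
  ∃ δ C : ℝ, 0 < δ ∧ ∀ᶠ N : ℕ+ in atTop, ∀ i j : Fin k,
    Summable (fun l : Set.Ici N => (f i).1 l * Real.log ((f j).1 l) ^ 2) ∧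
    ∑' l : Set.Ici N, (f i).1 l * Real.log ((f j).1 l) ^ 2 ≤
      C * Real.exp (-((N : ℝ) ^ m * (c - δ)))

/-! ### Minimax risk -/

/-- The minimax risk over `S` for the estimation of `p_ℓ^θ` from `n` consecutive observations,
with the `L₁` loss: the infimum over all estimators `T` of
`sup_{θ ∈ S} E^θ ‖T(Y_1, …, Y_n) - p_ℓ^θ‖₁`. -/
def obsMinimaxRisk {k : ℕ} (S : Set (Param k)) (ℓ n : ℕ) : ℝ≥0∞ :=
  ⨅ T : (Fin n → ℕ+) → (Fin ℓ → ℕ+) → ℝ, ⨆ θ ∈ S,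
    ∑' y : Fin n → ℕ+, ENNReal.ofReal (obsDensity θ n y) *
      ∑' z : Fin ℓ → ℕ+, ENNReal.ofReal |T y z - obsDensity θ ℓ z|

/-- The parameters with transition probabilities at least `q`, linked emission tails, and emission
densities in the envelope class with given constants. -/
def uniformClass (k : ℕ) (q m c K d B : ℝ) (N₀ : ℕ+) : Set (Param k) :=
  {θ | θ.1 ∈ transMatGE k q ∧ LinkedTails m c θ.2 ∧
    ∀ j, θ.2 j ∈ envelopeClass m c K d B N₀}

end BayesHMM

end

/-! Posterior concentration rests on the three classical ingredients: a test, a lower bound on the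
prior mass near the truth, and a small prior tail. A single test serves all alternatives, so no
entropy bound on the parameter space is needed.

The test cuts the n observations into N blocks of length ℓ separated by gaps of length g, and
rejects when the empirical measure of the blocks is at L₁ distance at least x from the true p_ℓ
(`blockTest`). If all entries of Q are at least q, Doeblin contraction bounds the law of the blocks
by (1 + (1-q)^g/q)^N times the product law (`pathSum_blocks_le`, `map_blocks_le`). With q = (log
n)^(-r) and g about 2 (log n)^(1+r) this factor is at most e, so the blocks may be treated as
independent. Under the truth the mean deviation of independent blocks is at most N^(-1/2) ∑ √p_ℓ,
where the sum is finite by the exponential envelope, and Markov's inequality applies. Under θ with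
D_ℓ ≥ 4x, acceptance forces a set depending on θ, but not on the sample, to be visited too often,
and Hoeffding's inequality gives exp(-2 N x²).

For the marginal likelihood, all observations are at most L, of order (log n)^(1/m), with
probability tending to 1. On that event the likelihood ratio is bounded below by a constant for
every θ whose transition probabilities and masses f_j(l), l ≤ L, fall short of the true ones by a
relative amount at most 1/(2n) (`obsDensity_ge_of_close`). The Gamma representation of the Dirichlet
process shows that the prior mass of such θ is at least exp(-C (log n)^s) when s ≥ max(1/m + 1,
(K+1)/m) (`exists_hmmPrior_closeParam_ge`).

For x = n^(-1/2) (log n)^τ, N x² is at least of order (log n)^(2τ-1-r). The test wins once 1 + r + s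
< 2τ, provided that for every C the prior mass of the matrices with an entry below (log n)^(-r) is
o(exp(-C (log n)^s)) (`concentratesAtRate_of_prior_tail`). The theorem takes s = 4t₀ - 1, with r =
4t₀ under the exponential tail and r = 1 in the two other cases.

The minimax bound is Le Cam's two-point method: moving mass of order n^(-1/2) from 1 to 2 in every
emission density changes p_ℓ by at least that order, while the two laws of n observations keep an
overlap of at least 1/4 (`exists_obsMinimaxRisk_ge`). -/

noncomputable section

namespace BayesHMM

/-! ### Mixing of the hidden chain and path sums of product functionals -/

section

variable {k : ℕ}

/-! ### Powers of a transition matrix -/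

/-- A transition matrix as an element of the matrix algebra. -/
def toMatrix (Q : TransMat k) : Matrix (Fin k) (Fin k) ℝ := Matrix.of fun i j => Q.entry i j

lemma entry_nonneg (Q : TransMat k) (i j : Fin k) : 0 ≤ Q.entry i j := (Q i).2.1 j

lemma sum_entry (Q : TransMat k) (i : Fin k) : ∑ j, Q.entry i j = 1 := (Q i).2.2

lemma entry_le_one (Q : TransMat k) (i j : Fin k) : Q.entry i j ≤ 1 := by
  rw [← sum_entry Q i]
  exact Finset.single_le_sum (fun a _ => entry_nonneg Q i a) (Finset.mem_univ j)

lemma pow_apply_succ (Q : TransMat k) (n : ℕ) (i j : Fin k) :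
    (toMatrix Q ^ (n + 1)) i j = ∑ a, Q.entry i a * (toMatrix Q ^ n) a j := by
  rw [pow_succ', Matrix.mul_apply]; rfl

lemma pow_apply_succ' (Q : TransMat k) (n : ℕ) (i j : Fin k) :
    (toMatrix Q ^ (n + 1)) i j = ∑ a, (toMatrix Q ^ n) i a * Q.entry a j := by
  rw [pow_succ, Matrix.mul_apply]; rfl

lemma pow_apply_nonneg (Q : TransMat k) (n : ℕ) (i j : Fin k) : 0 ≤ (toMatrix Q ^ n) i j := by
  induction n generalizing i with
  | zero => rw [pow_zero, Matrix.one_apply]; split_ifs <;> norm_num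
  | succ n ih =>
    rw [pow_apply_succ]
    exact Finset.sum_nonneg fun a _ => mul_nonneg (entry_nonneg Q i a) (ih a)

lemma sum_pow_apply (Q : TransMat k) (n : ℕ) (i : Fin k) : ∑ j, (toMatrix Q ^ n) i j = 1 := by
  induction n generalizing i with
  | zero => simp [Matrix.one_apply]
  | succ n ih =>
    simp_rw [pow_apply_succ]
    rw [Finset.sum_comm]
    simp_rw [← Finset.mul_sum, ih, mul_one]
    exact sum_entry Q i

/-- Doeblin contraction of the columns of `Q ^ n`. -/
lemma pow_apply_sub_le {Q : TransMat k} {q : ℝ} (hQ : Q ∈ transMatGE k q)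
    (hq1 : q ≤ 1) (n : ℕ) (i i' j : Fin k) :
    (toMatrix Q ^ n) i j - (toMatrix Q ^ n) i' j ≤ (1 - q) ^ n := by
  induction n generalizing i i' with
  | zero =>
    rw [pow_zero, Matrix.one_apply, Matrix.one_apply, pow_zero]
    split_ifs <;> norm_num
  | succ n ih =>
    have : Nonempty (Fin k) := ⟨i⟩
    set v : Fin k → ℝ := fun a => (toMatrix Q ^ n) a j with hv
    obtain ⟨a₀, ha₀⟩ := Finite.exists_min v
    obtain ⟨a₁, ha₁⟩ := Finite.exists_max v
    -- Row `i` puts mass at least `q` on a minimiser of the column, so its average is at most max -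
    -- q (max - min); the average along row `i'` is at least min. One step therefore shrinks the
    -- oscillation by 1 - q.
    have h1 : q * (v a₁ - v a₀) ≤ ∑ a, Q.entry i a * (v a₁ - v a) :=
      (mul_le_mul_of_nonneg_right (hQ i a₀) (sub_nonneg.2 (ha₁ a₀))).trans
        (Finset.single_le_sum (f := fun a => Q.entry i a * (v a₁ - v a))
          (fun a _ => mul_nonneg (entry_nonneg Q i a) (sub_nonneg.2 (ha₁ a)))
          (Finset.mem_univ a₀))
    have h2 : 0 ≤ ∑ a, Q.entry i' a * (v a - v a₀) :=
      Finset.sum_nonneg fun a _ => mul_nonneg (entry_nonneg Q i' a) (sub_nonneg.2 (ha₀ a))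
    simp only [mul_sub, Finset.sum_sub_distrib, ← Finset.sum_mul, sum_entry, one_mul] at h1 h2
    rw [pow_apply_succ, pow_apply_succ, pow_succ']
    have h3 := mul_le_mul_of_nonneg_left (ih a₁ a₀) (sub_nonneg.2 hq1)
    change ∑ a, Q.entry i a * v a - ∑ a, Q.entry i' a * v a ≤ _
    change (1 - q) * (v a₁ - v a₀) ≤ _ at h3
    nlinarith

lemma IsStationary.sum_mul_pow {Q : TransMat k} {μ : Fin k → ℝ} (h : IsStationary Q μ) (n : ℕ)
    (j : Fin k) : ∑ i, μ i * (toMatrix Q ^ n) i j = μ j := by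
  induction n generalizing j with
  | zero => simp [Matrix.one_apply]
  | succ n ih =>
    simp_rw [pow_apply_succ', Finset.mul_sum, ← mul_assoc]
    rw [Finset.sum_comm]
    simp_rw [← Finset.sum_mul, ih]
    exact h.2 j

lemma IsStationary.le_apply {Q : TransMat k} {μ : Fin k → ℝ} (h : IsStationary Q μ) {q : ℝ}
    (hQ : Q ∈ transMatGE k q) (j : Fin k) : q ≤ μ j := by
  rw [← h.2 j, ← one_mul q, ← h.1.2, Finset.sum_mul]
  exact Finset.sum_le_sum fun i _ => mul_le_mul_of_nonneg_left (hQ i j) (h.1.1 i)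

/-- The additive error (1 - q)^n becomes a relative one because `μ j` is at least `q`. The relative
form is the one that can be iterated from block to block. -/
lemma IsStationary.pow_apply_le {Q : TransMat k} {μ : Fin k → ℝ} (h : IsStationary Q μ) {q : ℝ}
    (hQ : Q ∈ transMatGE k q) (hq : 0 < q) (hq1 : q ≤ 1) (n : ℕ) (i j : Fin k) :
    (toMatrix Q ^ n) i j ≤ (1 + (1 - q) ^ n / q) * μ j := by
  have h1 : (toMatrix Q ^ n) i j - μ j ≤ (1 - q) ^ n := by
    rw [← h.sum_mul_pow n j]
    calc (toMatrix Q ^ n) i j - ∑ a, μ a * (toMatrix Q ^ n) a j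
        = ∑ a, μ a * ((toMatrix Q ^ n) i j - (toMatrix Q ^ n) a j) := by
          simp_rw [mul_sub, Finset.sum_sub_distrib, ← Finset.sum_mul, h.1.2, one_mul]
      _ ≤ ∑ a, μ a * (1 - q) ^ n := Finset.sum_le_sum fun a _ =>
          mul_le_mul_of_nonneg_left (pow_apply_sub_le hQ hq1 n i a j) (h.1.1 a)
      _ = (1 - q) ^ n := by rw [← Finset.sum_mul, h.1.2, one_mul]
  have h2 : (1 - q) ^ n ≤ (1 - q) ^ n / q * μ j := by
    rw [div_mul_eq_mul_div, le_div_iff₀ hq]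
    exact mul_le_mul_of_nonneg_left (h.le_apply hQ j) (pow_nonneg (sub_nonneg.2 hq1) n)
  linarith

/-- A transition matrix with positive entries has a stationary distribution, and its powers
converge to it. -/
lemma exists_isStationary_tendsto {Q : TransMat k} {q : ℝ} (hk : 1 ≤ k) (hq : 0 < q)
    (hQ : Q ∈ transMatGE k q) :
    ∃ μ, IsStationary Q μ ∧
      ∀ i j, Tendsto (fun n => (toMatrix Q ^ n) i j) atTop (𝓝 (μ j)) := by
  let z : Fin k := ⟨0, hk⟩
  have hq1 : q ≤ 1 := (hQ z z).trans (entry_le_one Q z z)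
  -- The next power averages the entries of the column over row `i`, so the increment is bounded by
  -- the oscillation of the column.
  have hcau : ∀ i j, CauchySeq fun n => (toMatrix Q ^ n) i j := fun i j => by
    refine cauchySeq_of_le_geometric (1 - q) 1 (by linarith) fun n => ?_
    rw [one_mul, Real.dist_eq, abs_le]
    have h1 : (toMatrix Q ^ (n + 1)) i j - (toMatrix Q ^ n) i j
        = ∑ a, Q.entry i a * ((toMatrix Q ^ n) a j - (toMatrix Q ^ n) i j) := by
      simp_rw [mul_sub, Finset.sum_sub_distrib, ← Finset.sum_mul, sum_entry, one_mul,
        pow_apply_succ]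
    have h2 : ∀ a, Q.entry i a * ((toMatrix Q ^ n) a j - (toMatrix Q ^ n) i j)
        ≤ Q.entry i a * (1 - q) ^ n := fun a =>
      mul_le_mul_of_nonneg_left (pow_apply_sub_le hQ hq1 n a i j) (entry_nonneg Q i a)
    have h3 : ∀ a, Q.entry i a * (-(1 - q) ^ n)
        ≤ Q.entry i a * ((toMatrix Q ^ n) a j - (toMatrix Q ^ n) i j) := fun a =>
      mul_le_mul_of_nonneg_left (by linarith [pow_apply_sub_le hQ hq1 n i a j])
        (entry_nonneg Q i a)
    have h4 := Finset.sum_le_sum fun a (_ : a ∈ Finset.univ) => h2 a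
    have h5 := Finset.sum_le_sum fun a (_ : a ∈ Finset.univ) => h3 a
    rw [← Finset.sum_mul, sum_entry, one_mul] at h4 h5
    constructor <;> linarith
  choose L hL using fun i j => cauchySeq_tendsto_of_complete (hcau i j)
  -- The contraction makes the limit independent of the starting state.
  have hLi : ∀ i j, L i j = L z j := fun i j => by
    have h0 : Tendsto (fun n : ℕ => (1 - q) ^ n) atTop (𝓝 0) :=
      tendsto_pow_atTop_nhds_zero_of_lt_one (by linarith) (by linarith)
    have h1 := le_of_tendsto_of_tendsto' ((hL i j).sub (hL z j)) h0
      fun n => pow_apply_sub_le hQ hq1 n i z j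
    have h2 := le_of_tendsto_of_tendsto' ((hL z j).sub (hL i j)) h0
      fun n => pow_apply_sub_le hQ hq1 n z i j
    linarith
  refine ⟨L z, ⟨⟨fun j => ge_of_tendsto' (hL z j) fun n => pow_apply_nonneg Q n z j, ?_⟩,
    fun j => ?_⟩, fun i j => hLi i j ▸ hL i j⟩
  · refine tendsto_nhds_unique (l := (atTop : Filter ℕ))
      (f := fun n => ∑ j, (toMatrix Q ^ n) z j) (tendsto_finsetSum _ fun j _ => hL z j) ?_
    simp_rw [sum_pow_apply]
    exact tendsto_const_nhds
  · refine tendsto_nhds_unique (l := (atTop : Filter ℕ))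
      (f := fun n => ∑ i, (toMatrix Q ^ n) z i * Q.entry i j)
      (tendsto_finsetSum _ fun i _ => (hL z i).mul_const (Q.entry i j)) ?_
    simp_rw [← pow_apply_succ']
    exact (hL z j).comp (tendsto_add_atTop_nat 1)

lemma isStationary_statDist {Q : TransMat k} {q : ℝ} (hk : 1 ≤ k) (hq : 0 < q)
    (hQ : Q ∈ transMatGE k q) : IsStationary Q (statDist Q) := by
  have h : ∃ μ, IsStationary Q μ :=
    (exists_isStationary_tendsto hk hq hQ).imp fun _ h => h.1
  rw [statDist, dif_pos h]
  exact h.choose_spec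

/-- `statDist` is a choice among the stationary vectors. Each of these is fixed by all powers of
`Q`, whose rows tend to `μ`, so it is `μ`. -/
lemma tendsto_pow_statDist {Q : TransMat k} {q : ℝ} (hk : 1 ≤ k) (hq : 0 < q)
    (hQ : Q ∈ transMatGE k q) (i j : Fin k) :
    Tendsto (fun n => (toMatrix Q ^ n) i j) atTop (𝓝 (statDist Q j)) := by
  obtain ⟨μ, hμ, hlim⟩ := exists_isStationary_tendsto hk hq hQ
  have hs := isStationary_statDist hk hq hQ
  have : statDist Q j = μ j := by
    refine tendsto_nhds_unique (l := (atTop : Filter ℕ)) (f := fun _ : ℕ => statDist Q j)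
      tendsto_const_nhds ?_
    have := tendsto_finsetSum (Finset.univ : Finset (Fin k))
      fun i _ => (hlim i j).const_mul (statDist Q i)
    simp_rw [hs.sum_mul_pow, ← Finset.sum_mul, hs.1.2, one_mul] at this
    exact this
  exact this ▸ hlim i j

lemma statDist_nonneg (Q : TransMat k) (j : Fin k) : 0 ≤ statDist Q j := by
  unfold statDist
  split_ifs with h
  · exact h.choose_spec.1.1 j
  · exact le_rfl

/-! ### Backward recursion -/

/-- `bwd Q n F v x` is the expectation of `F 0 (X_0) ⋯ F (n - 1) (X_{n-1}) v(X_n)` for the chain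
with kernel `Q` started at `x`. -/
def bwd (Q : Fin k → Fin k → ℝ≥0∞) :
    (n : ℕ) → (F : ℕ → Fin k → ℝ≥0∞) → (v : Fin k → ℝ≥0∞) → Fin k → ℝ≥0∞
  | 0, _, v => v
  | n + 1, F, v => fun x => F 0 x * ∑ x', Q x x' * bwd Q n (fun t => F (t + 1)) v x'

variable (Q : Fin k → Fin k → ℝ≥0∞)

lemma bwd_add (a b : ℕ) (F : ℕ → Fin k → ℝ≥0∞) (v : Fin k → ℝ≥0∞) :
    bwd Q (a + b) F v = bwd Q a F (bwd Q b (fun t => F (a + t)) v) := by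
  induction a generalizing F with
  | zero => simp [bwd]
  | succ a ih =>
    rw [Nat.succ_add_eq_add_succ, show a + b.succ = (a + b) + 1 by omega]
    funext x
    simp only [bwd, ih]
    simp_rw [show ∀ t, a + t + 1 = a + 1 + t from fun t => by omega]

lemma bwd_congr {n : ℕ} {F G : ℕ → Fin k → ℝ≥0∞} (h : ∀ t < n, F t = G t) (v : Fin k → ℝ≥0∞) :
    bwd Q n F v = bwd Q n G v := by
  induction n generalizing F G with
  | zero => rfl
  | succ n ih =>
    funext x
    simp only [bwd]
    rw [h 0 (by omega), ih fun t ht => h (t + 1) (by omega)]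

lemma bwd_mono (n : ℕ) (F : ℕ → Fin k → ℝ≥0∞) {v w : Fin k → ℝ≥0∞} (h : ∀ x, v x ≤ w x)
    (x : Fin k) : bwd Q n F v x ≤ bwd Q n F w x := by
  induction n generalizing F x with
  | zero => exact h x
  | succ n ih =>
    simp only [bwd]
    gcongr
    exact ih _ _

lemma bwd_const (n : ℕ) (F : ℕ → Fin k → ℝ≥0∞) (c : ℝ≥0∞) (x : Fin k) :
    bwd Q n F (fun _ => c) x = bwd Q n F (fun _ => 1) x * c := by
  induction n generalizing F x with
  | zero => simp [bwd]
  | succ n ih =>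
    simp only [bwd]
    simp_rw [ih, ← mul_assoc, ← Finset.sum_mul, ← mul_assoc]

/-- Entries of a transition matrix, as extended nonnegative numbers. -/
def kern (Q : TransMat k) (i j : Fin k) : ℝ≥0∞ := ENNReal.ofReal (Q.entry i j)

lemma sum_kern (Q : TransMat k) (i : Fin k) : ∑ j, kern Q i j = 1 := by
  simp only [kern]
  rw [← ENNReal.ofReal_sum_of_nonneg fun j _ => entry_nonneg Q i j, sum_entry, ENNReal.ofReal_one]

lemma bwd_one_pow (Q : TransMat k) (n : ℕ) (v : Fin k → ℝ≥0∞) (x : Fin k) :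
    bwd (kern Q) n (fun _ _ => 1) v x = ∑ j, ENNReal.ofReal ((toMatrix Q ^ n) x j) * v j := by
  induction n generalizing x with
  | zero =>
    simp only [bwd, pow_zero, Matrix.one_apply]
    rw [Finset.sum_eq_single x] <;> simp +contextual [eq_comm]
  | succ n ih =>
    simp only [bwd, one_mul]
    simp_rw [ih, Finset.mul_sum, ← mul_assoc]
    rw [Finset.sum_comm]
    refine Finset.sum_congr rfl fun j _ => ?_
    rw [← Finset.sum_mul, pow_apply_succ, ENNReal.ofReal_sum_of_nonneg fun a _ =>
      mul_nonneg (entry_nonneg Q x a) (pow_apply_nonneg Q n a j)]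
    simp_rw [ENNReal.ofReal_mul (entry_nonneg Q x _)]
    rfl

lemma bwd_one_one (Q : TransMat k) (n : ℕ) (x : Fin k) :
    bwd (kern Q) n (fun _ _ => 1) (fun _ => 1) x = 1 := by
  rw [bwd_one_pow]
  simp_rw [mul_one]
  rw [← ENNReal.ofReal_sum_of_nonneg fun j _ => pow_apply_nonneg Q n x j, sum_pow_apply,
    ENNReal.ofReal_one]

/-- Total weight of the paths of length `n`, for the initial distribution `μ`. -/
def pathSum (Q : TransMat k) (μ : Fin k → ℝ) (n : ℕ) (F : ℕ → Fin k → ℝ≥0∞) : ℝ≥0∞ :=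
  ∑ x, ENNReal.ofReal (μ x) * bwd (kern Q) n F (fun _ => 1) x

lemma pathSum_congr (Q : TransMat k) (μ : Fin k → ℝ) {n : ℕ} {F G : ℕ → Fin k → ℝ≥0∞}
    (h : ∀ t < n, F t = G t) : pathSum Q μ n F = pathSum Q μ n G := by
  simp only [pathSum, bwd_congr _ h]

lemma pathSum_one (Q : TransMat k) {μ : Fin k → ℝ} (hμ : μ ∈ stdSimplex ℝ (Fin k)) (n : ℕ) :
    pathSum Q μ n (fun _ _ => 1) = 1 := by
  simp only [pathSum, bwd_one_one, mul_one]
  rw [← ENNReal.ofReal_sum_of_nonneg fun j _ => hμ.1 j, hμ.2, ENNReal.ofReal_one]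

/-- Blocks of length `ℓ` separated by gaps of length `g` are almost independent. -/
lemma pathSum_blocks_le {Q : TransMat k} {μ : Fin k → ℝ} (hμ : IsStationary Q μ) {q : ℝ}
    (hQ : Q ∈ transMatGE k q) (hq : 0 < q) (hq1 : q ≤ 1) (ℓ g r N : ℕ)
    (F : ℕ → Fin k → ℝ≥0∞)
    (hgap : ∀ i < N, ∀ t, ℓ ≤ t → t < ℓ + g → F (i * (ℓ + g) + t) = fun _ => 1)
    (hend : ∀ t, N * (ℓ + g) ≤ t → F t = fun _ => 1) :
    pathSum Q μ (N * (ℓ + g) + r) F ≤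
      ENNReal.ofReal (1 + (1 - q) ^ g / q) ^ N *
        ∏ i ∈ Finset.range N, pathSum Q μ ℓ (fun t => F (i * (ℓ + g) + t)) := by
  induction N generalizing F with
  | zero =>
    rw [pathSum_congr Q μ (G := fun _ _ => 1) fun t _ => hend t (by omega), pathSum_one Q hμ.1]
    simp
  | succ N ih =>
    set b := ℓ + g with hb
    set ρ := ENNReal.ofReal (1 + (1 - q) ^ g / q) with hρ
    set G : ℕ → Fin k → ℝ≥0∞ := fun t => F (b + t) with hG
    have hsh : ∀ i t, (i + 1) * b + t = b + (i * b + t) := fun i t => by ring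
    have ih' := ih G
      (fun i hi t h1 h2 => by
        simp only [hG, ← hsh]
        exact hgap (i + 1) (by omega) t h1 h2)
      (fun t ht => hend (b + t) (by rw [Nat.succ_mul]; omega))
    set u : Fin k → ℝ≥0∞ := bwd (kern Q) (N * b + r) G (fun _ => 1) with hu
    -- All factors in the gap are 1, so only Q^g acts there. Comparing it with `μ` restarts the
    -- chain in the stationary regime at the cost of `ρ`, whatever the state at the end of the first
    -- block.
    have hgapbound : ∀ x, bwd (kern Q) g (fun t => F (ℓ + t)) u x
        ≤ ρ * pathSum Q μ (N * b + r) G := fun x => by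
      rw [bwd_congr (kern Q) (G := fun _ _ => 1) fun t ht => ?_]
      · rw [bwd_one_pow, pathSum, Finset.mul_sum]
        refine Finset.sum_le_sum fun j _ => ?_
        rw [← mul_assoc, hρ, ← ENNReal.ofReal_mul]
        · gcongr
          exact hμ.pow_apply_le hQ hq hq1 g x j
        · have := pow_nonneg (sub_nonneg.2 hq1) g
          positivity
      · have := hgap 0 (by omega) (ℓ + t) (by omega) (by omega)
        simpa using this
    have hsplit : ∀ x, bwd (kern Q) ((N + 1) * b + r) F (fun _ => 1) x
        ≤ bwd (kern Q) ℓ F (fun _ => 1) x * (ρ * pathSum Q μ (N * b + r) G) := fun x => by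
      rw [show (N + 1) * b + r = ℓ + (g + (N * b + r)) by rw [Nat.succ_mul]; omega, bwd_add,
        bwd_add, ← bwd_const]
      refine bwd_mono _ _ _ (fun y => ?_) x
      convert hgapbound y using 2
      simp only [hu, hG, hb, add_assoc]
    calc pathSum Q μ ((N + 1) * b + r) F
        ≤ pathSum Q μ ℓ F * (ρ * pathSum Q μ (N * b + r) G) := by
          simp only [pathSum]
          rw [Finset.sum_mul]
          refine Finset.sum_le_sum fun x _ => ?_
          rw [mul_assoc]
          gcongr
          exact hsplit x
      _ ≤ pathSum Q μ ℓ F * (ρ * (ρ ^ N *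
            ∏ i ∈ Finset.range N, pathSum Q μ ℓ (fun t => G (i * b + t)))) := by
          gcongr
      _ = _ := by
          rw [Finset.prod_range_succ']
          simp only [hG, ← hsh, zero_mul, zero_add, pow_succ]
          ring

end

/-! ### From path sums to the law of the observations and of its blocks -/

section

variable {k : ℕ}

/-! ### Sums over paths and over observations -/

lemma sum_fin_succ_fun {α M : Type*} [Fintype α] [AddCommMonoid M] (n : ℕ)
    (g : (Fin (n + 1) → α) → M) :
    ∑ x, g x = ∑ a, ∑ x : Fin n → α, g (Fin.cons a x) := by
  rw [← Fintype.sum_prod_type']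
  exact (Fintype.sum_equiv (Fin.consEquiv fun _ : Fin (n + 1) => α) _ _ fun p => rfl).symm

lemma tsum_fin_succ_fun {α : Type*} (n : ℕ) (g : (Fin (n + 1) → α) → ℝ≥0∞) :
    ∑' x, g x = ∑' a, ∑' x : Fin n → α, g (Fin.cons a x) := by
  rw [← (Fin.consEquiv fun _ : Fin (n + 1) => α).tsum_eq g, ENNReal.tsum_prod']
  rfl

lemma tsum_prod_fin {α : Type*} (n : ℕ) (g : Fin n → α → ℝ≥0∞) :
    ∑' y : Fin n → α, ∏ i, g i (y i) = ∏ i, ∑' a, g i a := by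
  induction n with
  | zero => simp
  | succ n ih =>
    rw [tsum_fin_succ_fun, Fin.prod_univ_succ, ← ENNReal.tsum_mul_right]
    refine tsum_congr fun a => ?_
    simp_rw [Fin.prod_univ_succ, Fin.cons_zero, Fin.cons_succ, ENNReal.tsum_mul_left]
    rw [ih fun i => g i.succ]

/-- Peeling off the first state gives the recursion of `bwd`; the extra transition after the last
factor contributes a row sum, which is 1. -/
lemma sum_prod_kern (Q : TransMat k) (n : ℕ) (F : ℕ → Fin k → ℝ≥0∞) (a : Fin k) :
    ∑ x : Fin n → Fin k,
      (∏ i : Fin n, kern Q ((Fin.cons a x : Fin (n + 1) → Fin k) i.castSucc)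
        ((Fin.cons a x : Fin (n + 1) → Fin k) i.succ)) *
      ∏ i : Fin (n + 1), F i ((Fin.cons a x : Fin (n + 1) → Fin k) i) =
    bwd (kern Q) (n + 1) F (fun _ => 1) a := by
  induction n generalizing F a with
  | zero => simp [bwd, sum_kern]
  | succ n ih =>
    rw [bwd, sum_fin_succ_fun]
    beta_reduce
    rw [Finset.mul_sum]
    refine Finset.sum_congr rfl fun c _ => ?_
    rw [← ih (fun t => F (t + 1)) c, Finset.mul_sum, Finset.mul_sum]
    refine Finset.sum_congr rfl fun x _ => ?_
    rw [Fin.prod_univ_succ, Fin.prod_univ_succ (n := n + 1)]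
    simp only [Fin.castSucc_zero, Fin.cons_zero, Fin.cons_succ, Fin.val_zero, Fin.val_succ,
      ← Fin.succ_castSucc]
    ring

lemma ofReal_chainWeight_succ {Q : TransMat k} {μ : Fin k → ℝ} (hμ : ∀ i, 0 ≤ μ i) (n : ℕ)
    (x : Fin (n + 1) → Fin k) :
    ENNReal.ofReal (chainWeight μ Q (n + 1) x) =
      ENNReal.ofReal (μ (x 0)) * ∏ i : Fin n, kern Q (x i.castSucc) (x i.succ) := by
  rw [chainWeight, ENNReal.ofReal_mul (hμ _),
    ENNReal.ofReal_prod_of_nonneg fun i _ => entry_nonneg Q _ _]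
  rfl

lemma sum_chainWeight_mul_prod {Q : TransMat k} {μ : Fin k → ℝ}
    (hμ : μ ∈ stdSimplex ℝ (Fin k)) (n : ℕ) (F : ℕ → Fin k → ℝ≥0∞) :
    ∑ x : Fin n → Fin k, ENNReal.ofReal (chainWeight μ Q n x) * ∏ i : Fin n, F i (x i) =
      pathSum Q μ n F := by
  cases n with
  | zero =>
    rw [pathSum_congr Q μ (G := fun _ _ => 1) fun t ht => by omega, pathSum_one Q hμ]
    simp [chainWeight]
  | succ n =>
    rw [pathSum, sum_fin_succ_fun]
    refine Finset.sum_congr rfl fun a _ => ?_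
    rw [← sum_prod_kern, Finset.mul_sum]
    refine Finset.sum_congr rfl fun x _ => ?_
    rw [ofReal_chainWeight_succ hμ.1, Fin.cons_zero, mul_assoc]

lemma chainWeight_nonneg {Q : TransMat k} {μ : Fin k → ℝ} (hμ : ∀ i, 0 ≤ μ i) (n : ℕ)
    (x : Fin n → Fin k) : 0 ≤ chainWeight μ Q n x := by
  cases n with
  | zero => exact zero_le_one
  | succ n => exact mul_nonneg (hμ _) (Finset.prod_nonneg fun i _ => entry_nonneg Q _ _)

lemma jointMass_nonneg {μ : Fin k → ℝ} (hμ : ∀ i, 0 ≤ μ i) (θ : Param k) (n : ℕ)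
    (x : Fin n → Fin k) (y : Fin n → ℕ+) : 0 ≤ jointMass μ θ n x y :=
  mul_nonneg (chainWeight_nonneg hμ n x) (Finset.prod_nonneg fun i _ => (θ.2 (x i)).2.1 _)

lemma obsDensity_nonneg (θ : Param k) (n : ℕ) (y : Fin n → ℕ+) : 0 ≤ obsDensity θ n y :=
  Finset.sum_nonneg fun x _ => jointMass_nonneg (statDist_nonneg θ.1) θ n x y

/-- Emission probabilities, as extended nonnegative numbers. -/
def emit (θ : Param k) (x : Fin k) (l : ℕ+) : ℝ≥0∞ := ENNReal.ofReal ((θ.2 x).1 l)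

lemma tsum_emit (θ : Param k) (x : Fin k) : ∑' l, emit θ x l = 1 := by
  simp only [emit]
  rw [← ENNReal.ofReal_tsum_of_nonneg (θ.2 x).2.1 (θ.2 x).2.2.summable, (θ.2 x).2.2.tsum_eq,
    ENNReal.ofReal_one]

lemma ofReal_jointMass {μ : Fin k → ℝ} (hμ : ∀ i, 0 ≤ μ i) (θ : Param k) (n : ℕ)
    (x : Fin n → Fin k) (y : Fin n → ℕ+) :
    ENNReal.ofReal (jointMass μ θ n x y) =
      ENNReal.ofReal (chainWeight μ θ.1 n x) * ∏ i, emit θ (x i) (y i) := by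
  rw [jointMass, ENNReal.ofReal_mul (chainWeight_nonneg hμ n x),
    ENNReal.ofReal_prod_of_nonneg fun i _ => (θ.2 (x i)).2.1 _]
  rfl

lemma ofReal_obsDensity (θ : Param k) (n : ℕ) (y : Fin n → ℕ+) :
    ENNReal.ofReal (obsDensity θ n y) =
      ∑ x : Fin n → Fin k, ENNReal.ofReal (chainWeight (statDist θ.1) θ.1 n x) *
        ∏ i, emit θ (x i) (y i) := by
  rw [obsDensity, ENNReal.ofReal_sum_of_nonneg fun x _ =>
    jointMass_nonneg (statDist_nonneg θ.1) θ n x y]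
  simp_rw [ofReal_jointMass (statDist_nonneg θ.1)]

lemma ofReal_obsDensity_eq_pathSum {θ : Param k}
    (hμ : statDist θ.1 ∈ stdSimplex ℝ (Fin k)) (n : ℕ) (z : ℕ → ℕ+) :
    ENNReal.ofReal (obsDensity θ n fun i => z i) =
      pathSum θ.1 (statDist θ.1) n fun t x => emit θ x (z t) := by
  rw [ofReal_obsDensity, ← sum_chainWeight_mul_prod hμ]

/-- Expectations of product functionals of the observations. -/
lemma tsum_obsDensity_mul_prod {θ : Param k} (hμ : statDist θ.1 ∈ stdSimplex ℝ (Fin k)) (n : ℕ)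
    (w : ℕ → ℕ+ → ℝ≥0∞) :
    ∑' y : Fin n → ℕ+, ENNReal.ofReal (obsDensity θ n y) * ∏ i : Fin n, w i (y i) =
      pathSum θ.1 (statDist θ.1) n fun t x => ∑' l, emit θ x l * w t l := by
  rw [← sum_chainWeight_mul_prod hμ]
  simp_rw [ofReal_obsDensity, Finset.sum_mul]
  rw [Summable.tsum_finsetSum fun _ _ => ENNReal.summable]
  refine Finset.sum_congr rfl fun x _ => ?_
  simp_rw [mul_assoc, ← Finset.prod_mul_distrib]
  rw [ENNReal.tsum_mul_left, tsum_prod_fin n fun i l => emit θ (x i) l * w i l]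

lemma tsum_obsDensity {θ : Param k} (hμ : statDist θ.1 ∈ stdSimplex ℝ (Fin k)) (n : ℕ) :
    ∑' y : Fin n → ℕ+, ENNReal.ofReal (obsDensity θ n y) = 1 := by
  have := tsum_obsDensity_mul_prod hμ n fun _ _ => 1
  simp only [Finset.prod_const_one, mul_one, tsum_emit] at this
  rw [this, pathSum_one _ hμ]

lemma hasSum_obsDensity {θ : Param k} (hμ : statDist θ.1 ∈ stdSimplex ℝ (Fin k)) (n : ℕ) :
    HasSum (obsDensity θ n) 1 := by
  have h1 := tsum_obsDensity hμ n
  have hs : Summable (obsDensity θ n) := by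
    have := ENNReal.summable_toReal (h1 ▸ ENNReal.one_ne_top :
      ∑' y : Fin n → ℕ+, ENNReal.ofReal (obsDensity θ n y) ≠ ∞)
    simpa only [ENNReal.toReal_ofReal (obsDensity_nonneg θ n _)] using this
  rw [← ENNReal.ofReal_tsum_of_nonneg (obsDensity_nonneg θ n) hs, ENNReal.ofReal_eq_one] at h1
  exact h1 ▸ hs.hasSum

/-! ### The law of the observations -/

/-- The law of `n` consecutive observations. -/
def obsLaw (θ : Param k) (n : ℕ) : Measure (Fin n → ℕ+) :=
  Measure.sum fun y => ENNReal.ofReal (obsDensity θ n y) • Measure.dirac y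

lemma obsLaw_apply (θ : Param k) (n : ℕ) (A : Set (Fin n → ℕ+)) :
    obsLaw θ n A = ∑' y, A.indicator (fun y => ENNReal.ofReal (obsDensity θ n y)) y := by
  rw [obsLaw, Measure.sum_apply _ (MeasurableSet.of_discrete)]
  refine tsum_congr fun y => ?_
  by_cases h : y ∈ A <;> simp [h]

lemma obsLaw_singleton (θ : Param k) (n : ℕ) (y : Fin n → ℕ+) :
    obsLaw θ n {y} = ENNReal.ofReal (obsDensity θ n y) := by
  rw [obsLaw_apply, tsum_eq_single y] <;> simp +contextual

lemma isProbabilityMeasure_obsLaw {θ : Param k} (hμ : statDist θ.1 ∈ stdSimplex ℝ (Fin k))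
    (n : ℕ) : IsProbabilityMeasure (obsLaw θ n) :=
  ⟨by rw [obsLaw_apply, Set.indicator_univ, tsum_obsDensity hμ]⟩

/-- The blocks of length `ℓ` starting at the multiples of `b`. -/
def blocks {ℓ b N n : ℕ} (hℓ : ℓ ≤ b) (hn : N * b ≤ n) (y : Fin n → ℕ+) :
    Fin N → Fin ℓ → ℕ+ := fun i r =>
  y ⟨i * b + r, by
    have h1 : (i : ℕ) * b + b ≤ N * b := by
      rw [← Nat.succ_mul]; exact Nat.mul_le_mul_right b i.2
    omega⟩

lemma measure_le_of_singleton {α : Type*} [Countable α] [MeasurableSpace α]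
    [DiscreteMeasurableSpace α] {μ ν : Measure α} (h : ∀ a, μ {a} ≤ ν {a}) : μ ≤ ν := by
  refine Measure.le_iff.2 fun s hs => ?_
  rw [← Measure.tsum_indicator_apply_singleton μ s hs,
    ← Measure.tsum_indicator_apply_singleton ν s hs]
  exact ENNReal.tsum_le_tsum fun a => Set.indicator_le_indicator (h a)

/-- It suffices to compare singletons. Prescribing all blocks is a product functional: an indicator
at each time inside a block, the constant 1 in the gaps and after the last block. This is the
setting of `pathSum_blocks_le`. -/
lemma map_blocks_le {θ : Param k} {q : ℝ} (hk : 1 ≤ k)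
    (hQ : θ.1 ∈ transMatGE k q) (hq : 0 < q) (hq1 : q ≤ 1) {ℓ g N n : ℕ}
    (hn : N * (ℓ + g) ≤ n) :
    (obsLaw θ n).map (blocks (Nat.le_add_right ℓ g) hn) ≤
      ENNReal.ofReal (1 + (1 - q) ^ g / q) ^ N • Measure.pi fun _ : Fin N => obsLaw θ ℓ := by
  have hst := isStationary_statDist hk hq hQ
  have hpr := isProbabilityMeasure_obsLaw hst.1 ℓ
  refine measure_le_of_singleton fun z => ?_
  set b := ℓ + g with hb
  rw [Measure.map_apply .of_discrete .of_discrete, Measure.smul_apply, smul_eq_mul,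
    Measure.pi_singleton]
  simp_rw [obsLaw_singleton]
  -- the constraint on the observation at time `t`
  let w : ℕ → ℕ+ → ℝ≥0∞ := fun t l =>
    if h : t / b < N ∧ t % b < ℓ then (if l = z ⟨t / b, h.1⟩ ⟨t % b, h.2⟩ then 1 else 0) else 1
  let F : ℕ → Fin k → ℝ≥0∞ := fun t x => ∑' l, emit θ x l * w t l
  have hdiv : ∀ i t, t < b → (i * b + t) / b = i ∧ (i * b + t) % b = t := fun i t ht => by
    constructor
    · rw [mul_comm, Nat.mul_add_div (by omega), Nat.div_eq_of_lt ht, add_zero]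
    · rw [mul_comm, Nat.mul_add_mod, Nat.mod_eq_of_lt ht]
  have hw1 : ∀ t, ¬ (t / b < N ∧ t % b < ℓ) → F t = fun _ => 1 := fun t ht => by
    funext x
    simp only [F, w, dif_neg ht, mul_one, tsum_emit]
  have hwz : ∀ (i : Fin N) (r : Fin ℓ), F (i * b + r) = fun x => emit θ x (z i r) := by
    intro i r
    funext x
    have hr : (r : ℕ) < b := by omega
    obtain ⟨h1, h2⟩ := hdiv i r hr
    have h3 : ((i : ℕ) * b + r) / b < N ∧ ((i : ℕ) * b + r) % b < ℓ :=
      ⟨by rw [h1]; exact i.2, by rw [h2]; exact r.2⟩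
    have h4 : (⟨((i : ℕ) * b + r) / b, h3.1⟩ : Fin N) = i := Fin.ext h1
    have h5 : (⟨((i : ℕ) * b + r) % b, h3.2⟩ : Fin ℓ) = r := Fin.ext h2
    have hwl : ∀ l, w (i * b + r) l = if l = z i r then 1 else 0 := fun l => by
      simp only [w]
      rw [dif_pos h3, h4, h5]
    simp only [F, hwl]
    rw [tsum_eq_single (z i r)] <;> simp +contextual
  have hle : obsLaw θ n (blocks (Nat.le_add_right ℓ g) hn ⁻¹' {z}) ≤
      pathSum θ.1 (statDist θ.1) n F := by
    rw [obsLaw_apply, ← tsum_obsDensity_mul_prod hst.1]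
    refine ENNReal.tsum_le_tsum fun y => ?_
    by_cases hy : blocks (Nat.le_add_right ℓ g) hn y = z
    · rw [Set.indicator_of_mem (by exact hy), Finset.prod_eq_one, mul_one]
      intro t _
      simp only [w]
      split_ifs with h h'
      · rfl
      · refine absurd ?_ h'
        rw [← hy]
        simp only [blocks]
        congr 1
        exact Fin.ext (by simp only [← hb]; rw [mul_comm]; exact (Nat.div_add_mod _ _).symm)
      · rfl
    · rw [Set.indicator_of_notMem (by exact hy)]
      exact zero_le
  refine hle.trans ?_
  obtain ⟨r, rfl⟩ := Nat.exists_eq_add_of_le hn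
  refine (pathSum_blocks_le hst hQ hq hq1 ℓ g r N F (fun i hi t h1 h2 => hw1 _ ?_)
    (fun t ht => hw1 _ ?_)).trans ?_
  · rw [(hdiv i t h2).2]; omega
  · rintro ⟨h1, h2⟩
    have hb0 : 0 < b := by omega
    rw [Nat.div_lt_iff_lt_mul hb0] at h1
    exact absurd ht (not_le.2 h1)
  · gcongr
    rw [Finset.prod_range]
    refine le_of_eq (Finset.prod_congr rfl fun i _ => ?_)
    -- `ofReal_obsDensity_eq_pathSum` takes a sequence over all times; the value 1 beyond the block
    -- is a filler.
    let z' : ℕ → ℕ+ := fun r => if h : r < ℓ then z i ⟨r, h⟩ else 1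
    have hz : z i = fun r : Fin ℓ => z' r := by
      funext r; simp [z']
    rw [hz, ofReal_obsDensity_eq_pathSum hst.1]
    refine pathSum_congr _ _ fun t ht => ?_
    rw [hwz i ⟨t, ht⟩]
    simp [z', ht]

end

/-! ### Empirical measures of independent samples from a discrete distribution -/

section Empirical

variable {α : Type*} {N : ℕ}

open scoped Classical in
/-- The empirical frequency of `a` in the sample `z`. -/
def freq (z : Fin N → α) (a : α) : ℝ := (∑ i, if z i = a then (1 : ℝ) else 0) / N

/-- The `L₁` distance between the empirical measure of `z` and the mass function `p`. -/
def empDev (p : α → ℝ) (z : Fin N → α) : ℝ≥0∞ := ∑' a, ENNReal.ofReal |freq z a - p a|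

lemma summable_freq (z : Fin N → α) : Summable (freq z) := by
  classical
  refine summable_of_hasFiniteSupport ((Set.finite_range z).subset fun a ha => ?_)
  by_contra h
  refine ha ?_
  simp only [freq]
  rw [Finset.sum_eq_zero, zero_div]
  intro i _
  rw [if_neg]
  rintro rfl
  exact h ⟨i, rfl⟩

variable [MeasurableSpace α]

/-- The centered number of visits to `B` -/
def visitDev (π : Measure α) (B : Set α) (z : Fin N → α) : ℝ :=
  ∑ i, (B.indicator 1 (z i) - π.real B)

lemma hasSubgaussianMGF_indicator [DiscreteMeasurableSpace α] (π : Measure α) [IsProbabilityMeasure π] (B : Set α) :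
    HasSubgaussianMGF (fun a => B.indicator (1 : α → ℝ) a - π.real B) (1 / 4) π := by
  have h := hasSubgaussianMGF_of_mem_Icc (μ := π) (X := B.indicator (1 : α → ℝ)) (a := 0) (b := 1)
    (Measurable.of_discrete).aemeasurable (ae_of_all _ fun a => by
      by_cases h : a ∈ B <;> simp [h])
  rw [integral_indicator_one .of_discrete] at h
  convert h using 1
  rw [sub_zero, nnnorm_one]
  norm_num

lemma hoeffding_visitDev [DiscreteMeasurableSpace α] (π : Measure α) [IsProbabilityMeasure π] (B : Set α) {x : ℝ}
    (hx : 0 ≤ x) :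
    (Measure.pi fun _ : Fin N => π).real {z | x * N ≤ visitDev π B z} ≤
      Real.exp (-(2 * N * x ^ 2)) := by
  have hind : iIndepFun (fun (i : Fin N) (z : Fin N → α) =>
      B.indicator (1 : α → ℝ) (z i) - π.real B) (Measure.pi fun _ : Fin N => π) :=
    iIndepFun_pi (X := fun _ a => B.indicator (1 : α → ℝ) a - π.real B)
      fun i => (Measurable.of_discrete).aemeasurable
  have hsub : ∀ i ∈ (Finset.univ : Finset (Fin N)), HasSubgaussianMGF
      (fun z : Fin N → α => B.indicator (1 : α → ℝ) (z i) - π.real B) (1 / 4)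
      (Measure.pi fun _ : Fin N => π) := fun i _ => by
    refine HasSubgaussianMGF.of_map (X := fun a => B.indicator (1 : α → ℝ) a - π.real B)
      (Y := fun z : Fin N → α => z i) (measurable_pi_apply i).aemeasurable ?_
    rw [(measurePreserving_eval (fun _ : Fin N => π) i).map_eq]
    exact hasSubgaussianMGF_indicator π B
  refine (HasSubgaussianMGF.measure_sum_ge_le_of_iIndepFun hind hsub (by positivity)).trans (le_of_eq ?_)
  congr 1
  rcases Nat.eq_zero_or_pos N with rfl | hN
  · simp
  · have : (0 : ℝ) < N := by exact_mod_cast hN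
    simp
    field_simp
    ring

/-- By Jensen the mean absolute deviation is at most the standard deviation, and the variance is at
most `N * π.real B` because an indicator equals its square. Summed over singletons, this produces ∑
√p. -/
lemma integral_abs_visitDev_le [DiscreteMeasurableSpace α] (π : Measure α) [IsProbabilityMeasure π] (B : Set α) :
    ∫⁻ z, ENNReal.ofReal |visitDev π B z| ∂(Measure.pi fun _ : Fin N => π) ≤
      ENNReal.ofReal √(N * π.real B) := by
  set ν := Measure.pi fun _ : Fin N => π
  let X : α → ℝ := B.indicator (1 : α → ℝ)
  have hX : MemLp X 2 π := MemLp.of_bound (Measurable.of_discrete).aestronglyMeasurable 1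
    (ae_of_all _ fun a => by by_cases h : a ∈ B <;> simp [X, h])
  have hXi : ∀ i : Fin N, MemLp (fun z : Fin N → α => X (z i)) 2 ν := fun i =>
    hX.comp_measurePreserving (measurePreserving_eval (fun _ : Fin N => π) i)
  have hEX : π[X] = π.real B := integral_indicator_one .of_discrete
  have hvar : Var[X; π] ≤ π.real B := by
    refine (variance_le_expectation_sq (Measurable.of_discrete).aestronglyMeasurable).trans ?_
    rw [← hEX]
    refine le_of_eq (integral_congr_ae (ae_of_all _ fun a => ?_))
    by_cases h : a ∈ B <;> simp [X, h]
  have hS : MemLp (fun z : Fin N → α => ∑ i, X (z i)) 2 ν := memLp_finsetSum _ fun i _ => hXi i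
  have hES : ∫ z, ∑ i, X (z i) ∂ν = N * π.real B := by
    rw [integral_finsetSum _ fun i _ => (hXi i).integrable one_le_two]
    have h : ∀ i : Fin N, ∫ z : Fin N → α, X (z i) ∂ν = π.real B := fun i => by
      rw [integral_comp_eval (μ := fun _ : Fin N => π) (i := i) (f := X)
        (Measurable.of_discrete).aestronglyMeasurable, hEX]
    simp [h]
  have hZ : visitDev π B = fun z : Fin N → α => ∑ i, X (z i) - N * π.real B := by
    funext z
    simp [visitDev, X]
  have hZL : MemLp (visitDev (N := N) π B) 2 ν := by
    rw [hZ]; exact hS.sub (memLp_const _)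
  have hV : ∫ z, visitDev π B z ^ 2 ∂ν ≤ N * π.real B := by
    have h1 := variance_eq_integral hS.aestronglyMeasurable.aemeasurable
    rw [hES] at h1
    have h2 := variance_sum_pi (μ := fun _ : Fin N => π) (X := fun _ => X) fun _ => hX
    have h3 : (∑ i : Fin N, fun z : Fin N → α => X (z i)) = fun z => ∑ i, X (z i) := by
      funext z; simp
    rw [h3] at h2
    rw [hZ, ← h1, h2, Finset.sum_const, Finset.card_univ, Fintype.card_fin, nsmul_eq_mul]
    exact mul_le_mul_of_nonneg_left hvar (Nat.cast_nonneg N)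
  have hI : Integrable (fun z => |visitDev (N := N) π B z|) ν :=
    (hZL.integrable one_le_two).abs
  rw [← ofReal_integral_eq_lintegral_ofReal hI (ae_of_all _ fun z => abs_nonneg _)]
  refine ENNReal.ofReal_le_ofReal (Real.le_sqrt_of_sq_le ?_)
  have h4 := variance_nonneg (fun z => |visitDev (N := N) π B z|) ν
  rw [variance_eq_sub (X := fun z => |visitDev (N := N) π B z|) hZL.abs] at h4
  simp only [Pi.pow_apply, sq_abs] at h4
  linarith

lemma freq_sub_mul (π : Measure α) (hN : 0 < N) (z : Fin N → α) (a : α) :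
    freq z a - π.real {a} = visitDev π {a} z / N := by
  have : (N : ℝ) ≠ 0 := by positivity
  simp only [freq, visitDev, Finset.sum_sub_distrib, Finset.sum_const, Finset.card_univ,
    Fintype.card_fin, nsmul_eq_mul]
  rw [sub_div, mul_div_cancel_left₀ _ this]
  congr 3

/-- Mean `L₁` deviation of the empirical measure. -/
lemma lintegral_empDev_le [DiscreteMeasurableSpace α] [Countable α]
    (π : Measure α) [IsProbabilityMeasure π] (hN : 0 < N) :
    ∫⁻ z, empDev (fun a => π.real {a}) z ∂(Measure.pi fun _ : Fin N => π) ≤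
      ENNReal.ofReal (1 / √N) * ∑' a, ENNReal.ofReal √(π.real {a}) := by
  have hN' : (0 : ℝ) < N := by exact_mod_cast hN
  unfold empDev
  rw [lintegral_tsum fun a => (Measurable.of_discrete).aemeasurable, ← ENNReal.tsum_mul_left]
  refine ENNReal.tsum_le_tsum fun a => ?_
  calc ∫⁻ z, ENNReal.ofReal |freq z a - π.real {a}| ∂(Measure.pi fun _ : Fin N => π)
      = ENNReal.ofReal (1 / N) *
        ∫⁻ z, ENNReal.ofReal |visitDev π {a} z| ∂(Measure.pi fun _ : Fin N => π) := by
        rw [← lintegral_const_mul _ Measurable.of_discrete]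
        refine lintegral_congr fun z => ?_
        rw [freq_sub_mul π hN, abs_div, abs_of_pos hN', ← ENNReal.ofReal_mul (by positivity)]
        congr 1
        ring
    _ ≤ ENNReal.ofReal (1 / N) * ENNReal.ofReal √(N * π.real {a}) := by
        gcongr
        exact integral_abs_visitDev_le π {a}
    _ = _ := by
        rw [← ENNReal.ofReal_mul (by positivity), ← ENNReal.ofReal_mul (by positivity),
          Real.sqrt_mul hN'.le]
        congr 1
        have h := Real.mul_self_sqrt hN'.le
        have h0 : √(N : ℝ) ≠ 0 := (Real.sqrt_pos.2 hN').ne'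
        field_simp
        rw [sq, h]

lemma tsum_indicator_freq (hN : 0 < N) (π : Measure α) (z : Fin N → α) (B : Set α) :
    ∑' a, B.indicator (freq z) a = visitDev π B z / N + π.real B := by
  classical
  have h1 : ∀ a, B.indicator (freq z) a
      = (∑ i, if a = z i then B.indicator (1 : α → ℝ) (z i) else 0) / N := fun a => by
    by_cases ha : a ∈ B
    · simp only [Set.indicator_of_mem ha, freq]
      congr 1
      refine Finset.sum_congr rfl fun i _ => ?_
      by_cases h : z i = a
      · subst h; simp [ha]
      · simp [h, Ne.symm h]
    · simp only [Set.indicator_of_notMem ha]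
      rw [Finset.sum_eq_zero, zero_div]
      intro i _
      by_cases h : a = z i
      · subst h; simp [ha]
      · simp [h]
  have hN' : (N : ℝ) ≠ 0 := by positivity
  simp_rw [h1]
  rw [tsum_div_const, Summable.tsum_finsetSum fun i _ => (hasSum_ite_eq _ _).summable]
  simp_rw [tsum_ite_eq]
  simp only [visitDev, Finset.sum_sub_distrib, Finset.sum_const, Finset.card_univ,
    Fintype.card_fin, nsmul_eq_mul]
  field_simp
  ring

lemma hasSum_real_singleton [DiscreteMeasurableSpace α] [Countable α]
    (π : Measure α) [IsProbabilityMeasure π] :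
    HasSum (fun a => π.real {a}) 1 := by
  have h := π.tsum_indicator_apply_singleton Set.univ .univ
  simp only [Set.indicator_univ, measure_univ] at h
  have hs := ENNReal.hasSum_toReal (h ▸ ENNReal.one_ne_top : ∑' a, π {a} ≠ ∞)
  have h2 : (∑' a, (π {a}).toReal) = 1 := by
    rw [← ENNReal.tsum_toReal_eq fun a => measure_ne_top _ _, h, ENNReal.toReal_one]
  exact h2 ▸ hs

lemma tsum_indicator_real [DiscreteMeasurableSpace α] [Countable α]
    (π : Measure α) [IsProbabilityMeasure π] (B : Set α) :
    ∑' a, B.indicator (fun a => π.real {a}) a = π.real B := by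
  rw [Measure.real, ← π.tsum_indicator_apply_singleton B .of_discrete,
    ENNReal.tsum_toReal_eq fun a => by
      by_cases h : a ∈ B <;> simp [h]]
  refine tsum_congr fun a => ?_
  by_cases h : a ∈ B <;> simp [h, Measure.real]

/-- If the empirical measure is close to `p`, which is far from `π`, then a set on which `p`
exceeds `π` is visited too often under `π`. -/
lemma exists_visitDev_ge [DiscreteMeasurableSpace α] [Countable α]
    (π : Measure α) [IsProbabilityMeasure π] {p : α → ℝ}
    (hp : HasSum p 1) {x : ℝ} (hx : 4 * x ≤ ∑' a, |p a - π.real {a}|) (hN : 0 < N) :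
    ∃ B : Set α, ∀ z : Fin N → α, empDev p z < ENNReal.ofReal x → x * N ≤ visitDev π B z := by
  have hN' : (0 : ℝ) < N := by exact_mod_cast hN
  set r : α → ℝ := fun a => π.real {a}
  have hr : HasSum r 1 := hasSum_real_singleton π
  -- This set realises the total variation distance and does not depend on the sample, so
  -- Hoeffding's inequality applies to it.
  let B : Set α := {a | r a ≤ p a}
  have hd : HasSum (fun a => p a - r a) 0 := by simpa using hp.sub hr
  have habs : Summable fun a => |p a - r a| := hd.summable.abs
  have hB : ∑' a, B.indicator (fun a => p a - r a) a = (∑' a, |p a - r a|) / 2 := by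
    have h1 : ∀ a, B.indicator (fun a => p a - r a) a = (|p a - r a| + (p a - r a)) / 2 :=
      fun a => by
        by_cases h : r a ≤ p a
        · rw [Set.indicator_of_mem (by exact h), abs_of_nonneg (sub_nonneg.2 h)]; ring
        · rw [Set.indicator_of_notMem (by exact h), abs_of_neg (by linarith [not_le.1 h])]; ring
    simp_rw [h1]
    rw [tsum_div_const, habs.tsum_add hd.summable, hd.tsum_eq, add_zero]
  refine ⟨B, fun z hz => ?_⟩
  have hf : Summable (fun a => |freq z a - p a|) := ((summable_freq z).sub hp.summable).abs
  have hlt : ∑' a, |freq z a - p a| < x := by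
    unfold empDev at hz
    rw [← ENNReal.ofReal_tsum_of_nonneg (fun a => abs_nonneg _) hf] at hz
    exact (ENNReal.ofReal_lt_ofReal_iff_of_nonneg (tsum_nonneg fun a => abs_nonneg _)).1 hz
  have h2 : ∑' a, B.indicator p a - ∑' a, B.indicator (freq z) a ≤ ∑' a, |freq z a - p a| := by
    rw [← (hp.summable.indicator B).tsum_sub ((summable_freq z).indicator B)]
    refine Summable.tsum_le_tsum (fun a => ?_)
      ((hp.summable.indicator B).sub ((summable_freq z).indicator B)) hf
    by_cases h : a ∈ B
    · simp only [Set.indicator_of_mem h]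
      rw [abs_sub_comm]; exact le_abs_self _
    · simp [h]
  have h3 : ∑' a, B.indicator p a - π.real B = (∑' a, |p a - r a|) / 2 := by
    rw [← hB, ← tsum_indicator_real π B, ← (hp.summable.indicator B).tsum_sub
      (hr.summable.indicator B)]
    refine tsum_congr fun a => ?_
    by_cases h : a ∈ B <;> simp [h, r]
  rw [tsum_indicator_freq hN π] at h2
  -- `p` exceeds `π` on `B` by half the L₁ distance, hence by at least 2x, and the empirical measure
  -- loses less than x of it.
  have h4 : x ≤ visitDev π B z / N := by linarith
  rwa [le_div_iff₀ hN'] at h4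

end Empirical

/-! ### Le Cam's method with mass moved between two points -/

section

variable {k : ℕ}

/-! ### Minimax lower bound -/

/-- Le Cam's two-point bound. -/
lemma obsMinimaxRisk_ge_of_two_points {S : Set (Param k)} {θ₀ θ₁ : Param k} (h₀ : θ₀ ∈ S)
    (h₁ : θ₁ ∈ S) (ℓ n : ℕ) {Δ c : ℝ≥0∞}
    (hΔ : Δ ≤ ∑' z : Fin ℓ → ℕ+, ENNReal.ofReal |obsDensity θ₀ ℓ z - obsDensity θ₁ ℓ z|)
    (hc : c ≤ ∑' y : Fin n → ℕ+,
      min (ENNReal.ofReal (obsDensity θ₀ n y)) (ENNReal.ofReal (obsDensity θ₁ n y))) :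
    c * Δ / 2 ≤ obsMinimaxRisk S ℓ n := by
  refine le_iInf fun T => ?_
  set R : Param k → ℝ≥0∞ := fun θ => ∑' y : Fin n → ℕ+, ENNReal.ofReal (obsDensity θ n y) *
    ∑' z : Fin ℓ → ℕ+, ENNReal.ofReal |T y z - obsDensity θ ℓ z| with hR
  have h2 : c * Δ ≤ R θ₀ + R θ₁ := by
    rw [hR, ← ENNReal.tsum_add]
    calc c * Δ ≤ (∑' y : Fin n → ℕ+, min (ENNReal.ofReal (obsDensity θ₀ n y))
          (ENNReal.ofReal (obsDensity θ₁ n y))) * Δ := by gcongr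
      _ ≤ _ := by
        rw [← ENNReal.tsum_mul_right]
        refine ENNReal.tsum_le_tsum fun y => ?_
        -- No estimate is close to both densities: for each `y` the two losses add up to at least
        -- `Δ`.
        have h3 : Δ ≤ (∑' z : Fin ℓ → ℕ+, ENNReal.ofReal |T y z - obsDensity θ₀ ℓ z|) +
            ∑' z : Fin ℓ → ℕ+, ENNReal.ofReal |T y z - obsDensity θ₁ ℓ z| := by
          rw [← ENNReal.tsum_add]
          refine hΔ.trans (ENNReal.tsum_le_tsum fun z => ?_)
          rw [← ENNReal.ofReal_add (abs_nonneg _) (abs_nonneg _)]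
          refine ENNReal.ofReal_le_ofReal ?_
          rw [abs_sub_comm (T y z)]
          exact abs_sub_le _ _ _
        refine (mul_le_mul_right h3 _).trans ?_
        rw [mul_add]
        gcongr
        · exact min_le_left _ _
        · exact min_le_right _ _
  have h4 : R θ₀ + R θ₁ ≤ 2 * ⨆ θ ∈ S, R θ := by
    rw [two_mul]
    exact add_le_add (le_iSup₂ (f := fun θ (_ : θ ∈ S) => R θ) θ₀ h₀)
      (le_iSup₂ (f := fun θ (_ : θ ∈ S) => R θ) θ₁ h₁)
  refine ENNReal.div_le_of_le_mul ?_
  exact (h2.trans h4).trans (mul_comm _ _).le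

/-- Applied to a likelihood ratio, it bounds the overlap of two laws from below through a second
moment, which factorises along a hidden path. For G ≥ 1 it is 0 ≤ (G - 1)² + 1. -/
lemma ennreal_le_min_one_add (G : ℝ≥0∞) : G ≤ min 1 G + 2⁻¹ * G ^ 2 := by
  rcases le_total G 1 with h | h
  · rw [min_eq_right h]; exact le_self_add
  · rw [min_eq_left h]
    rcases eq_or_ne G ∞ with rfl | hG
    · simp
    · lift G to ℝ≥0 using hG
      have : ((2 : ℝ≥0∞)⁻¹) = ((2⁻¹ : ℝ≥0) : ℝ≥0∞) := by simp
      rw [this]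
      norm_cast
      rw [← NNReal.coe_le_coe]
      push_cast
      nlinarith [sq_nonneg ((G : ℝ) - 1)]

/-- Two hidden Markov models with the same transition matrix and close emission densities have
close laws. -/
lemma tsum_min_obsDensity_ge {Q : TransMat k} {f f' : Fin k → Emission}
    (hμ : statDist Q ∈ stdSimplex ℝ (Fin k)) (hf : ∀ j l, 0 < (f j).1 l) {κ : ℝ≥0∞} (n : ℕ)
    (hκ : ∀ j, ∑' l, ENNReal.ofReal ((f' j).1 l ^ 2 / (f j).1 l) ≤ κ) :
    1 ≤ (∑' y : Fin n → ℕ+, min (ENNReal.ofReal (obsDensity (Q, f) n y))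
      (ENNReal.ofReal (obsDensity (Q, f') n y))) + 2⁻¹ * κ ^ n := by
  let g : Fin k → ℕ+ → ℝ≥0∞ := fun j l => ENNReal.ofReal ((f' j).1 l / (f j).1 l)
  have hg : ∀ j l, emit (Q, f') j l = emit (Q, f) j l * g j l := fun j l => by
    simp only [emit, g]
    rw [← ENNReal.ofReal_mul (hf j l).le, mul_div_cancel₀ _ (hf j l).ne']
  have hg2 : ∀ j l, emit (Q, f) j l * g j l ^ 2 = ENNReal.ofReal ((f' j).1 l ^ 2 / (f j).1 l) :=
    fun j l => by
      simp only [emit, g]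
      rw [← ENNReal.ofReal_pow (div_nonneg ((f' j).2.1 l) (hf j l).le),
        ← ENNReal.ofReal_mul (hf j l).le]
      congr 1
      have := (hf j l).ne'
      field_simp
  let W : (Fin n → Fin k) → ℝ≥0∞ := fun x => ENNReal.ofReal (chainWeight (statDist Q) Q n x)
  have hW : ∑ x, W x = 1 := by
    have := sum_chainWeight_mul_prod (Q := Q) hμ n fun _ _ => 1
    simpa [pathSum_one Q hμ] using this
  have hpt : ∀ y : Fin n → ℕ+, ENNReal.ofReal (obsDensity (Q, f') n y) ≤
      min (ENNReal.ofReal (obsDensity (Q, f) n y)) (ENNReal.ofReal (obsDensity (Q, f') n y)) +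
      2⁻¹ * ∑ x, W x * ∏ i, (emit (Q, f) (x i) (y i) * g (x i) (y i) ^ 2) := fun y => by
    -- The comparison is made path by path, where both joint laws are products with the same chain
    -- weight. Afterwards, the sum over paths of the minima is at most the minimum of the sums.
    have h1 : ∀ x : Fin n → Fin k, W x * ∏ i, emit (Q, f') (x i) (y i) ≤
        min (W x * ∏ i, emit (Q, f) (x i) (y i)) (W x * ∏ i, emit (Q, f') (x i) (y i)) +
        2⁻¹ * (W x * ∏ i, (emit (Q, f) (x i) (y i) * g (x i) (y i) ^ 2)) := fun x => by
      simp_rw [hg, Finset.prod_mul_distrib, Finset.prod_pow]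
      set G := ∏ i, g (x i) (y i)
      set E := ∏ i, emit (Q, f) (x i) (y i)
      calc W x * (E * G) = W x * E * G := (mul_assoc _ _ _).symm
        _ ≤ W x * E * (min 1 G + 2⁻¹ * G ^ 2) := by gcongr; exact ennreal_le_min_one_add G
        _ = W x * E * min 1 G + 2⁻¹ * (W x * (E * G ^ 2)) := by ring
        _ ≤ _ := by
          gcongr
          refine le_min ?_ ?_
          · exact (mul_le_mul_right (min_le_left 1 G) _).trans (mul_one _).le
          · rw [← mul_assoc]; exact mul_le_mul_right (min_le_right 1 G) _
    rw [ofReal_obsDensity, ofReal_obsDensity, Finset.mul_sum]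
    refine (Finset.sum_le_sum fun x _ => h1 x).trans ?_
    rw [Finset.sum_add_distrib]
    gcongr
    exact le_min (Finset.sum_le_sum fun x _ => min_le_left _ _)
      (Finset.sum_le_sum fun x _ => min_le_right _ _)
  rw [← tsum_obsDensity (θ := (Q, f')) hμ n]
  refine (ENNReal.tsum_le_tsum hpt).trans ?_
  rw [ENNReal.tsum_add, ENNReal.tsum_mul_left, Summable.tsum_finsetSum fun _ _ => ENNReal.summable]
  gcongr
  calc ∑ x, ∑' y : Fin n → ℕ+, W x * ∏ i, (emit (Q, f) (x i) (y i) * g (x i) (y i) ^ 2)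
      ≤ ∑ x, W x * κ ^ n := by
        refine Finset.sum_le_sum fun x _ => ?_
        rw [ENNReal.tsum_mul_left,
          tsum_prod_fin n fun i l => emit (Q, f) (x i) l * g (x i) l ^ 2]
        gcongr
        refine (Finset.prod_le_pow_card _ _ κ fun i _ => ?_).trans (by simp)
        simp_rw [hg2]
        exact hκ _
    _ = κ ^ n := by rw [← Finset.sum_mul, hW, one_mul]

/-- Mass `h` moved from `1` to `2`. -/
def moveMass (f : Emission) (h : ℝ) (h0 : 0 ≤ h) (h1 : h ≤ f.1 1) : Emission :=
  ⟨fun l => f.1 l + (if l = 2 then h else 0) - (if l = 1 then h else 0), fun l => by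
    have := f.2.1 l
    by_cases hl : l = 1
    · subst hl
      have : (1 : ℕ+) ≠ 2 := by decide
      simp [this, h1]
    · simp only [hl, if_false, sub_zero]
      split_ifs <;> linarith, by
    simpa using (f.2.2.add (hasSum_ite_eq 2 h)).sub (hasSum_ite_eq 1 h)⟩

lemma moveMass_one (f : Emission) {h : ℝ} (h0 : 0 ≤ h) (h1 : h ≤ f.1 1) :
    (moveMass f h h0 h1).1 1 = f.1 1 - h := by
  have : (1 : ℕ+) ≠ 2 := by decide
  simp [moveMass, this]

lemma moveMass_two (f : Emission) {h : ℝ} (h0 : 0 ≤ h) (h1 : h ≤ f.1 1) :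
    (moveMass f h h0 h1).1 2 = f.1 2 + h := by
  have : (2 : ℕ+) ≠ 1 := by decide
  simp [moveMass, this]

lemma moveMass_of_ne (f : Emission) {h : ℝ} (h0 : 0 ≤ h) (h1 : h ≤ f.1 1) {l : ℕ+} (hl1 : l ≠ 1)
    (hl2 : l ≠ 2) : (moveMass f h h0 h1).1 l = f.1 l := by
  simp [moveMass, hl1, hl2]

/-- The first-order terms 2h and -2h cancel, so the second moment of the density ratio exceeds 1
only by a quantity of order h². -/
lemma hasSum_sq_moveMass_div (f : Emission) (hf : ∀ l, 0 < f.1 l) {h : ℝ} (h0 : 0 ≤ h)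
    (h1 : h ≤ f.1 1) :
    HasSum (fun l => (moveMass f h h0 h1).1 l ^ 2 / f.1 l)
      (1 + (2 * h + h ^ 2 / f.1 2) + (-(2 * h) + h ^ 2 / f.1 1)) := by
  have h3 := (f.2.2.add (hasSum_ite_eq 2 (2 * h + h ^ 2 / f.1 2))).add
    (hasSum_ite_eq 1 (-(2 * h) + h ^ 2 / f.1 1))
  convert h3 using 1
  funext l
  have hl := (hf l).ne'
  have h12 : (1 : ℕ+) ≠ 2 := by decide
  by_cases hl1 : l = 1
  · subst hl1
    rw [moveMass_one, if_neg h12, if_pos rfl]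
    field_simp
    ring
  · by_cases hl2 : l = 2
    · subst hl2
      rw [moveMass_two, if_neg hl1, if_pos rfl]
      field_simp
      ring
    · rw [moveMass_of_ne f h0 h1 hl1 hl2, if_neg hl1, if_neg hl2]
      field_simp
      ring

/-- The L₁ distance dominates the difference of the probabilities that the first observation is 1.
As both models share `Q`, their stationary weights agree and sum to 1, and this difference is `h`.
-/
lemma obsDensity_diff_ge {Q : TransMat k} {f f' : Fin k → Emission}
    (hμ : statDist Q ∈ stdSimplex ℝ (Fin k)) {h : ℝ} (h0 : 0 ≤ h)
    (hff' : ∀ j, (f j).1 1 = (f' j).1 1 + h) {ℓ : ℕ} (hℓ : 1 ≤ ℓ) :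
    ENNReal.ofReal h ≤ ∑' z : Fin ℓ → ℕ+,
      ENNReal.ofReal |obsDensity (Q, f) ℓ z - obsDensity (Q, f') ℓ z| := by
  let w : ℕ → ℕ+ → ℝ≥0∞ := fun t l => if t = 0 then (if l = 1 then 1 else 0) else 1
  have hw : ∀ t l, w t l ≤ 1 := fun t l => by simp only [w]; split_ifs <;> simp
  have hmarg : ∀ f : Fin k → Emission, ∑' z : Fin ℓ → ℕ+,
      ENNReal.ofReal (obsDensity (Q, f) ℓ z) * ∏ i : Fin ℓ, w i (z i) =
      ∑ x, ENNReal.ofReal (statDist Q x) * emit (Q, f) x 1 := fun f => by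
    rw [tsum_obsDensity_mul_prod (θ := (Q, f)) hμ]
    obtain ⟨r, rfl⟩ : ∃ r, ℓ = r + 1 := ⟨ℓ - 1, by omega⟩
    rw [pathSum]
    refine Finset.sum_congr rfl fun x _ => ?_
    simp only [bwd]
    simp only [w, Nat.succ_ne_zero, if_false, mul_one, tsum_emit, bwd_one_one, if_true, sum_kern]
    rw [tsum_eq_single 1] <;> simp +contextual
  have h1 : ∑ x, ENNReal.ofReal (statDist Q x) * emit (Q, f) x 1 =
      (∑ x, ENNReal.ofReal (statDist Q x) * emit (Q, f') x 1) + ENNReal.ofReal h := by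
    have h2 : ∑ x, ENNReal.ofReal (statDist Q x) = 1 := by
      rw [← ENNReal.ofReal_sum_of_nonneg fun j _ => hμ.1 j, hμ.2, ENNReal.ofReal_one]
    simp only [emit, hff']
    simp_rw [ENNReal.ofReal_add ((f' _).2.1 1) h0, mul_add, Finset.sum_add_distrib,
      ← Finset.sum_mul, h2, one_mul]
  have hfin : ∑ x, ENNReal.ofReal (statDist Q x) * emit (Q, f') x 1 ≠ ∞ :=
    ENNReal.sum_ne_top.2 fun x _ => ENNReal.mul_ne_top ENNReal.ofReal_ne_top ENNReal.ofReal_ne_top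
  refine (ENNReal.add_le_add_iff_left hfin).1 ?_
  rw [← h1, ← hmarg f, ← hmarg f', ← ENNReal.tsum_add]
  refine ENNReal.tsum_le_tsum fun z => ?_
  have hW : ∏ i : Fin ℓ, w i (z i) ≤ 1 := Finset.prod_le_one' fun i _ => hw _ _
  set W := ∏ i : Fin ℓ, w i (z i)
  calc ENNReal.ofReal (obsDensity (Q, f) ℓ z) * W
      ≤ (ENNReal.ofReal (obsDensity (Q, f') ℓ z) +
        ENNReal.ofReal |obsDensity (Q, f) ℓ z - obsDensity (Q, f') ℓ z|) * W := by
        gcongr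
        rw [← ENNReal.ofReal_add (obsDensity_nonneg _ _ _) (abs_nonneg _)]
        refine ENNReal.ofReal_le_ofReal ?_
        linarith [le_abs_self (obsDensity (Q, f) ℓ z - obsDensity (Q, f') ℓ z)]
    _ ≤ _ := by
        rw [add_mul]
        gcongr
        exact mul_le_of_le_one_right' hW

/-- The new constants do not depend on `h`, so one class contains the alternatives for every n. The
mass at 2 is merely bounded by 1, whence exp(c 2^m) ≤ d'; at most halving the mass at 1 adds log 2
to the weighted sum, and N^K ≥ 1 absorbs it. -/
lemma moveMass_mem_envelopeClass {m c K d B : ℝ} {N₀ : ℕ+} (hK : 0 < K) {f : Emission}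
    (hf : f ∈ envelopeClass m c K d B N₀) {h : ℝ} (h0 : 0 ≤ h) (h1 : h ≤ f.1 1)
    (h2 : h ≤ f.1 1 / 2) {d' B' : ℝ} (hd' : d ≤ d') (hd2 : Real.exp (c * (2 : ℝ) ^ m) ≤ d')
    (hB' : B + Real.log 2 ≤ B') :
    moveMass f h h0 h1 ∈ envelopeClass m c K d' B' N₀ := by
  obtain ⟨hpos, henv, hsum⟩ := hf
  have hpos' : ∀ l, 0 < (moveMass f h h0 h1).1 l := fun l => by
    by_cases hl1 : l = 1
    · subst hl1; rw [moveMass_one]; linarith [hpos 1]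
    · by_cases hl2 : l = 2
      · subst hl2; rw [moveMass_two]; linarith [hpos 2]
      · rw [moveMass_of_ne f h0 h1 hl1 hl2]; exact hpos l
  refine ⟨hpos', fun l => ?_, fun N hN => ?_⟩
  · have h3 : d * Real.exp (-(c * (l : ℝ) ^ m)) ≤ d' * Real.exp (-(c * (l : ℝ) ^ m)) := by
      gcongr
    by_cases hl1 : l = 1
    · subst hl1; rw [moveMass_one]; linarith [henv 1]
    · by_cases hl2 : l = 2
      · subst hl2
        have h4 : (moveMass f h h0 h1).1 2 ≤ 1 :=
          le_hasSum (moveMass f h h0 h1).2.2 2 fun j _ => (moveMass f h h0 h1).2.1 j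
        refine h4.trans ?_
        rw [Real.exp_neg, ← div_eq_mul_inv, le_div_iff₀ (Real.exp_pos _), one_mul]
        simpa using hd2
      · rw [moveMass_of_ne f h0 h1 hl1 hl2]; exact (henv l).trans h3
  · have h3 : ∀ l : ℕ+, -Real.log ((moveMass f h h0 h1).1 l) / (l : ℝ) ≤
        -Real.log (f.1 l) / (l : ℝ) + if l = 1 then Real.log 2 else 0 := fun l => by
      by_cases hl1 : l = 1
      · subst hl1
        have h4 : Real.log (f.1 1 / 2) ≤ Real.log ((moveMass f h h0 h1).1 1) :=
          Real.log_le_log (by linarith [hpos 1]) (by rw [moveMass_one]; linarith)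
        rw [Real.log_div (hpos 1).ne' two_ne_zero] at h4
        simp
        linarith
      · rw [if_neg hl1, add_zero]
        gcongr
        · exact hpos l
        · by_cases hl2 : l = 2
          · subst hl2; rw [moveMass_two]; linarith
          · rw [moveMass_of_ne f h0 h1 hl1 hl2]
    have h5 : (1 : ℝ) ≤ (N : ℝ) ^ K :=
      Real.one_le_rpow (by exact_mod_cast (one_le : 1 ≤ N)) hK.le
    have h6 : Real.log 2 ≤ Real.log 2 * (N : ℝ) ^ K :=
      le_mul_of_one_le_right (Real.log_nonneg one_le_two) h5
    calc _ ≤ ∑ l ∈ Finset.Icc 1 N, (-Real.log (f.1 l) / (l : ℝ) +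
          if l = 1 then Real.log 2 else 0) := Finset.sum_le_sum fun l _ => h3 l
      _ ≤ B * (N : ℝ) ^ K + Real.log 2 * (N : ℝ) ^ K := by
        rw [Finset.sum_add_distrib, Finset.sum_ite_eq', if_pos (by simp)]
        exact add_le_add (hsum N hN) h6
      _ ≤ B' * (N : ℝ) ^ K := by
        rw [← add_mul]
        gcongr

lemma envelopeClass_mono {m c K d B d' B' : ℝ} {N₀ N₀' : ℕ+} (hd : d ≤ d') (hB : B ≤ B')
    (hN : N₀ ≤ N₀') : envelopeClass m c K d B N₀ ⊆ envelopeClass m c K d' B' N₀' :=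
  fun f hf => ⟨hf.1, fun l => (hf.2.1 l).trans (by gcongr), fun N hN' =>
    (hf.2.2 N (hN.trans hN')).trans (by gcongr)⟩

lemma LinkedTails.moveMass {m c : ℝ} {f : Fin k → Emission} (hf : LinkedTails m c f) {h : ℝ}
    (h0 : 0 ≤ h) (h1 : ∀ j, h ≤ (f j).1 1) :
    LinkedTails m c fun j => moveMass (f j) h h0 (h1 j) := by
  obtain ⟨δ, C, hδ, hev⟩ := hf
  refine ⟨δ, C, hδ, ?_⟩
  filter_upwards [hev, eventually_ge_atTop 3] with N hN h3 i j
  have heq : (fun l : Set.Ici N => (BayesHMM.moveMass (f i) h h0 (h1 i)).1 l *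
      Real.log ((BayesHMM.moveMass (f j) h h0 (h1 j)).1 l) ^ 2) =
      fun l : Set.Ici N => (f i).1 l * Real.log ((f j).1 l) ^ 2 := by
    funext l
    have hl : (3 : ℕ+) ≤ l := h3.trans l.2
    have h31 : (1 : ℕ+) < 3 := by decide
    have h32 : (2 : ℕ+) < 3 := by decide
    rw [moveMass_of_ne _ _ _ (h31.trans_le hl).ne' (h32.trans_le hl).ne',
      moveMass_of_ne _ _ _ (h31.trans_le hl).ne' (h32.trans_le hl).ne']
  rw [heq]
  exact hN i j

theorem exists_obsMinimaxRisk_ge (hk : 1 ≤ k) (θs : Param k) {qs : ℝ} (hqs : 0 < qs)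
    (hQs : θs.1 ∈ transMatGE k qs) {m c K : ℝ} (hK : 0 < K)
    (hfs : ∀ j, θs.2 j ∈ emissionClass m c K) (hlink : LinkedTails m c θs.2) {ℓ : ℕ}
    (hℓ : 1 ≤ ℓ) :
    ∃ (d B : ℝ) (N₀ : ℕ+), θs ∈ uniformClass k qs m c K d B N₀ ∧
      ∃ c₀ : ℝ, 0 < c₀ ∧ ∀ n : ℕ, 1 ≤ n →
        ENNReal.ofReal (c₀ / Real.sqrt n) ≤
          obsMinimaxRisk (uniformClass k qs m c K d B N₀) ℓ n := by
  obtain ⟨Q, f⟩ := θs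
  have hμ := (isStationary_statDist hk hqs hQs).1
  choose d B N₀ hmem using hfs
  obtain ⟨d₁, hd₁⟩ := Finite.exists_le d
  obtain ⟨B₁, hB₁⟩ := Finite.exists_le B
  obtain ⟨N₁, hN₁⟩ := Finite.exists_le N₀
  have hpos : ∀ j l, 0 < (f j).1 l := fun j => (hmem j).1
  set d' := max d₁ (Real.exp (c * (2 : ℝ) ^ m))
  set B' := B₁ + Real.log 2
  have hlog2 : 0 ≤ Real.log 2 := Real.log_nonneg one_le_two
  -- a common lower bound for the masses of `1` and `2`
  obtain ⟨a, ha0, ha1, ha2⟩ : ∃ a : ℝ, 0 < a ∧ (∀ j, a ≤ (f j).1 1) ∧ ∀ j, a ≤ (f j).1 2 := by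
    obtain ⟨M, hM⟩ := Finite.exists_le fun j => max ((f j).1 1)⁻¹ ((f j).1 2)⁻¹
    have hM0 : 0 < M := (inv_pos.2 (hpos ⟨0, hk⟩ 1)).trans_le ((le_max_left _ _).trans (hM ⟨0, hk⟩))
    exact ⟨M⁻¹, inv_pos.2 hM0,
      fun j => inv_le_of_inv_le₀ (hpos j 1) ((le_max_left _ _).trans (hM j)),
      fun j => inv_le_of_inv_le₀ (hpos j 2) ((le_max_right _ _).trans (hM j))⟩
  have ha_one : a ≤ 1 := (ha1 ⟨0, hk⟩).trans
    (le_hasSum (f ⟨0, hk⟩).2.2 1 fun j _ => (f ⟨0, hk⟩).2.1 j)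
  have hθs : (Q, f) ∈ uniformClass k qs m c K d' B' N₁ :=
    ⟨hQs, hlink, fun j => envelopeClass_mono ((hd₁ j).trans (le_max_left _ _))
      ((hB₁ j).trans (by simp only [B']; linarith)) (hN₁ j) (hmem j)⟩
  -- a/32 = (a/4) · (1/4) · (1/2): the size of the shift, the overlap of the two laws, and the
  -- factor 1/2 of the two-point bound.
  refine ⟨d', B', N₁, hθs, a / 32, by positivity, fun n hn => ?_⟩
  have hn0 : (0 : ℝ) < n := by exact_mod_cast hn
  have hsq1 : 1 ≤ √(n : ℝ) := Real.one_le_sqrt.2 (by exact_mod_cast hn)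
  set h : ℝ := a / 4 / √n with hh
  have h0 : 0 < h := by positivity
  have ha4 : h ≤ a / 4 := div_le_self (by positivity) hsq1
  have h1 : ∀ j, h ≤ (f j).1 1 := fun j => by linarith [ha1 j]
  set f' : Fin k → Emission := fun j => moveMass (f j) h h0.le (h1 j)
  have hθ' : (Q, f') ∈ uniformClass k qs m c K d' B' N₁ :=
    ⟨hQs, hlink.moveMass h0.le h1, fun j => envelopeClass_mono le_rfl le_rfl (hN₁ j)
      (moveMass_mem_envelopeClass hK (hmem j) h0.le (h1 j) (by linarith [ha1 j])
        ((hd₁ j).trans (le_max_left _ _)) (le_max_right _ _) (by simp only [B']; linarith [hB₁ j]))⟩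
  -- The χ² divergence of one observation is at most 1/(4n) (using a ≤ 1), so n observations keep
  -- the second moment below e^(1/4) ≤ 3/2 and the overlap above 1 - 3/4.
  have hκ : ∀ j, ∑' l, ENNReal.ofReal ((f' j).1 l ^ 2 / (f j).1 l) ≤
      ENNReal.ofReal (1 + 1 / (4 * n)) := fun j => by
    have hs := hasSum_sq_moveMass_div (f j) (hpos j) h0.le (h1 j)
    rw [← ENNReal.ofReal_tsum_of_nonneg (fun l => div_nonneg (sq_nonneg _) (hpos j l).le)
      hs.summable, hs.tsum_eq]
    refine ENNReal.ofReal_le_ofReal ?_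
    have h2 : h ^ 2 = a ^ 2 / 16 / n := by
      rw [hh, div_pow, Real.sq_sqrt hn0.le]; ring
    have h3 : ∀ x, a ≤ x → h ^ 2 / x ≤ 1 / (8 * n) := fun x hx => by
      rw [h2, div_le_div_iff₀ (ha0.trans_le hx) (by positivity)]
      field_simp
      nlinarith
    have h4 := h3 _ (ha1 j)
    have h5 := h3 _ (ha2 j)
    have h6 : 1 / (4 * n : ℝ) = 1 / (8 * n) + 1 / (8 * n) := by field_simp; norm_num
    linarith
  have haff := tsum_min_obsDensity_ge hμ hpos n hκ
  have hκn : ENNReal.ofReal (1 + 1 / (4 * n)) ^ n ≤ ENNReal.ofReal (3 / 2) := by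
    rw [← ENNReal.ofReal_pow (by positivity)]
    refine ENNReal.ofReal_le_ofReal ?_
    calc (1 + 1 / (4 * n) : ℝ) ^ n ≤ Real.exp (1 / (4 * n)) ^ n := by
          gcongr
          rw [add_comm]
          exact Real.add_one_le_exp _
      _ = Real.exp (1 / 4) := by
          rw [← Real.exp_nat_mul]; congr 1; field_simp
      _ ≤ 3 / 2 := by
          have := Real.add_one_le_exp (-(1 / 4) : ℝ)
          rw [Real.exp_neg] at this
          have h2 : Real.exp (1 / 4) ≤ (3 / 4)⁻¹ := by
            rw [le_inv_comm₀ (Real.exp_pos _) (by norm_num)]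
            linarith
          linarith [show ((3 : ℝ) / 4)⁻¹ ≤ 3 / 2 by norm_num]
  have hmin : ENNReal.ofReal (1 / 4) ≤ ∑' y : Fin n → ℕ+,
      min (ENNReal.ofReal (obsDensity (Q, f) n y)) (ENNReal.ofReal (obsDensity (Q, f') n y)) := by
    have h2 : (2 : ℝ≥0∞)⁻¹ * ENNReal.ofReal (1 + 1 / (4 * n)) ^ n ≤ ENNReal.ofReal (3 / 4) := by
      refine (mul_le_mul_right hκn _).trans (le_of_eq ?_)
      rw [show (2 : ℝ≥0∞)⁻¹ = ENNReal.ofReal (2⁻¹) by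
        rw [ENNReal.ofReal_inv_of_pos two_pos]; simp, ← ENNReal.ofReal_mul (by norm_num)]
      norm_num
    have h3 : ENNReal.ofReal (1 / 4) + ENNReal.ofReal (3 / 4) = 1 := by
      rw [← ENNReal.ofReal_add (by norm_num) (by norm_num)]; norm_num
    refine (ENNReal.add_le_add_iff_right (ENNReal.ofReal_ne_top (r := 3 / 4))).1 ?_
    rw [h3]
    exact haff.trans (by gcongr)
  refine le_trans (le_of_eq ?_) (obsMinimaxRisk_ge_of_two_points hθs hθ' ℓ n
    (obsDensity_diff_ge hμ h0.le (fun j => ?_) hℓ) hmin)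
  · rw [← ENNReal.ofReal_mul (by norm_num), ENNReal.div_eq_inv_mul,
      show (2 : ℝ≥0∞)⁻¹ = ENNReal.ofReal (2⁻¹) by
        rw [ENNReal.ofReal_inv_of_pos two_pos]; simp, ← ENNReal.ofReal_mul (by norm_num)]
    congr 1
    rw [hh]
    ring
  · simp only [f', moveMass_one]; ring

end

/-! ### Prior on Q: mass of small boxes and of small entries -/

section

variable {k : ℕ}

/-! ### Lebesgue measure on the simplex -/

/-- The first coordinates of a point of the simplex. -/
def simplexCoords (p : ℕ) (u : stdSimplex ℝ (Fin (p + 1))) : Fin p → ℝ :=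
  fun i => u.1 i.castSucc

lemma simplexVolume_succ (p : ℕ) :
    simplexVolume (p + 1) = (volume : Measure (Fin p → ℝ)).comap (simplexCoords p) := rfl

lemma sum_simplexCoords {p : ℕ} (u : stdSimplex ℝ (Fin (p + 1))) :
    ∑ i, simplexCoords p u i + u.1 (Fin.last p) = 1 := by
  rw [← u.2.2, Fin.sum_univ_castSucc]
  rfl

/-- The simplex is compact and the last coordinate is recovered from the sum, so the chart is a
closed embedding. The measure defined by `comap` is then the volume of the image. -/
lemma measurableEmbedding_simplexCoords (p : ℕ) : MeasurableEmbedding (simplexCoords p) := by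
  have hc : Continuous (simplexCoords p) :=
    continuous_pi fun i => (continuous_apply _).comp continuous_subtype_val
  refine (hc.isClosedEmbedding fun u v huv => ?_).measurableEmbedding
  refine Subtype.ext (funext fun j => ?_)
  refine Fin.lastCases ?_ (fun i => congrFun huv i) j
  have h1 := sum_simplexCoords u
  rw [huv] at h1
  linarith [sum_simplexCoords v]

lemma simplexVolume_apply (p : ℕ) (s : Set (stdSimplex ℝ (Fin (p + 1)))) :
    simplexVolume (p + 1) s = volume (simplexCoords p '' s) := by
  rw [simplexVolume_succ, (measurableEmbedding_simplexCoords p).comap_apply]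

lemma coord_mem_Icc (u : stdSimplex ℝ (Fin k)) (j : Fin k) : u.1 j ∈ Set.Icc (0 : ℝ) 1 := by
  refine ⟨u.2.1 j, ?_⟩
  rw [← u.2.2]
  exact Finset.single_le_sum (fun a _ => u.2.1 a) (Finset.mem_univ j)

lemma simplexVolume_univ_le (p : ℕ) : simplexVolume (p + 1) Set.univ ≤ 1 := by
  rw [simplexVolume_apply]
  calc volume (simplexCoords p '' Set.univ)
      ≤ volume (Set.univ.pi fun _ : Fin p => Set.Icc (0 : ℝ) 1) := by
        refine measure_mono ?_
        rintro _ ⟨u, -, rfl⟩ i -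
        exact coord_mem_Icc u _
    _ = 1 := by rw [volume_pi_pi]; simp

instance isFiniteMeasure_simplexVolume (p : ℕ) : IsFiniteMeasure (simplexVolume (p + 1)) :=
  ⟨(simplexVolume_univ_le p).trans_lt ENNReal.one_lt_top⟩

/-- In the chart a face lies in a coordinate hyperplane or, for the last coordinate, in the affine
hyperplane ∑ v = 1, which is proper because it misses 0. -/
lemma simplexVolume_coord_eq_zero (p : ℕ) (j : Fin (p + 1)) :
    simplexVolume (p + 1) {u | u.1 j = 0} = 0 := by
  rw [simplexVolume_apply]
  induction j using Fin.lastCases with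
  | cast i =>
    refine measure_mono_null (t := {v : Fin p → ℝ | v i = 0}) ?_ ?_
    · rintro _ ⟨u, hu, rfl⟩
      exact hu
    · exact Measure.pi_hyperplane _ i 0
  | last =>
    let E : AffineSubspace ℝ (Fin p → ℝ) :=
      { carrier := {v | ∑ i, v i = 1}
        smul_vsub_vadd_mem' := fun c v₁ v₂ v₃ h₁ h₂ h₃ => by
          simp only [Set.mem_ofPred_eq] at h₁ h₂ h₃
          simp [Finset.sum_add_distrib, ← Finset.mul_sum, h₁, h₂, h₃] }
    refine measure_mono_null (t := (E : Set (Fin p → ℝ))) ?_ (Measure.addHaar_affineSubspace _ E ?_)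
    · rintro _ ⟨u, hu, rfl⟩
      have h1 := sum_simplexCoords u
      rw [show u.1 (Fin.last p) = 0 from hu, add_zero] at h1
      exact h1
    · intro h
      have h0 : (0 : Fin p → ℝ) ∈ E := h ▸ AffineSubspace.mem_top ℝ _ _
      have h1 : ∑ i : Fin p, (0 : Fin p → ℝ) i = 1 := h0
      simp at h1

lemma simplexVolume_box_ge (p : ℕ) (u₀ : stdSimplex ℝ (Fin (p + 1))) {δ : ℝ} (hδ : 0 < δ)
    (hu₀ : ∀ j, δ ≤ u₀.1 j) :
    ENNReal.ofReal (2 * δ / (p + 1)) ^ p ≤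
      simplexVolume (p + 1) {u | ∀ j, |u.1 j - u₀.1 j| ≤ δ} := by
  rw [simplexVolume_apply]
  -- The last coordinate accumulates the errors of the p others; dividing by p + 1 keeps it within
  -- `δ`. All coordinates stay nonnegative because those of `u₀` are at least `δ`.
  set η : ℝ := δ / (p + 1) with hη
  have hη0 : 0 < η := by positivity
  have hηδ : η * (p + 1) = δ := by rw [hη]; field_simp
  have hηle : η ≤ δ := div_le_self hδ.le (by linarith [Nat.cast_nonneg (α := ℝ) p])
  calc ENNReal.ofReal (2 * δ / (p + 1)) ^ p
      = volume (Set.univ.pi fun i : Fin p =>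
          Set.Icc (u₀.1 i.castSucc - η) (u₀.1 i.castSucc + η)) := by
        rw [volume_pi_pi]
        simp_rw [Real.volume_Icc]
        rw [Finset.prod_congr rfl fun i _ => by
          rw [show u₀.1 i.castSucc + η - (u₀.1 i.castSucc - η) = 2 * δ / (p + 1) by
            rw [hη]; ring]]
        simp
    _ ≤ _ := by
        refine measure_mono fun v hv => ?_
        have hv' : ∀ i, |v i - u₀.1 i.castSucc| ≤ η := fun i => by
          have := hv i (Set.mem_univ i)
          rw [abs_le]
          constructor <;> linarith [this.1, this.2]
        have hlast : |(1 - ∑ i, v i) - u₀.1 (Fin.last p)| ≤ δ := by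
          have h1 := sum_simplexCoords u₀
          have h2 : (1 - ∑ i, v i) - u₀.1 (Fin.last p) = -∑ i, (v i - u₀.1 i.castSucc) := by
            rw [Finset.sum_sub_distrib, ← h1]
            simp only [simplexCoords]
            ring
          rw [h2, abs_neg]
          refine (Finset.abs_sum_le_sum_abs _ _).trans
            ((Finset.sum_le_sum fun i _ => hv' i).trans ?_)
          rw [Finset.sum_const, Finset.card_univ, Fintype.card_fin, nsmul_eq_mul]
          linarith
        have hmem : (Fin.snoc v (1 - ∑ i, v i) : Fin (p + 1) → ℝ) ∈
            stdSimplex ℝ (Fin (p + 1)) := by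
          refine ⟨fun j => ?_, ?_⟩
          · refine Fin.lastCases ?_ (fun i => ?_) j
            · rw [Fin.snoc_last]
              linarith [(abs_le.1 hlast).1, hu₀ (Fin.last p)]
            · rw [Fin.snoc_castSucc]
              linarith [(abs_le.1 (hv' i)).1, hu₀ i.castSucc]
          · rw [Fin.sum_univ_castSucc]
            simp
        refine ⟨⟨_, hmem⟩, fun j => ?_, ?_⟩
        · refine Fin.lastCases ?_ (fun i => ?_) j
          · simpa using hlast
          · simpa using (hv' i).trans hηle
        · funext i
          simp [simplexCoords]

/-! ### The prior on transition matrices -/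

lemma transMatVolume_univ_le (p : ℕ) : transMatVolume (p + 1) Set.univ ≤ 1 := by
  rw [transMatVolume, Measure.pi_univ]
  exact Finset.prod_le_one' fun i _ => simplexVolume_univ_le p

lemma ae_transMatVolume_pos (p : ℕ) : ∀ᵐ Q ∂transMatVolume (p + 1), ∀ i j, 0 < Q.entry i j := by
  rw [ae_all_iff]; intro i
  rw [ae_all_iff]; intro j
  have h : transMatVolume (p + 1) (Function.eval i ⁻¹' {u | u.1 j = 0}) = 0 :=
    Measure.pi_eval_preimage_null _ (simplexVolume_coord_eq_zero p j)
  refine measure_mono_null (fun Q hQ => ?_) h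
  exact le_antisymm (not_lt.1 hQ) (entry_nonneg Q i j)

variable {priorQ : Measure (TransMat k)} {πq : stdSimplex ℝ (Fin k) → ℝ≥0} {Q₀ : TransMat k}

lemma HasRowDensity.ae_pos (h : HasRowDensity priorQ πq Q₀) (hk : 1 ≤ k) :
    ∀ᵐ Q ∂priorQ, ∀ i j, 0 < Q.entry i j := by
  obtain ⟨p, rfl⟩ : ∃ p, k = p + 1 := ⟨k - 1, by omega⟩
  rw [h.eq_withDensity]
  exact (withDensity_absolutelyContinuous _ _).ae_le (ae_transMatVolume_pos p)

lemma measurableSet_box (Q₀ : TransMat k) (δ : ℝ) :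
    MeasurableSet {Q : TransMat k | ∀ i j, |Q.entry i j - Q₀.entry i j| ≤ δ} := by
  simp only [Set.ofPred_forall]
  refine MeasurableSet.iInter fun i => MeasurableSet.iInter fun j => ?_
  refine measurableSet_le (Measurable.abs (Measurable.sub_const ?_ _)) measurable_const
  exact (measurable_pi_apply j).comp (measurable_subtype_coe.comp (measurable_pi_apply i))

lemma measurable_entry (i j : Fin k) : Measurable fun Q : TransMat k => Q.entry i j :=
  (measurable_pi_apply j).comp (measurable_subtype_coe.comp (measurable_pi_apply i))

/-- The prior mass of small boxes around `Q₀` is at least polynomial in their size. -/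
lemma HasRowDensity.exists_box_ge (h : HasRowDensity priorQ πq Q₀) (hk : 1 ≤ k) {q : ℝ}
    (hQ₀ : Q₀ ∈ transMatGE k q) (hq : 0 < q) :
    ∃ c δ₀ : ℝ, 0 < c ∧ 0 < δ₀ ∧ ∀ δ, 0 < δ → δ ≤ δ₀ →
      ENNReal.ofReal (c * δ ^ ((k - 1) * k)) ≤
        priorQ {Q | ∀ i j, |Q.entry i j - Q₀.entry i j| ≤ δ} := by
  obtain ⟨p, rfl⟩ : ∃ p, k = p + 1 := ⟨k - 1, by omega⟩
  -- By continuity the density exceeds half its value at `Q₀` on a neighbourhood. The power of `δ`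
  -- in the bound is the dimension (k - 1) k.
  set r : ℝ≥0 := rowProduct πq Q₀ / 2
  have hr : 0 < r := half_pos h.pos_at
  have hnhds : {Q | r < rowProduct πq Q} ∈ 𝓝 Q₀ :=
    h.continuousAt.eventually (lt_mem_nhds (NNReal.half_lt_self h.pos_at.ne'))
  obtain ⟨ρ, hρ, hball⟩ := Metric.nhds_basis_closedBall.mem_iff.1 hnhds
  refine ⟨r * (2 / (p + 1)) ^ (p * (p + 1)), min ρ q, by positivity, lt_min hρ hq,
    fun δ hδ0 hδ => ?_⟩
  set W : Set (TransMat (p + 1)) := {Q | ∀ i j, |Q.entry i j - Q₀.entry i j| ≤ δ} with hW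
  have hWmeas : MeasurableSet W := measurableSet_box Q₀ δ
  have hWr : ∀ Q ∈ W, (r : ℝ≥0∞) ≤ rowProduct πq Q := fun Q hQ => by
    have hmem : Q ∈ Metric.closedBall Q₀ ρ := by
      rw [Metric.mem_closedBall, dist_pi_le_iff hρ.le]
      intro i
      rw [Subtype.dist_eq, dist_pi_le_iff hρ.le]
      intro j
      rw [Real.dist_eq]
      exact (hQ i j).trans (hδ.trans (min_le_left _ _))
    exact_mod_cast (hball hmem).le
  have hWpi : W = Set.univ.pi fun i => {u | ∀ j, |u.1 j - Q₀.entry i j| ≤ δ} := by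
    ext Q
    simp [hW, TransMat.entry]
  rw [h.eq_withDensity, withDensity_apply _ hWmeas]
  calc ENNReal.ofReal (r * (2 / (p + 1)) ^ (p * (p + 1)) * δ ^ ((p + 1 - 1) * (p + 1)))
      = r * ∏ i : Fin (p + 1), ENNReal.ofReal (2 * δ / (p + 1)) ^ p := by
        rw [Finset.prod_const, Finset.card_univ, Fintype.card_fin, ← pow_mul,
          ← ENNReal.ofReal_pow (by positivity), ← ENNReal.ofReal_coe_nnreal,
          ← ENNReal.ofReal_mul r.coe_nonneg, Nat.add_sub_cancel, mul_assoc, ← mul_pow]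
        congr 3
        ring
    _ ≤ r * transMatVolume (p + 1) W := by
        rw [hWpi, transMatVolume, Measure.pi_pi]
        gcongr with i
        exact simplexVolume_box_ge p (Q₀ i) hδ0
          fun j => (hδ.trans (min_le_right _ _)).trans (hQ₀ i j)
    _ = ∫⁻ _ in W, r ∂transMatVolume (p + 1) := by rw [setLIntegral_const]
    _ ≤ _ := setLIntegral_mono' hWmeas hWr

/-- Prior mass of the transition matrices with a small entry. -/
lemma HasRowDensity.measure_compl_transMatGE_le (h : HasRowDensity priorQ πq Q₀) (hk : 1 ≤ k)
    {φ : Fin k → ℝ → ℝ} (hφ0 : ∀ i x, 0 < x → 0 ≤ φ i x)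
    (hφ : ∀ i, AntitoneOn (φ i) (Set.Ioi 0)) {C : ℝ}
    (hπ : ∀ u : stdSimplex ℝ (Fin k), (∀ i, 0 < u.1 i) →
      (πq u : ℝ) ≤ C * ∏ i, Real.exp (-(φ i (u.1 i)))) {q : ℝ} (hq : 0 < q) :
    priorQ (transMatGE k q)ᶜ ≤ ENNReal.ofReal (k * |C| ^ k * ∑ j, Real.exp (-(φ j q))) := by
  obtain ⟨p, rfl⟩ : ∃ p, k = p + 1 := ⟨k - 1, by omega⟩
  have hsub : (transMatGE (p + 1) q)ᶜ ⊆ ⋃ i, ⋃ j, {Q | Q.entry i j < q} := by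
    intro Q hQ
    simp only [transMatGE, Set.mem_compl_iff, Set.mem_ofPred_eq, not_forall, not_le] at hQ
    simpa using hQ
  have hone : ∀ u : stdSimplex ℝ (Fin (p + 1)), (∀ i, 0 < u.1 i) → ∀ j,
      (πq u : ℝ) ≤ |C| * Real.exp (-(φ j (u.1 j))) := fun u hu j => by
    refine (hπ u hu).trans ?_
    -- Only the factor of the small coordinate is kept; the others are at most 1.
    have h1 : ∏ i, Real.exp (-(φ i (u.1 i))) ≤ Real.exp (-(φ j (u.1 j))) := by
      rw [← Finset.prod_erase_mul _ _ (Finset.mem_univ j)]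
      refine mul_le_of_le_one_left (Real.exp_pos _).le
        (Finset.prod_le_one (fun i _ => (Real.exp_pos _).le) fun i _ => ?_)
      rw [Real.exp_le_one_iff, neg_nonpos]
      exact hφ0 i _ (hu i)
    exact mul_le_mul (le_abs_self C) h1 (Finset.prod_nonneg fun i _ => (Real.exp_pos _).le)
      (abs_nonneg C)
  have hC : ∀ u : stdSimplex ℝ (Fin (p + 1)), (∀ i, 0 < u.1 i) → (πq u : ℝ) ≤ |C| :=
    fun u hu => (hone u hu 0).trans (mul_le_of_le_one_right (abs_nonneg C) (by
      rw [Real.exp_le_one_iff, neg_nonpos]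
      exact hφ0 0 _ (hu 0)))
  have hij : ∀ i j, priorQ {Q | Q.entry i j < q} ≤
      ENNReal.ofReal (|C| ^ (p + 1) * Real.exp (-(φ j q))) := fun i j => by
    have hmeas : MeasurableSet {Q : TransMat (p + 1) | Q.entry i j < q} :=
      measurableSet_lt (measurable_entry i j) measurable_const
    rw [h.eq_withDensity, withDensity_apply _ hmeas]
    calc ∫⁻ Q in {Q | Q.entry i j < q}, (rowProduct πq Q : ℝ≥0∞) ∂transMatVolume (p + 1)
        ≤ ∫⁻ _ in {Q | Q.entry i j < q}, ENNReal.ofReal (|C| ^ (p + 1) * Real.exp (-(φ j q)))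
            ∂transMatVolume (p + 1) := by
          refine lintegral_mono_ae ?_
          rw [ae_restrict_iff' hmeas]
          filter_upwards [ae_transMatVolume_pos p] with Q hQ hQq
          rw [← ENNReal.ofReal_coe_nnreal]
          refine ENNReal.ofReal_le_ofReal ?_
          rw [rowProduct, NNReal.coe_prod, ← Finset.mul_prod_erase _ _ (Finset.mem_univ i)]
          have h1 : (πq (Q i) : ℝ) ≤ |C| * Real.exp (-(φ j q)) := by
            refine (hone (Q i) (hQ i) j).trans ?_
            have := hφ j (Set.mem_Ioi.2 (hQ i j)) (Set.mem_Ioi.2 hq) (le_of_lt hQq)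
            gcongr
          have h2 : ∏ a ∈ Finset.univ.erase i, (πq (Q a) : ℝ) ≤ |C| ^ p := by
            refine (Finset.prod_le_prod (fun a _ => (πq (Q a)).2)
              fun a _ => hC (Q a) (hQ a)).trans ?_
            simp
          calc _ ≤ |C| * Real.exp (-(φ j q)) * |C| ^ p :=
                mul_le_mul h1 h2 (Finset.prod_nonneg fun a _ => (πq (Q a)).2) (by positivity)
            _ = _ := by ring
      _ ≤ _ := by
          rw [setLIntegral_const]
          exact mul_le_of_le_one_right' ((measure_mono (Set.subset_univ _)).trans
            (transMatVolume_univ_le p))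
  refine (measure_mono hsub).trans ((measure_iUnion_fintype_le _ _).trans ?_)
  calc ∑ i, priorQ (⋃ j, {Q | Q.entry i j < q})
      ≤ ∑ _i : Fin (p + 1), ∑ j, ENNReal.ofReal (|C| ^ (p + 1) * Real.exp (-(φ j q))) :=
        Finset.sum_le_sum fun i _ => (measure_iUnion_fintype_le _ _).trans
          (Finset.sum_le_sum fun j _ => hij i j)
    _ = _ := by
        rw [Finset.sum_const, Finset.card_univ, Fintype.card_fin, nsmul_eq_mul,
          ← ENNReal.ofReal_sum_of_nonneg fun j _ => by positivity, ← Finset.mul_sum,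
          ← ENNReal.ofReal_natCast, ← ENNReal.ofReal_mul (by positivity)]
        congr 1
        ring

end

/-! ### Prior on f: Gamma boxes and the Dirichlet process -/

section

/-! ### Lower bounds for Gamma probabilities -/

lemma Gamma_add_one_le {a A : ℝ} (ha : 0 ≤ a) (haA : a ≤ A) :
    Real.Gamma (a + 1) ≤ max 1 (Real.Gamma (A + 1)) := by
  have h := Real.convexOn_Gamma.le_max_of_mem_Icc (x := 1) (y := A + 1) (z := a + 1)
    (by simp) (Set.mem_Ioi.2 (by linarith)) ⟨by linarith, by linarith⟩
  rwa [Real.Gamma_one] at h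

lemma gammaMeasure_apply_ge {a : ℝ} {s : Set ℝ} (hs : MeasurableSet s) {c : ℝ}
    (h : ∀ x ∈ s, 0 ≤ x ∧ c ≤ x ^ (a - 1) * Real.exp (-x) / Real.Gamma a) :
    ENNReal.ofReal c * volume s ≤ gammaMeasure a 1 s := by
  rw [gammaMeasure, withDensity_apply _ hs, ← setLIntegral_const]
  refine setLIntegral_mono' hs fun x hx => ?_
  rw [gammaPDF_of_nonneg (h x hx).1]
  refine ENNReal.ofReal_le_ofReal ((h x hx).2.trans (le_of_eq ?_))
  rw [Real.one_rpow, one_mul]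
  ring

/-- A lower bound for the density times the length f η. Since 1/Γ(a) = a/Γ(a + 1), only a factor `a`
is lost as `a` tends to 0, and f^A / 2 bounds the power of x from below uniformly in a ≤ A. -/
lemma exists_gammaMeasure_Icc_ge (A : ℝ) :
    ∃ c : ℝ, 0 < c ∧ c ≤ 1 ∧ ∀ a f η : ℝ, 0 < a → a ≤ A → 0 < f → f ≤ 1 → 0 < η → η ≤ 1 →
      ENNReal.ofReal (c * a * η * f ^ (A + 1)) ≤
        gammaMeasure a 1 (Set.Icc f (f * (1 + η))) := by
  set M := max 1 (Real.Gamma (A + 1)) with hM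
  have hM1 : 1 ≤ M := le_max_left _ _
  have hE : Real.exp (-2) ≤ 1 := Real.exp_le_one_iff.2 (by norm_num)
  refine ⟨Real.exp (-2) / (2 * M), by positivity, ?_, ?_⟩
  · rw [div_le_one (by positivity)]
    linarith
  intro a f η ha haA hf hf1 hη hη1
  have hG : 0 < Real.Gamma a := Real.Gamma_pos_of_pos ha
  have hGa : Real.Gamma a ≤ M / a := by
    rw [le_div_iff₀ ha, mul_comm, ← Real.Gamma_add_one ha.ne']
    exact Gamma_add_one_le ha.le haA
  refine le_trans (le_of_eq ?_) (gammaMeasure_apply_ge (c := f ^ A / 2 * Real.exp (-2) * (a / M))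
    measurableSet_Icc fun x hx => ⟨hf.le.trans hx.1, ?_⟩)
  · rw [Real.volume_Icc, ← ENNReal.ofReal_mul (by positivity), Real.rpow_add_one hf.ne']
    congr 1
    field_simp
    ring
  · have hx0 : 0 < x := hf.trans_le hx.1
    have hx2 : x ≤ 2 := hx.2.trans (by nlinarith)
    have h1 : f ^ A / 2 ≤ x ^ (a - 1) := by
      -- For a ≥ 1 the power is increasing and x ≥ f is used; for a ≤ 1 it is decreasing and x ≤ 2
      -- is used.
      rcases le_total 1 a with h | h
      · have h2 : f ^ A ≤ x ^ (a - 1) :=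
          (Real.rpow_le_rpow_of_exponent_ge hf hf1 (by linarith)).trans
            (Real.rpow_le_rpow hf.le hx.1 (by linarith))
        linarith [Real.rpow_pos_of_pos hf A]
      · have h2 : (2 : ℝ) ^ (a - 1) ≤ x ^ (a - 1) :=
          Real.rpow_le_rpow_of_nonpos hx0 hx2 (by linarith)
        have h3 : (2 : ℝ) ^ (-1 : ℝ) ≤ 2 ^ (a - 1) :=
          Real.rpow_le_rpow_of_exponent_le one_le_two (by linarith)
        rw [Real.rpow_neg_one] at h3
        have h4 : f ^ A ≤ 1 := Real.rpow_le_one hf.le hf1 (by linarith)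
        linarith
    rw [mul_div_assoc]
    rw [mul_assoc]
    refine mul_le_mul h1 ?_ (by positivity) (by positivity)
    rw [div_eq_mul_inv (Real.exp (-x))]
    refine mul_le_mul (Real.exp_le_exp.2 (by linarith)) ?_ (by positivity) (by positivity)
    rw [le_inv_comm₀ (by positivity) hG, inv_div]
    exact hGa

/-- The integral of x^(a-1) is δ^a / a, and a Γ(a) = Γ(a + 1) ≤ 1 by convexity. For the decaying `a`
and `δ` used in the tail, δ + a log(1/δ) is summable, so infinitely many such constraints have
positive joint probability. -/
lemma gammaMeasure_Ioc_ge {a δ : ℝ} (ha : 0 < a) (ha1 : a ≤ 1) (hδ : 0 < δ) :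
    ENNReal.ofReal (Real.exp (-(δ + a * Real.log (1 / δ)))) ≤
      gammaMeasure a 1 (Set.Ioc 0 δ) := by
  have hG : 0 < Real.Gamma a := Real.Gamma_pos_of_pos ha
  have hG1 : a * Real.Gamma a ≤ 1 := by
    rw [← Real.Gamma_add_one ha.ne']
    refine (Gamma_add_one_le ha.le ha1).trans ?_
    rw [show (1 : ℝ) + 1 = 2 by norm_num, Real.Gamma_two, max_self]
  have hint : ∫ x in (0 : ℝ)..δ, x ^ (a - 1) = δ ^ a / a := by
    rw [integral_rpow (Or.inl (by linarith))]
    simp [Real.zero_rpow ha.ne']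
  have hint' : ∫⁻ x in Set.Ioc 0 δ, ENNReal.ofReal (x ^ (a - 1)) = ENNReal.ofReal (δ ^ a / a) := by
    rw [← hint, intervalIntegral.integral_of_le hδ.le, ofReal_integral_eq_lintegral_ofReal]
    · have h := intervalIntegral.intervalIntegrable_rpow' (a := 0) (b := δ) (r := a - 1)
        (by linarith)
      rwa [intervalIntegrable_iff_integrableOn_Ioc_of_le hδ.le] at h
    · rw [EventuallyLE, ae_restrict_iff' measurableSet_Ioc]
      exact ae_of_all _ fun x hx => Real.rpow_nonneg hx.1.le _
  rw [gammaMeasure, withDensity_apply _ measurableSet_Ioc]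
  calc ENNReal.ofReal (Real.exp (-(δ + a * Real.log (1 / δ))))
      ≤ ENNReal.ofReal (Real.exp (-δ) / Real.Gamma a) * ENNReal.ofReal (δ ^ a / a) := by
        rw [← ENNReal.ofReal_mul (by positivity)]
        refine ENNReal.ofReal_le_ofReal ?_
        rw [neg_add, Real.exp_add, one_div, Real.log_inv, mul_neg, neg_neg, mul_comm a,
          ← Real.rpow_def_of_pos hδ, div_mul_div_comm, le_div_iff₀ (by positivity)]
        refine mul_le_of_le_one_right (by positivity) ?_
        rwa [mul_comm]
    _ = ∫⁻ x in Set.Ioc 0 δ,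
          ENNReal.ofReal (Real.exp (-δ) / Real.Gamma a) * ENNReal.ofReal (x ^ (a - 1)) := by
        rw [lintegral_const_mul' _ _ ENNReal.ofReal_ne_top, hint']
    _ ≤ _ := by
        refine setLIntegral_mono' measurableSet_Ioc fun x hx => ?_
        rw [gammaPDF_of_nonneg hx.1.le, ← ENNReal.ofReal_mul (by positivity)]
        refine ENNReal.ofReal_le_ofReal ?_
        have h1 : Real.exp (-δ) ≤ Real.exp (-x) := Real.exp_le_exp.2 (by linarith [hx.2])
        have h2 := Real.rpow_nonneg hx.1.le (a - 1)
        rw [Real.one_rpow, one_mul, div_mul_eq_mul_div, one_div, mul_assoc, ← div_eq_inv_mul]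
        gcongr ?_ / _
        rw [mul_comm]
        gcongr

/-! ### The Dirichlet process -/

lemma exp_neg_le_tprod {ι : Type*} {p : ι → ℝ≥0∞} {e : ι → ℝ} {E : ℝ}
    (h : ∀ i, ENNReal.ofReal (Real.exp (-(e i))) ≤ p i) (hE : ∀ s : Finset ι, ∑ i ∈ s, e i ≤ E) :
    ENNReal.ofReal (Real.exp (-E)) ≤ ∏' i, p i := by
  have hs : ∀ s : Finset ι, ENNReal.ofReal (Real.exp (-E)) ≤ ∏ i ∈ s, p i := fun s => by
    refine le_trans ?_ (Finset.prod_le_prod' fun i _ => h i)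
    rw [← ENNReal.ofReal_prod_of_nonneg fun i _ => (Real.exp_pos _).le, ← Real.exp_sum,
      Finset.sum_neg_distrib]
    exact ENNReal.ofReal_le_ofReal (Real.exp_le_exp.2 (neg_le_neg (hE s)))
  by_cases hm : Multipliable p
  · exact ge_of_tendsto' hm.hasProd hs
  -- Without convergence the infinite product is 1 by convention, and the empty partial product
  -- supplies the bound.
  · rw [tprod_eq_one_of_not_multipliable hm]
    simpa using hs ∅

/-- The case distinction is measurable because, for nonnegative families, it says that the extended
sum ∑ γ is neither ∞ nor 0. -/
lemma measurable_normalize : Measurable normalize := by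
  let S : (ℕ+ → ℝ) → ℝ≥0∞ := fun γ => ∑' m, ENNReal.ofReal (γ m)
  have hS : Measurable S := Measurable.tsum fun m => (measurable_pi_apply m).ennreal_ofReal
  let E : Set (ℕ+ → ℝ) := {γ | (∀ l, 0 ≤ γ l) ∧ S γ ≠ ∞ ∧ S γ ≠ 0}
  have hE : MeasurableSet E := by
    have h0 : MeasurableSet {γ : ℕ+ → ℝ | ∀ l, 0 ≤ γ l} := by
      simp only [Set.ofPred_forall]
      exact MeasurableSet.iInter fun l => measurableSet_le measurable_const (measurable_pi_apply l)
    exact h0.inter ((hS (measurableSet_singleton ∞)).compl.inter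
      (hS (measurableSet_singleton 0)).compl)
  have key : ∀ γ : ℕ+ → ℝ, (∀ l, 0 ≤ γ l) → S γ ≠ ∞ → Summable γ := fun γ h0 hfin => by
    have := ENNReal.summable_toReal hfin
    simpa only [ENNReal.toReal_ofReal (h0 _)] using this
  have hval : ∀ γ : ℕ+ → ℝ, (∀ l, 0 ≤ γ l) → ∑' m, γ m = (S γ).toReal := fun γ h0 => by
    simp only [S]
    rw [ENNReal.tsum_toReal_eq fun m => ENNReal.ofReal_ne_top]
    simp only [ENNReal.toReal_ofReal (h0 _)]
  have hiff : ∀ γ : ℕ+ → ℝ, ((∀ l, 0 ≤ γ l) ∧ Summable γ ∧ 0 < ∑' m, γ m) ↔ γ ∈ E := fun γ => by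
    constructor
    · rintro ⟨h0, h1, h2⟩
      refine ⟨h0, h1.tsum_ofReal_ne_top, fun h => ?_⟩
      rw [hval γ h0, h] at h2
      simp at h2
    · rintro ⟨h0, h1, h2⟩
      refine ⟨h0, key γ h0 h1, ?_⟩
      rw [hval γ h0]
      exact ENNReal.toReal_pos h2 h1
  have hcoord : Measurable fun γ => (normalize γ).1 := by
    classical
    refine measurable_pi_iff.2 fun l => ?_
    have heq : (fun γ => (normalize γ).1 l) =
        fun γ => if γ ∈ E then γ l / (S γ).toReal else if l = 1 then 1 else 0 := by
      funext γ
      by_cases h : γ ∈ E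
      · rw [if_pos h, normalize, dif_pos ((hiff γ).2 h), ← hval γ h.1]
      · rw [if_neg h, normalize, dif_neg (mt (hiff γ).1 h)]
    rw [heq]
    exact Measurable.ite hE ((measurable_pi_apply l).div hS.ennreal_toReal) measurable_const
  exact hcoord.subtype_mk

lemma normalize_apply_ge {γ f b : ℕ+ → ℝ} {T : ℝ} {l : ℕ+} (hγ : ∀ l, 0 < γ l)
    (hle : ∀ l, γ l ≤ b l) (hb : HasSum b T) (hl : f l ≤ γ l) (hf : 0 ≤ f l) :
    f l / T ≤ (normalize γ).1 l := by
  have hs : Summable γ := Summable.of_nonneg_of_le (fun l => (hγ l).le) hle hb.summable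
  have hpos : 0 < ∑' m, γ m := hs.tsum_pos (fun l => (hγ l).le) 1 (hγ 1)
  have hT : ∑' m, γ m ≤ T := hb.tsum_eq ▸ hs.tsum_le_tsum hle hb.summable
  rw [normalize, dif_pos ⟨fun l => (hγ l).le, hs, hpos⟩]
  exact div_le_div₀ (hf.trans hl) hl hpos hT

lemma summable_pnat_rpow {s : ℝ} (hs : s < -1) : Summable fun l : ℕ+ => (l : ℝ) ^ s :=
  (Real.summable_nat_rpow.2 hs).comp_injective PNat.coe_injective

lemma sum_le_sum_Icc_add_tsum {L : ℕ+} {e u v : ℕ+ → ℝ} (hu : ∀ l, 0 ≤ u l) (hv : ∀ l, 0 ≤ v l)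
    (hvs : Summable v) (he1 : ∀ l ≤ L, e l ≤ u l) (he2 : ∀ l, L < l → e l ≤ v l)
    (s : Finset ℕ+) : ∑ l ∈ s, e l ≤ ∑ l ∈ Finset.Icc 1 L, u l + ∑' l, v l := by
  rw [← Finset.sum_filter_add_sum_filter_not s (fun l => l ≤ L)]
  refine add_le_add ?_ ?_
  · refine (Finset.sum_le_sum fun l hl => he1 l (Finset.mem_filter.1 hl).2).trans
      (Finset.sum_le_sum_of_subset_of_nonneg (fun l hl => ?_) fun l _ _ => hu l)
    exact Finset.mem_Icc.2 ⟨one_le, (Finset.mem_filter.1 hl).2⟩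
  · exact (Finset.sum_le_sum fun l hl => he2 l (not_le.1 (Finset.mem_filter.1 hl).2)).trans
      (hvs.sum_le_tsum _ fun l _ => hv l)

/-- The Dirichlet process gives substantial mass to the mass functions that are bounded below by a
slight reduction of a given mass function on an initial segment. -/
theorem exists_dirichletProcess_ge {G : Measure ℕ+} (hG : PolynomialTail G) :
    ∃ (C D : ℝ) (L₀ : ℕ+), 0 < C ∧ 0 < D ∧
      ∀ f : Emission, (∀ l, 0 < f.1 l) → ∀ L : ℕ+, L₀ ≤ L → ∀ η : ℝ, 0 < η → η ≤ 1 →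
        ENNReal.ofReal (Real.exp (-(C * (1 + Real.log (1 / η) +
            ∑ l ∈ Finset.Icc 1 L, (1 + Real.log (1 / η) + Real.log l - Real.log (f.1 l)))))) ≤
          dirichletProcess G {g | ∀ l ≤ L, f.1 l / (1 + D * η) ≤ g.1 l} := by
  obtain ⟨a, A, α, ha, haA, hα, hGl⟩ := hG
  have hA : 0 < A := ha.trans_le haA
  have hgpos : ∀ l, 0 < G.real {l} := fun l =>
    (mul_pos ha (Real.rpow_pos_of_pos (by exact_mod_cast l.pos) _)).trans_le (hGl l).1
  have hl1 : ∀ l : ℕ+, (1 : ℝ) ≤ l := fun l => by exact_mod_cast (one_le : 1 ≤ l)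
  have hgle : ∀ l : ℕ+, G.real {l} ≤ A * (l : ℝ) ^ (-2 : ℝ) := fun l =>
    (hGl l).2.trans (mul_le_mul_of_nonneg_left
      (Real.rpow_le_rpow_of_exponent_le (hl1 l) (by linarith)) hA.le)
  have hgA : ∀ l : ℕ+, G.real {l} ≤ A := fun l =>
    (hgle l).trans (mul_le_of_le_one_right hA.le
      (Real.rpow_le_one_of_one_le_of_nonpos (hl1 l) (by norm_num)))
  obtain ⟨c, hc0, hc1, hc⟩ := exists_gammaMeasure_Icc_ge A
  have hs2 : Summable fun l : ℕ+ => (l : ℝ) ^ (-2 : ℝ) := summable_pnat_rpow (by norm_num)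
  have hs3 : Summable fun l : ℕ+ => (l : ℝ) ^ (-(3 / 2) : ℝ) := summable_pnat_rpow (by norm_num)
  set D₂ := ∑' l : ℕ+, (l : ℝ) ^ (-2 : ℝ) with hD₂
  set D₃ := ∑' l : ℕ+, (l : ℝ) ^ (-(3 / 2) : ℝ) with hD₃
  have hD₂0 : 0 ≤ D₂ := tsum_nonneg fun l => Real.rpow_nonneg (Nat.cast_nonneg _) _
  have hD₃0 : 0 ≤ D₃ := tsum_nonneg fun l => Real.rpow_nonneg (Nat.cast_nonneg _) _
  have hca : 0 ≤ Real.log (1 / (c * min a 1)) := by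
    refine Real.log_nonneg ?_
    rw [le_div_iff₀ (by positivity), one_mul]
    exact mul_le_one₀ hc1 (by positivity) (min_le_right _ _)
  obtain ⟨M, hM⟩ := exists_nat_ge A
  set C₁ := Real.log (1 / (c * min a 1)) + 1 + α + (A + 1) with hC₁
  set C := C₁ + (D₂ + A * D₂ + 4 * A * D₃) with hC
  have hC1pos : 0 < C₁ := by positivity
  have hCC : C₁ ≤ C := by rw [hC]; linarith [show 0 ≤ D₂ + A * D₂ + 4 * A * D₃ by positivity]
  -- Beyond M ≥ A one has G{l} ≤ A/l² ≤ 1, as `gammaMeasure_Ioc_ge` requires. The constant 1 + D₂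
  -- comes from the total mass on the box, at most 1 + η + η D₂.
  refine ⟨C, 1 + D₂, ⟨M + 1, M.succ_pos⟩, by linarith, by positivity, fun f hf L hL η hη hη1 => ?_⟩
  have hf1 : ∀ l, f.1 l ≤ 1 := fun l => le_hasSum f.2.2 l fun j _ => f.2.1 j
  have hη' : 0 ≤ Real.log (1 / η) := Real.log_nonneg (by rw [le_div_iff₀ hη]; linarith)
  have hlogl : ∀ l : ℕ+, 0 ≤ Real.log l := fun l => Real.log_nonneg (hl1 l)
  have hlogf : ∀ l, Real.log (f.1 l) ≤ 0 := fun l => Real.log_nonpos (hf l).le (hf1 l)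
  -- the box of the Gamma variables, and the exponents of its one-dimensional probabilities
  let δ : ℕ+ → ℝ := fun l => η * (l : ℝ) ^ (-2 : ℝ)
  have hδ : ∀ l, 0 < δ l := fun l =>
    mul_pos hη (Real.rpow_pos_of_pos (by exact_mod_cast l.pos) _)
  let S : ℕ+ → Set ℝ := fun l =>
    if l ≤ L then Set.Icc (f.1 l) (f.1 l * (1 + η)) else Set.Ioc 0 (δ l)
  have hSm : ∀ l, MeasurableSet (S l) := fun l => by
    simp only [S]; split_ifs
    exacts [measurableSet_Icc, measurableSet_Ioc]
  let e : ℕ+ → ℝ := fun l =>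
    if l ≤ L then -Real.log (c * G.real {l} * η * f.1 l ^ (A + 1))
    else δ l + G.real {l} * Real.log (1 / δ l)
  have hp : ∀ l, ENNReal.ofReal (Real.exp (-(e l))) ≤ gammaLaw (G.real {l}) (S l) := fun l => by
    rw [gammaLaw, if_pos (hgpos l)]
    simp only [e, S]
    split_ifs with h
    · have h1 : 0 < f.1 l ^ (A + 1) := Real.rpow_pos_of_pos (hf l) _
      have h2 := hgpos l
      rw [neg_neg, Real.exp_log (by positivity)]
      exact hc _ _ _ (hgpos l) (hgA l) (hf l) (hf1 l) hη hη1
    · refine gammaMeasure_Ioc_ge (hgpos l) ?_ (hδ l)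
      have hlM : (M : ℝ) ≤ l := by
        have h1 : M + 1 ≤ (l : ℕ) := (PNat.coe_le_coe _ _).2 (hL.trans (not_le.1 h).le)
        exact_mod_cast (Nat.le_succ M).trans h1
      refine (hgle l).trans ?_
      have hl0 : (0 : ℝ) < l := lt_of_lt_of_le one_pos (hl1 l)
      rw [Real.rpow_neg hl0.le, ← div_eq_mul_inv, div_le_one (Real.rpow_pos_of_pos hl0 _)]
      norm_num
      nlinarith [hl1 l]
  -- Each coordinate l ≤ L costs a multiple of its summand on the right. The coordinates beyond L
  -- cost O(1 + log(1/η)) in total, since G{l} log l = O(l^(-3/2)).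
  have hE : ∀ s : Finset ℕ+, ∑ l ∈ s, e l ≤ C * (1 + Real.log (1 / η) +
      ∑ l ∈ Finset.Icc 1 L, (1 + Real.log (1 / η) + Real.log l - Real.log (f.1 l))) := fun s => by
    have hsum : Summable fun l : ℕ+ => (1 + A * Real.log (1 / η)) * (l : ℝ) ^ (-2 : ℝ) +
        4 * A * (l : ℝ) ^ (-(3 / 2) : ℝ) := (hs2.mul_left _).add (hs3.mul_left _)
    refine (sum_le_sum_Icc_add_tsum (L := L)
      (u := fun l => C₁ * (1 + Real.log (1 / η) + Real.log l - Real.log (f.1 l)))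
      (fun l => mul_nonneg hC1pos.le (by linarith [hlogl l, hlogf l]))
      (fun l => add_nonneg (mul_nonneg (by positivity) (Real.rpow_nonneg (Nat.cast_nonneg _) _))
        (mul_nonneg (by positivity) (Real.rpow_nonneg (Nat.cast_nonneg _) _)))
      hsum (fun l hl => ?_) (fun l hl => ?_) s).trans ?_
    · simp only [e, if_pos hl]
      have h0 : (0 : ℝ) < l := lt_of_lt_of_le one_pos (hl1 l)
      have h1 : (c * min a 1) * (l : ℝ) ^ (-α) ≤ c * G.real {l} := by
        rw [mul_assoc]
        refine mul_le_mul_of_nonneg_left (le_trans ?_ (hGl l).1) hc0.le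
        exact mul_le_mul_of_nonneg_right (min_le_left _ _) (Real.rpow_nonneg h0.le _)
      have h2 : 0 < (c * min a 1) * (l : ℝ) ^ (-α) := by positivity
      have hfA : 0 < f.1 l ^ (A + 1) := Real.rpow_pos_of_pos (hf l) _
      have h3 : Real.log ((c * min a 1) * (l : ℝ) ^ (-α) * η * f.1 l ^ (A + 1)) ≤
          Real.log (c * G.real {l} * η * f.1 l ^ (A + 1)) :=
        Real.log_le_log (by positivity) (by gcongr)
      rw [Real.log_mul (by positivity) hfA.ne', Real.log_mul (by positivity) hη.ne',
        Real.log_mul (by positivity) (by positivity), Real.log_rpow h0, Real.log_rpow (hf l)] at h3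
      have h4 : Real.log (c * min a 1) = -Real.log (1 / (c * min a 1)) := by
        rw [one_div, Real.log_inv, neg_neg]
      have h5 : Real.log η = -Real.log (1 / η) := by rw [one_div, Real.log_inv, neg_neg]
      rw [h4, h5] at h3
      have hx := hlogl l
      have hy := hlogf l
      nlinarith [mul_nonneg hca hη', mul_nonneg hca hx, mul_nonneg hca (neg_nonneg.2 hy),
        mul_nonneg (by linarith : 0 ≤ α) hη', mul_nonneg (by linarith : 0 ≤ α) (neg_nonneg.2 hy),
        mul_nonneg hA.le hη', mul_nonneg hA.le hx]
    · simp only [e, if_neg (not_le.2 hl)]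
      have h0 : (0 : ℝ) < l := lt_of_lt_of_le one_pos (hl1 l)
      have hr : (0 : ℝ) < (l : ℝ) ^ (-2 : ℝ) := Real.rpow_pos_of_pos h0 _
      have hlogδ : Real.log (1 / δ l) = Real.log (1 / η) + 2 * Real.log l := by
        simp only [δ]
        rw [one_div, Real.log_inv, Real.log_mul hη.ne' hr.ne', Real.log_rpow h0, one_div,
          Real.log_inv]
        ring
      have hlog : Real.log l ≤ 2 * (l : ℝ) ^ (1 / 2 : ℝ) := by
        refine (Real.log_le_rpow_div h0.le (ε := 1 / 2) (by norm_num)).trans (le_of_eq ?_)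
        ring
      have hmul : (l : ℝ) ^ (-2 : ℝ) * (l : ℝ) ^ (1 / 2 : ℝ) = (l : ℝ) ^ (-(3 / 2) : ℝ) := by
        rw [← Real.rpow_add h0]; norm_num
      rw [hlogδ]
      calc δ l + G.real {l} * (Real.log (1 / η) + 2 * Real.log l)
          ≤ 1 * (l : ℝ) ^ (-2 : ℝ) + A * (l : ℝ) ^ (-2 : ℝ) *
            (Real.log (1 / η) + 2 * (2 * (l : ℝ) ^ (1 / 2 : ℝ))) := by
            refine add_le_add (mul_le_mul_of_nonneg_right hη1 hr.le)
              (mul_le_mul (hgle l) (by linarith) ?_ (by positivity))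
            linarith [hlogl l]
        _ = _ := by rw [← hmul]; ring
    · rw [(hs2.mul_left _).tsum_add (hs3.mul_left _), tsum_mul_left, tsum_mul_left, ← hD₂, ← hD₃,
        ← Finset.mul_sum]
      set U := ∑ l ∈ Finset.Icc 1 L, (1 + Real.log (1 / η) + Real.log l - Real.log (f.1 l))
      have hU : 0 ≤ U := Finset.sum_nonneg fun l _ => by linarith [hlogl l, hlogf l]
      have h1 : C₁ * U ≤ C * U := mul_le_mul_of_nonneg_right hCC hU
      have h2 : (1 + A * Real.log (1 / η)) * D₂ + 4 * A * D₃ ≤ C * (1 + Real.log (1 / η)) := by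
        rw [hC]
        nlinarith [mul_nonneg hC1pos.le hη', mul_nonneg hD₂0 hη', mul_nonneg hA.le
          (mul_nonneg hD₃0 hη')]
      linarith
  refine (exp_neg_le_tprod hp hE).trans ?_
  rw [← Measure.infinitePi_pi_univ _ hSm, dirichletProcess]
  refine le_trans (measure_mono fun γ hγ => ?_)
    (Measure.le_map_apply measurable_normalize.aemeasurable _)
  have hγS : ∀ l, γ l ∈ S l := fun l => hγ l (Set.mem_univ l)
  have hpos : ∀ l, 0 < γ l := fun l => by
    have := hγS l
    simp only [S] at this
    split_ifs at this
    exacts [(hf l).trans_le this.1, this.1]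
  have hle : ∀ l, γ l ≤ f.1 l * (1 + η) + δ l := fun l => by
    have := hγS l
    simp only [S] at this
    split_ifs at this
    · exact this.2.trans (le_add_of_nonneg_right (hδ l).le)
    · exact this.2.trans (le_add_of_nonneg_left (mul_nonneg (hf l).le (by linarith)))
  have hT : HasSum (fun l => f.1 l * (1 + η) + δ l) (1 + (1 + D₂) * η) := by
    rw [show 1 + (1 + D₂) * η = 1 * (1 + η) + η * D₂ by ring]
    exact (f.2.2.mul_right (1 + η)).add (hs2.hasSum.mul_left η)
  intro l hl
  refine normalize_apply_ge (f := f.1) hpos hle hT ?_ (hf l).le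
  have := hγS l
  simp only [S, if_pos hl] at this
  exact this.1

end

/-! ### Testing and evidence bounds for the posterior -/

section

variable {k : ℕ}

/-! ### Measurability in the parameter -/

lemma measurable_pow_apply (n : ℕ) (i j : Fin k) :
    Measurable fun Q : TransMat k => (toMatrix Q ^ n) i j := by
  induction n generalizing i with
  | zero => simp only [pow_zero]; exact measurable_const
  | succ n ih =>
    simp_rw [pow_apply_succ]
    exact Finset.measurable_sum _ fun a _ => (measurable_entry i a).mul (ih a)

lemma exists_mem_transMatGE {Q : TransMat k} (hk : 1 ≤ k) (h : ∀ i j, 0 < Q.entry i j) :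
    ∃ q, 0 < q ∧ Q ∈ transMatGE k q := by
  have : Nonempty (Fin k) := ⟨⟨0, hk⟩⟩
  obtain ⟨p, hp⟩ := Finite.exists_min fun p : Fin k × Fin k => Q.entry p.1 p.2
  exact ⟨_, h p.1 p.2, fun i j => hp (i, j)⟩

/-- On the matrices with positive entries the stationary distribution is measurable. -/
lemma exists_measurable_statDist (hk : 1 ≤ k) (j : Fin k) :
    ∃ g : TransMat k → ℝ, Measurable g ∧
      ∀ Q : TransMat k, (∀ i j, 0 < Q.entry i j) → statDist Q j = g Q := by
  refine ⟨fun Q => limsup (fun n => (toMatrix Q ^ n) ⟨0, hk⟩ j) atTop,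
    Measurable.limsup fun n => measurable_pow_apply n _ j, fun Q hQ => ?_⟩
  obtain ⟨q, hq, hQq⟩ := exists_mem_transMatGE hk hQ
  exact (tendsto_pow_statDist hk hq hQq _ j).limsup_eq.symm

/-- `statDist` is defined by choice; measurability is obtained where it is a limit of powers, on the
matrices with positive entries. These have full mass under a prior with a row density. -/
lemma exists_measurable_obsDensity (hk : 1 ≤ k) (n : ℕ) (y : Fin n → ℕ+) :
    ∃ g : Param k → ℝ, Measurable g ∧
      ∀ θ : Param k, (∀ i j, 0 < θ.1.entry i j) → obsDensity θ n y = g θ := by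
  choose μ hμm hμ using fun j : Fin k => exists_measurable_statDist hk j
  refine ⟨fun θ => ∑ x : Fin n → Fin k, jointMass (fun j => μ j θ.1) θ n x y, ?_, fun θ hθ => ?_⟩
  · refine Finset.measurable_sum _ fun x _ => Measurable.mul ?_
      (Finset.measurable_prod _ fun i _ => ?_)
    · cases n with
      | zero => exact measurable_const
      | succ n =>
        exact ((hμm _).comp measurable_fst).mul (Finset.measurable_prod _ fun i _ =>
          (measurable_entry _ _).comp measurable_fst)
    · exact (measurable_pi_apply _).comp
        (measurable_subtype_coe.comp ((measurable_pi_apply _).comp measurable_snd))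
  · simp only [obsDensity, ← hμ _ θ.1 hθ]

lemma aemeasurable_obsDist {ν : Measure (Param k)} (hk : 1 ≤ k)
    (hν : ∀ᵐ θ ∂ν, ∀ i j, 0 < θ.1.entry i j) (ℓ : ℕ) (θs : Param k) :
    AEMeasurable (fun θ => obsDist ℓ θ θs) ν := by
  choose g hgm hg using fun y : Fin ℓ → ℕ+ => exists_measurable_obsDensity hk ℓ y
  refine ⟨fun θ => (∑' y, ENNReal.ofReal |g y θ - obsDensity θs ℓ y|).toReal,
    Measurable.ennreal_toReal (Measurable.tsum fun y => ((hgm y).sub_const _).abs.ennreal_ofReal),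
    ?_⟩
  filter_upwards [hν] with θ hθ
  rw [ENNReal.tsum_toReal_eq fun y => ENNReal.ofReal_ne_top, obsDist]
  refine tsum_congr fun y => ?_
  rw [ENNReal.toReal_ofReal (abs_nonneg _), hg y θ hθ]

/-! ### Posterior probabilities and tests -/

/-- Superadditivity of the lower integral needs no measurability, which suits densities defined
through `statDist`. -/
lemma sum_lintegral_le_lintegral_tsum {α β : Type*} [MeasurableSpace α] (μ : Measure α)
    (f : β → α → ℝ≥0∞) : ∑' b, ∫⁻ a, f b a ∂μ ≤ ∫⁻ a, ∑' b, f b a ∂μ := by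
  classical
  refine ENNReal.summable.tsum_le_of_sum_le fun s => ?_
  have h : ∀ s : Finset β, ∑ b ∈ s, ∫⁻ a, f b a ∂μ ≤ ∫⁻ a, ∑ b ∈ s, f b a ∂μ := fun s => by
    induction s using Finset.induction_on with
    | empty => simp
    | insert b s hb ih =>
      simp_rw [Finset.sum_insert hb]
      exact (add_le_add le_rfl ih).trans (le_lintegral_add _ _)
  exact (h s).trans (lintegral_mono fun a => ENNReal.sum_le_tsum s)

/-- The basic testing bound for posterior probabilities. -/
lemma obsLaw_posterior_ge_le {ν : Measure (Param k)} [IsProbabilityMeasure ν] (hk : 1 ≤ k)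
    (hν : ∀ᵐ θ ∂ν, ∀ i j, 0 < θ.1.entry i j) {n : ℕ} {θs : Param k} {A S : Set (Param k)}
    (hA : NullMeasurableSet A ν) (hS : MeasurableSet S) (T : Set (Fin n → ℕ+)) {β κ τ : ℝ≥0∞}
    (hτ : τ ≠ 0) (hτ' : τ ≠ ∞) (hκ : κ ≠ 0) (hκ' : κ ≠ ∞)
    (hT : ∀ θ ∈ A ∩ S, obsLaw θ n Tᶜ ≤ β) :
    obsLaw θs n {y | τ ≤ posterior ν n y A} ≤ obsLaw θs n T +
      obsLaw θs n {y | ∫⁻ θ, ENNReal.ofReal (obsDensity θ n y) ∂ν <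
        κ * ENNReal.ofReal (obsDensity θs n y)} + (β + ν Sᶜ) / (τ * κ) := by
  set E : Set (Fin n → ℕ+) := {y | ∫⁻ θ, ENNReal.ofReal (obsDensity θ n y) ∂ν <
        κ * ENNReal.ofReal (obsDensity θs n y)}
  set B : Set (Fin n → ℕ+) := {y | τ ≤ posterior ν n y A} ∩ (Tᶜ ∩ Eᶜ) with hB
  have hsub : {y | τ ≤ posterior ν n y A} ⊆ (T ∪ E) ∪ B := fun y hy => by
    by_cases h1 : y ∈ T
    · exact Or.inl (Or.inl h1)
    · by_cases h2 : y ∈ E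
      · exact Or.inl (Or.inr h2)
      · exact Or.inr ⟨hy, h1, h2⟩
  refine (measure_mono hsub).trans ((measure_union_le _ _).trans
    (add_le_add (measure_union_le _ _) ?_))
  rw [ENNReal.le_div_iff_mul_le (Or.inl (mul_ne_zero hτ hκ)) (Or.inl (ENNReal.mul_ne_top hτ' hκ')),
    obsLaw_apply, ← ENNReal.tsum_mul_right]
  have hone : ∀ θ : Param k, (∀ i j, 0 < θ.1.entry i j) → obsLaw θ n Tᶜ ≤ 1 := fun θ hθ => by
    obtain ⟨q, hq, hQ⟩ := exists_mem_transMatGE hk hθ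
    have := isProbabilityMeasure_obsLaw (isStationary_statDist hk hq hQ).1 n
    exact prob_le_one
  -- On `B` the numerator of the posterior is at least τ κ times the true density. Summed over y,
  -- the numerators restricted to acceptance are at most the prior integral over `A` of the
  -- acceptance probability, which is at most `β` on `S` and 1 elsewhere.
  calc ∑' y, B.indicator (fun y => ENNReal.ofReal (obsDensity θs n y)) y * (τ * κ)
      ≤ ∑' y, ∫⁻ θ in A, Tᶜ.indicator (fun y => ENNReal.ofReal (obsDensity θ n y)) y ∂ν := by
        refine ENNReal.tsum_le_tsum fun y => ?_
        by_cases hy : y ∈ B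
        · rw [Set.indicator_of_mem hy]
          simp_rw [Set.indicator_of_mem hy.2.1]
          have h1 : κ * ENNReal.ofReal (obsDensity θs n y) ≤
              ∫⁻ θ, ENNReal.ofReal (obsDensity θ n y) ∂ν := not_lt.1 hy.2.2
          have h2 := ENNReal.mul_le_of_le_div (show τ ≤ posterior ν n y A from hy.1)
          calc _ = τ * (κ * ENNReal.ofReal (obsDensity θs n y)) := by ring
            _ ≤ _ := (mul_le_mul_right h1 τ).trans h2
        · rw [Set.indicator_of_notMem hy, zero_mul]
          exact zero_le
    _ ≤ ∫⁻ θ in A, ∑' y, Tᶜ.indicator (fun y => ENNReal.ofReal (obsDensity θ n y)) y ∂ν :=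
        sum_lintegral_le_lintegral_tsum _ _
    _ = ∫⁻ θ in A, obsLaw θ n Tᶜ ∂ν := by simp_rw [obsLaw_apply]
    _ ≤ ∫⁻ θ in A, (β + Sᶜ.indicator 1 θ) ∂ν := by
        refine lintegral_mono_ae ?_
        rw [ae_restrict_iff'₀ hA]
        filter_upwards [hν] with θ hθ hθA
        by_cases hθS : θ ∈ S
        · exact (hT θ ⟨hθA, hθS⟩).trans le_self_add
        · rw [Set.indicator_of_mem (by exact hθS)]
          exact (hone θ hθ).trans le_add_self
    _ ≤ ∫⁻ θ, (β + Sᶜ.indicator 1 θ) ∂ν := setLIntegral_le_lintegral _ _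
    _ = β + ν Sᶜ := by
        rw [lintegral_add_left measurable_const, lintegral_indicator_one hS.compl]
        simp

/-- The test that compares the empirical measure of separated blocks with the true density. -/
def blockTest (θs : Param k) {ℓ b N n : ℕ} (hℓ : ℓ ≤ b) (hn : N * b ≤ n) (x : ℝ) :
    Set (Fin n → ℕ+) :=
  {y | ENNReal.ofReal x ≤ empDev (obsDensity θs ℓ) (blocks hℓ hn y)}

lemma obsLaw_real_singleton (θ : Param k) (n : ℕ) (y : Fin n → ℕ+) :
    (obsLaw θ n).real {y} = obsDensity θ n y := by
  rw [Measure.real, obsLaw_singleton, ENNReal.toReal_ofReal (obsDensity_nonneg θ n y)]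

/-- Type I error: pass to independent blocks, then apply Markov's inequality to the mean L₁
deviation. -/
lemma obsLaw_blockTest_le (hk : 1 ≤ k) {θs : Param k} {q : ℝ} (hQ : θs.1 ∈ transMatGE k q)
    (hq : 0 < q) (hq1 : q ≤ 1) {ℓ g N n : ℕ} (hn : N * (ℓ + g) ≤ n) (hN : 0 < N) {x : ℝ}
    (hx : 0 < x) :
    obsLaw θs n (blockTest θs (Nat.le_add_right ℓ g) hn x) ≤
      ENNReal.ofReal (1 + (1 - q) ^ g / q) ^ N *
        (ENNReal.ofReal (1 / √N) * (∑' z, ENNReal.ofReal √(obsDensity θs ℓ z)) /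
          ENNReal.ofReal x) := by
  have hpr := isProbabilityMeasure_obsLaw (isStationary_statDist hk hq hQ).1 ℓ
  have h1 := map_blocks_le hk hQ hq hq1 hn
    {z : Fin N → Fin ℓ → ℕ+ | ENNReal.ofReal x ≤ empDev (obsDensity θs ℓ) z}
  rw [Measure.map_apply .of_discrete .of_discrete, Measure.smul_apply, smul_eq_mul] at h1
  refine h1.trans (mul_le_mul_right ?_ _)
  have hx' : ENNReal.ofReal x ≠ 0 := by simpa using hx
  refine (meas_ge_le_lintegral_div (Measurable.of_discrete).aemeasurable hx'
    ENNReal.ofReal_ne_top).trans (ENNReal.div_le_div_right ?_ _)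
  have h2 := lintegral_empDev_le (obsLaw θs ℓ) hN
  simp_rw [obsLaw_real_singleton] at h2
  exact h2

/-- Type II error: pass to independent blocks; acceptance puts the empirical measure near the true
density, so the set of `exists_visitDev_ge` is visited too often, and Hoeffding's inequality
applies. -/
lemma obsLaw_compl_blockTest_le (hk : 1 ≤ k) {θs θ : Param k} {qs q : ℝ}
    (hQs : θs.1 ∈ transMatGE k qs) (hqs : 0 < qs) (hQ : θ.1 ∈ transMatGE k q)
    (hq : 0 < q) (hq1 : q ≤ 1) {ℓ g N n : ℕ} (hn : N * (ℓ + g) ≤ n) (hN : 0 < N) {x : ℝ}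
    (hx : 0 < x) (hD : 4 * x ≤ obsDist ℓ θ θs) :
    obsLaw θ n (blockTest θs (Nat.le_add_right ℓ g) hn x)ᶜ ≤
      ENNReal.ofReal (1 + (1 - q) ^ g / q) ^ N * ENNReal.ofReal (Real.exp (-(2 * N * x ^ 2))) := by
  have hpr := isProbabilityMeasure_obsLaw (isStationary_statDist hk hq hQ).1 ℓ
  have h1 := map_blocks_le hk hQ hq hq1 hn
    {z : Fin N → Fin ℓ → ℕ+ | ENNReal.ofReal x ≤ empDev (obsDensity θs ℓ) z}ᶜ
  rw [Measure.map_apply .of_discrete .of_discrete, Measure.smul_apply, smul_eq_mul] at h1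
  refine h1.trans (mul_le_mul_right ?_ _)
  have hD' : 4 * x ≤ ∑' z, |obsDensity θs ℓ z - (obsLaw θ ℓ).real {z}| := by
    simp_rw [obsLaw_real_singleton, abs_sub_comm (obsDensity θs ℓ _)]
    exact hD
  obtain ⟨B, hB⟩ := exists_visitDev_ge (N := N) (obsLaw θ ℓ)
    (hasSum_obsDensity (isStationary_statDist hk hqs hQs).1 ℓ) hD' hN
  refine (measure_mono (t := {z | x * N ≤ visitDev (obsLaw θ ℓ) B z})
    fun z hz => hB z (not_le.1 hz)).trans ?_
  rw [← ofReal_measureReal]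
  exact ENNReal.ofReal_le_ofReal (hoeffding_visitDev _ B hx.le)

/-! ### The marginal likelihood -/

/-- Along a hidden path each transition and each emission loses at most the factor s = 1 - 1/(2n),
and s^n ≥ 1/2 by Bernoulli's inequality. This gives the 1/4; the initial weight gives `qs`. -/
lemma obsDensity_ge_of_close (hk : 1 ≤ k) {θs θ : Param k} {qs : ℝ} (hqs : 0 < qs)
    (hQs : θs.1 ∈ transMatGE k qs) {n : ℕ} (hn : 1 ≤ n) {L : ℕ+}
    (hQ : ∀ i j, |θ.1.entry i j - θs.1.entry i j| ≤ qs / (2 * n))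
    (hf : ∀ j, ∀ l ≤ L, (θs.2 j).1 l * (1 - 1 / (2 * n)) ≤ (θ.2 j).1 l) {y : Fin n → ℕ+}
    (hy : ∀ i, y i ≤ L) : qs / 4 * obsDensity θs n y ≤ obsDensity θ n y := by
  have hn0 : (0 : ℝ) < n := by exact_mod_cast hn
  have hn1 : (1 : ℝ) ≤ n := by exact_mod_cast hn
  set s : ℝ := 1 - 1 / (2 * n) with hs
  have hinv : 1 / (2 * n : ℝ) ≤ 1 / 2 :=
    one_div_le_one_div_of_le two_pos (by linarith)
  have hs0 : 1 / 2 ≤ s := by rw [hs]; linarith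
  have hs1 : s ≤ 1 := by rw [hs]; linarith [show 0 ≤ 1 / (2 * n : ℝ) by positivity]
  have hsn : 1 / 2 ≤ s ^ n := by
    have h := one_add_mul_le_pow (a := -(1 / (2 * n : ℝ))) (by linarith) n
    have h2 : 1 + (n : ℝ) * -(1 / (2 * n)) = 1 / 2 := by field_simp; norm_num
    rw [h2] at h
    rwa [hs, sub_eq_add_neg]
  have hent : ∀ i j, θs.1.entry i j * s ≤ θ.1.entry i j := fun i j => by
    have h1 := (abs_le.1 (hQ i j)).1
    have h2 := mul_le_mul_of_nonneg_right (hQs i j) (show 0 ≤ 1 / (2 * n : ℝ) by positivity)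
    have h3 : qs / (2 * n) = qs * (1 / (2 * n)) := by ring
    rw [hs, mul_sub, mul_one]
    linarith
  have hqss : θ.1 ∈ transMatGE k (qs * s) := fun i j =>
    (mul_le_mul_of_nonneg_right (hQs i j) (by linarith)).trans (hent i j)
  have hst := isStationary_statDist hk hqs hQs
  have hstθ := isStationary_statDist hk (by positivity) hqss
  -- No perturbation bound for the stationary distribution is needed: its weights are at least the
  -- smallest entry of the matrix, and those of the truth are at most 1.
  have hμ : ∀ j, qs * s * statDist θs.1 j ≤ statDist θ.1 j := fun j =>
    (mul_le_of_le_one_right (by positivity) (coord_mem_Icc ⟨_, hst.1⟩ j).2).trans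
      (hstθ.le_apply hqss j)
  have hchain : ∀ x : Fin n → Fin k, qs * s ^ n * chainWeight (statDist θs.1) θs.1 n x ≤
      chainWeight (statDist θ.1) θ.1 n x := fun x => by
    obtain ⟨p, rfl⟩ : ∃ p, n = p + 1 := ⟨n - 1, by omega⟩
    simp only [chainWeight]
    have h1 : s ^ p * ∏ i : Fin p, θs.1.entry (x i.castSucc) (x i.succ) ≤
        ∏ i : Fin p, θ.1.entry (x i.castSucc) (x i.succ) := by
      have : s ^ p = ∏ _i : Fin p, s := by simp
      rw [this, ← Finset.prod_mul_distrib]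
      refine Finset.prod_le_prod (fun i _ => mul_nonneg (by linarith) (entry_nonneg _ _ _))
        fun i _ => ?_
      rw [mul_comm]
      exact hent _ _
    calc _ = (qs * s * statDist θs.1 (x 0)) *
          (s ^ p * ∏ i : Fin p, θs.1.entry (x i.castSucc) (x i.succ)) := by ring
      _ ≤ _ := mul_le_mul (hμ _) h1 (mul_nonneg (by positivity)
          (Finset.prod_nonneg fun i _ => entry_nonneg _ _ _)) (statDist_nonneg _ _)
  have hemit : ∀ x : Fin n → Fin k, s ^ n * ∏ i, (θs.2 (x i)).1 (y i) ≤
      ∏ i, (θ.2 (x i)).1 (y i) := fun x => by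
    have : s ^ n = ∏ _i : Fin n, s := by simp
    rw [this, ← Finset.prod_mul_distrib]
    refine Finset.prod_le_prod (fun i _ => mul_nonneg (by linarith) ((θs.2 _).2.1 _))
      fun i _ => ?_
    rw [mul_comm]
    exact hf _ _ (hy i)
  rw [obsDensity, obsDensity, Finset.mul_sum]
  refine Finset.sum_le_sum fun x _ => ?_
  have hp0 : 0 ≤ ∏ i, (θs.2 (x i)).1 (y i) := Finset.prod_nonneg fun i _ => (θs.2 _).2.1 _
  have hc0 := chainWeight_nonneg (Q := θs.1) (statDist_nonneg θs.1) n x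
  calc qs / 4 * jointMass (statDist θs.1) θs n x y
      = (qs * (1 / 2) * chainWeight (statDist θs.1) θs.1 n x) *
        (1 / 2 * ∏ i, (θs.2 (x i)).1 (y i)) := by rw [jointMass]; ring
    _ ≤ (qs * s ^ n * chainWeight (statDist θs.1) θs.1 n x) *
        (s ^ n * ∏ i, (θs.2 (x i)).1 (y i)) := by gcongr
    _ ≤ _ := mul_le_mul (hchain x) (hemit x) (mul_nonneg (by positivity) hp0)
        (chainWeight_nonneg (statDist_nonneg _) n x)

/-- The parameters close to `θs`: the set on which the likelihood is bounded below. -/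
def closeParam (θs : Param k) (δ η : ℝ) (L : ℕ+) : Set (Param k) :=
  {Q | ∀ i j, |Q.entry i j - θs.1.entry i j| ≤ δ} ×ˢ
    Set.univ.pi fun j => {g : Emission | ∀ l ≤ L, (θs.2 j).1 l / (1 + η) ≤ g.1 l}

lemma measurableSet_closeParam (θs : Param k) (δ η : ℝ) (L : ℕ+) :
    MeasurableSet (closeParam θs δ η L) := by
  refine (measurableSet_box θs.1 δ).prod (MeasurableSet.univ_pi fun j => ?_)
  simp only [Set.ofPred_forall]
  refine MeasurableSet.iInter fun l => MeasurableSet.iInter fun _ => ?_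
  exact measurableSet_le measurable_const ((measurable_pi_apply l).comp measurable_subtype_coe)

lemma lintegral_obsDensity_ge (ν : Measure (Param k)) (hk : 1 ≤ k) {θs : Param k} {qs : ℝ}
    (hqs : 0 < qs) (hQs : θs.1 ∈ transMatGE k qs) {n : ℕ} (hn : 1 ≤ n) {L : ℕ+} {η : ℝ}
    (hη0 : 0 ≤ η) (hη : η ≤ 1 / (2 * n)) {y : Fin n → ℕ+} (hy : ∀ i, y i ≤ L) :
    ENNReal.ofReal (qs / 4) * ν (closeParam θs (qs / (2 * n)) η L) *
      ENNReal.ofReal (obsDensity θs n y) ≤ ∫⁻ θ, ENNReal.ofReal (obsDensity θ n y) ∂ν := by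
  set V := closeParam θs (qs / (2 * n)) η L
  calc _ = ∫⁻ _ in V, ENNReal.ofReal (qs / 4 * obsDensity θs n y) ∂ν := by
        rw [setLIntegral_const, ENNReal.ofReal_mul (by positivity)]
        ring
    _ ≤ ∫⁻ θ in V, ENNReal.ofReal (obsDensity θ n y) ∂ν := by
        refine setLIntegral_mono' (measurableSet_closeParam _ _ _ _) fun θ hθ =>
          ENNReal.ofReal_le_ofReal ?_
        refine obsDensity_ge_of_close hk hqs hQs hn hθ.1 (fun j l hl => ?_) hy
        refine le_trans ?_ (hθ.2 j (Set.mem_univ j) l hl)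
        rw [div_eq_mul_inv ((θs.2 j).1 l)]
        refine mul_le_mul_of_nonneg_left ?_ ((θs.2 j).2.1 l)
        have h1 : 1 - η ≤ (1 + η)⁻¹ := by
          rw [← one_div, le_div_iff₀ (by linarith)]
          nlinarith [sq_nonneg η]
        linarith
    _ ≤ _ := setLIntegral_le_lintegral _ _

lemma bwd_le_prod (Q : TransMat k) {n : ℕ} {F : ℕ → Fin k → ℝ≥0∞} {c : ℕ → ℝ≥0∞}
    (h : ∀ t x, F t x ≤ c t) (x : Fin k) :
    bwd (kern Q) n F (fun _ => 1) x ≤ ∏ t ∈ Finset.range n, c t := by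
  induction n generalizing F c x with
  | zero => simp [bwd]
  | succ n ih =>
    rw [bwd, Finset.prod_range_succ', mul_comm (∏ t ∈ _, _)]
    beta_reduce
    refine mul_le_mul (h 0 x) ?_ zero_le zero_le
    calc ∑ x', kern Q x x' * bwd (kern Q) n (fun t => F (t + 1)) (fun _ => 1) x'
        ≤ ∑ x', kern Q x x' * ∏ t ∈ Finset.range n, c (t + 1) := by
          gcongr with x' _
          exact ih (fun t x => h (t + 1) x) x'
      _ = _ := by rw [← Finset.sum_mul, sum_kern, one_mul]

/-- Probability that one of the first `n` observations is large. -/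
lemma obsLaw_exists_gt_le (θs : Param k) (hμ : statDist θs.1 ∈ stdSimplex ℝ (Fin k)) (n : ℕ)
    (L : ℕ+) {τ : ℝ≥0∞} (hτ : ∀ x, ∑' l, emit θs x l * (if L < l then 1 else 0) ≤ τ) :
    obsLaw θs n {y | ∃ i, L < y i} ≤ n * τ := by
  have hi : ∀ i : Fin n, obsLaw θs n {y | L < y i} ≤ τ := fun i => by
    let w : ℕ → ℕ+ → ℝ≥0∞ := fun t l => if t = i then (if L < l then 1 else 0) else 1
    calc obsLaw θs n {y | L < y i}
        ≤ ∑' y : Fin n → ℕ+, ENNReal.ofReal (obsDensity θs n y) * ∏ t : Fin n, w t (y t) := by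
          rw [obsLaw_apply]
          refine ENNReal.tsum_le_tsum fun y => ?_
          by_cases hy : L < y i
          · rw [Set.indicator_of_mem (by exact hy), Finset.prod_eq_one, mul_one]
            intro t _
            simp only [w]
            split_ifs with h1 h2
            · rfl
            · exact absurd (by rwa [Fin.ext h1]) h2
            · rfl
          · rw [Set.indicator_of_notMem (by exact hy)]
            exact zero_le
      _ = pathSum θs.1 (statDist θs.1) n fun t x => ∑' l, emit θs x l * w t l :=
          tsum_obsDensity_mul_prod hμ n w
      _ ≤ ∑ x, ENNReal.ofReal (statDist θs.1 x) *
            ∏ t ∈ Finset.range n, (if t = i then τ else 1) := by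
          unfold pathSum
          gcongr with x _
          refine bwd_le_prod _ (fun t x => ?_) x
          simp only [w]
          split_ifs with h
          · exact hτ x
          · simp [tsum_emit]
      _ = τ := by
          rw [← Finset.sum_mul, ← ENNReal.ofReal_sum_of_nonneg fun j _ => hμ.1 j, hμ.2,
            ENNReal.ofReal_one, one_mul, Finset.prod_ite_eq', if_pos (by simp)]
  calc obsLaw θs n {y | ∃ i, L < y i} = obsLaw θs n (⋃ i, {y | L < y i}) := by
        rw [Set.ofPred_exists]
    _ ≤ ∑ i : Fin n, obsLaw θs n {y | L < y i} := measure_iUnion_fintype_le _ _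
    _ ≤ ∑ _i : Fin n, τ := Finset.sum_le_sum fun i _ => hi i
    _ = n * τ := by simp

/-! ### The law of the observed process -/

/-- The event is covered by the finitely many hidden paths. An inequality is enough, as only upper
bounds of probabilities are transferred to `P`. -/
lemma IsHiddenMarkovChain.map_le {Ω : Type*} [MeasurableSpace Ω] {P : Measure Ω}
    {X : ℕ → Ω → Fin k} {Y : ℕ → Ω → ℕ+} {θs : Param k}
    (h : IsHiddenMarkovChain P X Y (statDist θs.1) θs) (n : ℕ) :
    P.map (fun ω (i : Fin n) => Y i ω) ≤ obsLaw θs n := by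
  have hm : Measurable fun ω (i : Fin n) => Y i ω :=
    measurable_pi_iff.2 fun i => h.measurable_obs i
  refine measure_le_of_singleton fun y => ?_
  rw [Measure.map_apply hm .of_discrete, obsLaw_singleton, obsDensity,
    ENNReal.ofReal_sum_of_nonneg fun x _ => jointMass_nonneg (statDist_nonneg θs.1) θs n x y]
  simp_rw [← h.law]
  refine le_trans (measure_mono fun ω hω => ?_) (measure_iUnion_fintype_le _ _)
  exact Set.mem_iUnion.2 ⟨fun i => X i ω, fun i => ⟨rfl, congrFun hω i⟩⟩

lemma concentratesAtRate_of_tendsto {Ω : Type*} [MeasurableSpace Ω] {P : Measure Ω}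
    {X : ℕ → Ω → Fin k} {Y : ℕ → Ω → ℕ+} {θs : Param k}
    (h : IsHiddenMarkovChain P X Y (statDist θs.1) θs) {ν : Measure (Param k)} {ℓ : ℕ}
    {ε : ℕ → ℝ} {M : ℝ} (hM : 0 < M)
    (hlim : ∀ τ : ℝ≥0∞, τ ≠ 0 → τ ≠ ∞ → Tendsto (fun n => obsLaw θs n
      {y | τ ≤ posterior ν n y {θ | M * ε n ≤ obsDist ℓ θ θs}}) atTop (𝓝 0)) :
    ConcentratesAtRate P Y ν ℓ θs ε := by
  refine ⟨M, hM, fun τ hτ => ?_⟩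
  -- The hypothesis covers finite levels; lowering `τ` to `min τ 1` only enlarges the event.
  have hmin : min τ 1 ≠ 0 := by simp [hτ.ne']
  refine tendsto_of_tendsto_of_tendsto_of_le_of_le tendsto_const_nhds
    (hlim (min τ 1) hmin (ne_top_of_le_ne_top ENNReal.one_ne_top (min_le_right _ _)))
    (fun n => zero_le) fun n => ?_
  have hm : Measurable fun ω (i : Fin n) => Y i ω :=
    measurable_pi_iff.2 fun i => h.measurable_obs i
  refine le_trans (measure_mono fun ω hω => ?_)
    ((Measure.map_apply hm .of_discrete).symm.le.trans (h.map_le n _))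
  simp only [Set.mem_preimage, Set.mem_ofPred_eq] at hω ⊢
  refine (min_le_left _ _).trans (hω.trans ?_)
  rw [edist_dist, Real.dist_eq, sub_zero, abs_of_nonneg ENNReal.toReal_nonneg]
  exact ENNReal.ofReal_toReal_le

end

/-! ### Powers of log n: truncation level and prior mass -/

section

variable {k : ℕ}

/-! ### Tails of the observations under the true parameter -/

lemma summable_exp_neg_mul_rpow {b m : ℝ} (hb : 0 < b) (hm : 0 < m) :
    Summable fun l : ℕ+ => Real.exp (-(b * (l : ℝ) ^ m)) := by
  have h1 : (fun l : ℕ => Real.exp (-b * (l : ℝ) ^ m)) =O[atTop] fun l : ℕ => (l : ℝ) ^ (-2 : ℝ) := by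
    have h2 : Tendsto (fun l : ℕ => (l : ℝ) ^ m) atTop atTop :=
      (tendsto_rpow_atTop hm).comp tendsto_natCast_atTop_atTop
    refine ((isLittleO_exp_neg_mul_rpow_atTop hb (-2 / m)).comp_tendsto h2).isBigO.congr'
      (Eventually.of_forall fun l => rfl) (Eventually.of_forall fun l => ?_)
    simp only [Function.comp]
    rw [← Real.rpow_mul (Nat.cast_nonneg l)]
    congr 1
    field_simp
  have h3 := summable_of_isBigO_nat (Real.summable_nat_rpow.2 (by norm_num : (-2 : ℝ) < -1)) h1
  refine (h3.comp_injective PNat.coe_injective).congr fun l => ?_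
  simp [neg_mul]

/-- The density is an average over hidden paths, hence at most the product of the envelopes h. The
sum of the roots is then at most (∑ √h)^ℓ, and √h still decays like exp(-c l^m / 2). -/
lemma tsum_sqrt_obsDensity_ne_top {θs : Param k} (hμ : statDist θs.1 ∈ stdSimplex ℝ (Fin k))
    {m c d : ℝ} (hm : 0 < m) (hc : 0 < c)
    (hd : ∀ j l, (θs.2 j).1 l ≤ d * Real.exp (-(c * (l : ℝ) ^ m))) (ℓ : ℕ) :
    ∑' z : Fin ℓ → ℕ+, ENNReal.ofReal √(obsDensity θs ℓ z) ≠ ∞ := by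
  have hd0 : 0 ≤ |d| := abs_nonneg d
  let h : ℕ+ → ℝ := fun l => |d| * Real.exp (-(c * (l : ℝ) ^ m))
  have hh : ∀ l, 0 ≤ h l := fun l => by positivity
  have hle : ∀ z : Fin ℓ → ℕ+, obsDensity θs ℓ z ≤ ∏ i, h (z i) := fun z => by
    rw [← ENNReal.ofReal_le_ofReal_iff (Finset.prod_nonneg fun i _ => hh _), ofReal_obsDensity]
    have hw : ∑ x : Fin ℓ → Fin k, ENNReal.ofReal (chainWeight (statDist θs.1) θs.1 ℓ x) = 1 := by
      have := sum_chainWeight_mul_prod (Q := θs.1) hμ ℓ fun _ _ => 1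
      simpa [pathSum_one θs.1 hμ] using this
    rw [← one_mul (ENNReal.ofReal _), ← hw, Finset.sum_mul]
    refine Finset.sum_le_sum fun x _ => mul_le_mul_right ?_ _
    rw [ENNReal.ofReal_prod_of_nonneg fun i _ => hh _]
    refine Finset.prod_le_prod' fun i _ => ENNReal.ofReal_le_ofReal ((hd _ _).trans ?_)
    exact mul_le_mul_of_nonneg_right (le_abs_self d) (Real.exp_pos _).le
  have hsqrt : ∀ l : ℕ+, √(h l) = √|d| * Real.exp (-(c / 2 * (l : ℝ) ^ m)) := fun l => by
    rw [Real.sqrt_mul hd0, ← Real.exp_half]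
    congr 2
    ring
  have hs : Summable fun l => √(h l) := by
    simp_rw [hsqrt]
    exact (summable_exp_neg_mul_rpow (by positivity) hm).mul_left _
  refine ne_top_of_le_ne_top (b := ∏ _i : Fin ℓ, ∑' l, ENNReal.ofReal √(h l))
    (ENNReal.prod_ne_top fun i _ => hs.tsum_ofReal_ne_top) ?_
  rw [← tsum_prod_fin ℓ fun _ l => ENNReal.ofReal √(h l)]
  refine ENNReal.tsum_le_tsum fun z => ?_
  rw [← ENNReal.ofReal_prod_of_nonneg fun i _ => Real.sqrt_nonneg _]
  refine ENNReal.ofReal_le_ofReal ((Real.sqrt_le_sqrt (hle z)).trans (le_of_eq ?_))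
  rw [Real.sqrt_prod _ fun i _ => hh _]

/-- The truncation level of the observations. -/
def truncLevel (a m : ℝ) (n : ℕ) : ℕ+ := Nat.succPNat ⌊(a * Real.log n) ^ (1 / m)⌋₊

lemma truncLevel_cast (a m : ℝ) (n : ℕ) :
    ((truncLevel a m n : ℕ+) : ℝ) = (⌊(a * Real.log n) ^ (1 / m)⌋₊ : ℝ) + 1 := by
  simp [truncLevel]

lemma lt_truncLevel (a m : ℝ) (n : ℕ) : (a * Real.log n) ^ (1 / m) < truncLevel a m n := by
  rw [truncLevel_cast]
  exact Nat.lt_floor_add_one _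

lemma truncLevel_le {a m : ℝ} (ha : 0 ≤ a) (hm : 0 < m) {n : ℕ} (hn : 1 ≤ Real.log n) :
    (truncLevel a m n : ℝ) ≤ (a ^ (1 / m) + 1) * Real.log n ^ (1 / m) := by
  have hu : 0 ≤ Real.log n := by linarith
  rw [truncLevel_cast, add_mul, one_mul, ← Real.mul_rpow ha hu]
  exact add_le_add (Nat.floor_le (Real.rpow_nonneg (mul_nonneg ha hu) _))
    (Real.one_le_rpow hn (by positivity))

lemma tendsto_log_natCast : Tendsto (fun n : ℕ => Real.log n) atTop atTop :=
  Real.tendsto_log_atTop.comp tendsto_natCast_atTop_atTop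

lemma tendsto_truncLevel {a m : ℝ} (ha : 0 < a) (hm : 0 < m) :
    Tendsto (fun n => (truncLevel a m n : ℝ)) atTop atTop :=
  tendsto_atTop_mono (fun n => (lt_truncLevel a m n).le)
    ((tendsto_rpow_atTop (by positivity)).comp (tendsto_log_natCast.const_mul_atTop ha))

/-- Beyond the level l^m ≥ (4/c) log n, so half of the exponent c l^m yields n^(-2) and the other
half is summable. The factor n^(-2) survives the union over n observations. -/
lemma tsum_emit_tail_le {θs : Param k} {m c d : ℝ} (hm : 0 < m) (hc : 0 < c)
    (hd : ∀ j l, (θs.2 j).1 l ≤ d * Real.exp (-(c * (l : ℝ) ^ m))) {n : ℕ} (hn : 1 ≤ n)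
    (x : Fin k) :
    ∑' l, emit θs x l * (if truncLevel (4 / c) m n < l then 1 else 0) ≤
      ENNReal.ofReal (|d| * (∑' l : ℕ+, Real.exp (-(c / 2 * (l : ℝ) ^ m))) * (1 / n ^ 2)) := by
  have hn0 : (0 : ℝ) < n := by exact_mod_cast hn
  have hs := summable_exp_neg_mul_rpow (b := c / 2) (by positivity) hm
  have hs2 : Summable fun l : ℕ+ => |d| * Real.exp (-(c / 2 * (l : ℝ) ^ m)) * (1 / n ^ 2) :=
    (hs.mul_left _).mul_right _
  rw [← tsum_mul_left, ← tsum_mul_right, ENNReal.ofReal_tsum_of_nonneg (fun l => by positivity) hs2]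
  refine ENNReal.tsum_le_tsum fun l => ?_
  split_ifs with h
  · rw [mul_one]
    refine ENNReal.ofReal_le_ofReal ((hd x l).trans ?_)
    have hl : (truncLevel (4 / c) m n : ℝ) < l := by exact_mod_cast h
    have hu : 0 ≤ 4 / c * Real.log n :=
      mul_nonneg (by positivity) (Real.log_nonneg (by exact_mod_cast hn))
    have h1 : 4 / c * Real.log n ≤ (l : ℝ) ^ m := by
      have h2 := Real.rpow_le_rpow (Real.rpow_nonneg hu (1 / m))
        ((lt_truncLevel (4 / c) m n).trans hl).le hm.le
      rwa [← Real.rpow_mul hu, one_div_mul_cancel hm.ne', Real.rpow_one] at h2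
    have h3 : Real.exp (-(c * (l : ℝ) ^ m)) ≤
        Real.exp (-(c / 2 * (l : ℝ) ^ m)) * (1 / n ^ 2) := by
      have h4 : (1 / n ^ 2 : ℝ) = Real.exp (-(2 * Real.log n)) := by
        rw [Real.exp_neg, mul_comm, Real.exp_mul, Real.exp_log hn0, one_div]
        norm_num
      rw [h4, ← Real.exp_add]
      refine Real.exp_le_exp.2 ?_
      have h5 : c / 2 * (4 / c * Real.log n) = 2 * Real.log n := by field_simp; ring
      have h6 := mul_le_mul_of_nonneg_left h1 (by positivity : 0 ≤ c / 2)
      linarith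
    calc d * Real.exp (-(c * (l : ℝ) ^ m)) ≤ |d| * Real.exp (-(c * (l : ℝ) ^ m)) :=
          mul_le_mul_of_nonneg_right (le_abs_self d) (Real.exp_pos _).le
      _ ≤ |d| * (Real.exp (-(c / 2 * (l : ℝ) ^ m)) * (1 / n ^ 2)) :=
          mul_le_mul_of_nonneg_left h3 (abs_nonneg d)
      _ = _ := by ring
  · rw [mul_zero]; exact zero_le

lemma tendsto_obsLaw_exists_gt {θs : Param k} (hμ : statDist θs.1 ∈ stdSimplex ℝ (Fin k))
    {m c d : ℝ} (hm : 0 < m) (hc : 0 < c)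
    (hd : ∀ j l, (θs.2 j).1 l ≤ d * Real.exp (-(c * (l : ℝ) ^ m))) :
    Tendsto (fun n => obsLaw θs n {y | ∃ i, truncLevel (4 / c) m n < y i}) atTop (𝓝 0) := by
  set W := |d| * ∑' l : ℕ+, Real.exp (-(c / 2 * (l : ℝ) ^ m))
  have hlim : Tendsto (fun n : ℕ => ENNReal.ofReal (W * (1 / n))) atTop (𝓝 0) := by
    rw [← ENNReal.ofReal_zero]
    refine ENNReal.tendsto_ofReal ?_
    simpa using tendsto_one_div_atTop_nhds_zero_nat.const_mul W
  refine tendsto_of_tendsto_of_tendsto_of_le_of_le' tendsto_const_nhds hlim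
    (Eventually.of_forall fun n => zero_le) ?_
  filter_upwards [eventually_ge_atTop 1] with n hn
  have hn0 : (0 : ℝ) < n := by exact_mod_cast hn
  refine (obsLaw_exists_gt_le θs hμ n _ fun x => tsum_emit_tail_le hm hc hd hn x).trans
    (le_of_eq ?_)
  rw [← ENNReal.ofReal_natCast, ← ENNReal.ofReal_mul hn0.le]
  congr 1
  simp only [W]
  field_simp

/-! ### Prior mass of the neighbourhoods of the truth -/

instance isProbabilityMeasure_dirichletProcess (G : Measure ℕ+) :
    IsProbabilityMeasure (dirichletProcess G) :=
  Measure.isProbabilityMeasure_map measurable_normalize.aemeasurable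

instance isProbabilityMeasure_hmmPrior (priorQ : Measure (TransMat k)) [IsProbabilityMeasure priorQ]
    (G : Measure ℕ+) : IsProbabilityMeasure (hmmPrior priorQ G) := by
  unfold hmmPrior; infer_instance

lemma exists_box_ge_exp {priorQ : Measure (TransMat k)} {πq : stdSimplex ℝ (Fin k) → ℝ≥0}
    {Q₀ : TransMat k} (h : HasRowDensity priorQ πq Q₀) (hk : 1 ≤ k) {q : ℝ}
    (hQ₀ : Q₀ ∈ transMatGE k q) (hq : 0 < q) {s : ℝ} (hs : 1 ≤ s) :
    ∃ C : ℝ, ∀ᶠ n : ℕ in atTop, ENNReal.ofReal (Real.exp (-(C * Real.log n ^ s))) ≤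
      priorQ {Q | ∀ i j, |Q.entry i j - Q₀.entry i j| ≤ q / (2 * n)} := by
  obtain ⟨c, δ₀, hc, hδ₀, hbox⟩ := h.exists_box_ge hk hQ₀ hq
  set p : ℕ := (k - 1) * k
  refine ⟨|Real.log c| + p * |Real.log (q / 2)| + p, ?_⟩
  have hev : ∀ᶠ n : ℕ in atTop, q / (2 * n) ≤ δ₀ := by
    have h1 : Tendsto (fun n : ℕ => q / 2 * (1 / n)) atTop (𝓝 0) := by
      simpa using tendsto_one_div_atTop_nhds_zero_nat.const_mul (q / 2)
    filter_upwards [h1.eventually (ge_mem_nhds hδ₀)] with n hn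
    refine le_trans (le_of_eq ?_) hn
    ring
  filter_upwards [hev, eventually_ge_atTop 1, tendsto_log_natCast.eventually_ge_atTop 1]
    with n hn hn1 hu
  have hn0 : (0 : ℝ) < n := by exact_mod_cast hn1
  refine le_trans (ENNReal.ofReal_le_ofReal ?_) (hbox _ (by positivity) hn)
  have hpos : 0 < c * (q / (2 * n)) ^ p := by positivity
  rw [← Real.exp_log hpos]
  refine Real.exp_le_exp.2 ?_
  have h1 : Real.log (c * (q / (2 * n)) ^ p) =
      Real.log c + p * (Real.log (q / 2) - Real.log n) := by
    rw [Real.log_mul hc.ne' (by positivity), Real.log_pow,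
      show q / (2 * n : ℝ) = q / 2 / n by field_simp, Real.log_div (by positivity) hn0.ne']
  rw [h1]
  set u := Real.log n
  have hus : u ≤ u ^ s := by
    simpa using Real.rpow_le_rpow_of_exponent_le hu hs
  have hp : (0 : ℝ) ≤ p := Nat.cast_nonneg p
  have h2 := neg_abs_le (Real.log c)
  have h3 := mul_le_mul_of_nonneg_left (neg_abs_le (Real.log (q / 2))) hp
  have h4 : (|Real.log c| + p * |Real.log (q / 2)|) * 1 ≤
      (|Real.log c| + p * |Real.log (q / 2)|) * u ^ s :=
    mul_le_mul_of_nonneg_left (hu.trans hus) (by positivity)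
  have h5 := mul_le_mul_of_nonneg_left hus hp
  nlinarith

/-- The weights 1/l are at least 1/N for l ≤ N, so dropping them costs a factor N; this turns the
exponent K into K + 1. -/
lemma sum_neg_log_le {m c K d B : ℝ} {N₀ : ℕ+} {f : Emission}
    (hf : f ∈ envelopeClass m c K d B N₀) {N : ℕ+} (hN : N₀ ≤ N) :
    ∑ l ∈ Finset.Icc 1 N, -Real.log (f.1 l) ≤ |B| * (N : ℝ) ^ (K + 1) := by
  have hN0 : (0 : ℝ) < N := by exact_mod_cast N.pos
  calc ∑ l ∈ Finset.Icc 1 N, -Real.log (f.1 l)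
      ≤ ∑ l ∈ Finset.Icc 1 N, (N : ℝ) * (-Real.log (f.1 l) / (l : ℝ)) := by
        refine Finset.sum_le_sum fun l hl => ?_
        have hl0 : (0 : ℝ) < l := by exact_mod_cast l.pos
        have hlN : (l : ℝ) ≤ N := by exact_mod_cast (Finset.mem_Icc.1 hl).2
        have hlog : 0 ≤ -Real.log (f.1 l) := neg_nonneg.2 (Real.log_nonpos (hf.1 l).le
          (le_hasSum f.2.2 l fun j _ => f.2.1 j))
        rw [← mul_div_assoc, le_div_iff₀ hl0, mul_comm]
        exact mul_le_mul_of_nonneg_right hlN hlog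
    _ ≤ N * (|B| * (N : ℝ) ^ K) := by
        rw [← Finset.mul_sum]
        exact mul_le_mul_of_nonneg_left ((hf.2.2 N hN).trans
          (mul_le_mul_of_nonneg_right (le_abs_self B) (Real.rpow_nonneg hN0.le _))) hN0.le
    _ = _ := by rw [Real.rpow_add_one hN0.ne']; ring

/-- The level L is of order (log n)^(1/m), and the exponent of the Dirichlet bound is at most of
order L log n + L^(K+1). The two terms give the two conditions on `s`. -/
lemma exists_dirichletProcess_ge_exp {G : Measure ℕ+} (hG : PolynomialTail G) {m c K : ℝ}
    (hm : 0 < m) (hK : 0 < K) {f : Emission} (hf : f ∈ emissionClass m c K) {a : ℝ} (ha : 0 < a)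
    {s : ℝ} (hs1 : 1 / m + 1 ≤ s) (hs2 : (K + 1) / m ≤ s) :
    ∃ C : ℝ, ∀ᶠ n : ℕ in atTop, ENNReal.ofReal (Real.exp (-(C * Real.log n ^ s))) ≤
      dirichletProcess G {g | ∀ l ≤ truncLevel a m n, f.1 l / (1 + 1 / (2 * n)) ≤ g.1 l} := by
  obtain ⟨d, B, N₀, hfm⟩ := hf
  obtain ⟨C, D, L₀, hC, hD, hDP⟩ := exists_dirichletProcess_ge hG
  set a' := a ^ (1 / m) + 1 with ha'
  have ha'1 : 1 ≤ a' := by rw [ha']; linarith [Real.rpow_pos_of_pos ha (1 / m)]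
  have hm' : 0 < 1 / m := by positivity
  set C₂ := 3 + |Real.log a'| + 1 / m with hC₂
  refine ⟨C * (3 + a' * C₂ + |B| * a' ^ (K + 1)), ?_⟩
  have htend := tendsto_truncLevel ha hm
  filter_upwards [eventually_ge_atTop 1, tendsto_log_natCast.eventually_ge_atTop 1,
    tendsto_natCast_atTop_atTop.eventually_ge_atTop (2 * (D + 1)),
    htend.eventually_ge_atTop (N₀ : ℝ), htend.eventually_ge_atTop (L₀ : ℝ)]
    with n hn1 hu hnD hN hL
  have hn0 : (0 : ℝ) < n := by exact_mod_cast hn1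
  have hn1' : (1 : ℝ) ≤ n := by exact_mod_cast hn1
  set L := truncLevel a m n with hLdef
  have hNL : N₀ ≤ L := by exact_mod_cast hN
  have hLL : L₀ ≤ L := by exact_mod_cast hL
  have hL0 : (0 : ℝ) < L := by exact_mod_cast L.pos
  set u := Real.log n with hudef
  have hu0 : 0 < u := by linarith
  have hLle : (L : ℝ) ≤ a' * u ^ (1 / m) := truncLevel_le ha.le hm hu
  -- Small enough for D η ≤ 1/(2n), yet log(1/η) ≤ 2 log n for large n.
  set η : ℝ := 1 / (2 * n * (D + 1)) with hη
  have hη0 : 0 < η := by positivity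
  have hη1 : η ≤ 1 := by
    rw [hη, div_le_one (by positivity)]
    nlinarith
  have hDη : D * η ≤ 1 / (2 * n) := by
    rw [hη, mul_one_div, div_le_div_iff₀ (by positivity) (by positivity)]
    nlinarith
  refine le_trans (ENNReal.ofReal_le_ofReal (Real.exp_le_exp.2 (neg_le_neg ?_)))
    ((hDP f hfm.1 L hLL η hη0 hη1).trans (measure_mono fun g hg l hl => le_trans ?_ (hg l hl)))
  swap
  · exact div_le_div_of_nonneg_left (hfm.1 l).le (by positivity) (by linarith)
  rw [mul_assoc]
  refine mul_le_mul_of_nonneg_left ?_ hC.le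
  have hlogη : Real.log (1 / η) ≤ 2 * u := by
    rw [hη, one_div_one_div]
    calc Real.log (2 * n * (D + 1)) ≤ Real.log (n * n) :=
          Real.log_le_log (by positivity) (by nlinarith)
      _ = 2 * u := by rw [Real.log_mul hn0.ne' hn0.ne']; ring
  have hlogL : Real.log L ≤ |Real.log a'| * u + 1 / m * u := by
    have h1 := Real.log_le_log hL0 hLle
    rw [Real.log_mul (by positivity) (by positivity), Real.log_rpow hu0] at h1
    have h2 : Real.log u ≤ u := (Real.log_le_sub_one_of_pos hu0).trans (by linarith)
    have h3 := mul_le_mul_of_nonneg_left h2 hm'.le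
    have h4 : Real.log a' ≤ |Real.log a'| * u :=
      (le_abs_self _).trans (le_mul_of_one_le_right (abs_nonneg _) hu)
    linarith
  have hsum1 : ∑ l ∈ Finset.Icc 1 L, (1 + Real.log (1 / η) + Real.log l - Real.log (f.1 l)) ≤
      L * (C₂ * u) + |B| * (L : ℝ) ^ (K + 1) := by
    calc ∑ l ∈ Finset.Icc 1 L, (1 + Real.log (1 / η) + Real.log l - Real.log (f.1 l))
        ≤ ∑ l ∈ Finset.Icc 1 L, (C₂ * u + -Real.log (f.1 l)) := by
          refine Finset.sum_le_sum fun l hl => ?_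
          have hl0 : (0 : ℝ) < l := by exact_mod_cast l.pos
          have h1 : Real.log l ≤ Real.log L :=
            Real.log_le_log hl0 (by exact_mod_cast (Finset.mem_Icc.1 hl).2)
          rw [hC₂]
          linarith
      _ ≤ _ := by
          rw [Finset.sum_add_distrib, Finset.sum_const, nsmul_eq_mul]
          refine add_le_add (le_of_eq ?_) (sum_neg_log_le hfm hNL)
          simp
  have hus : u ≤ u ^ s := by
    simpa using Real.rpow_le_rpow_of_exponent_le hu (by linarith : 1 ≤ s)
  have hLu : L * u ≤ a' * u ^ s := by
    calc L * u ≤ a' * u ^ (1 / m) * u := mul_le_mul_of_nonneg_right hLle hu0.le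
      _ = a' * u ^ (1 / m + 1) := by rw [Real.rpow_add_one hu0.ne']; ring
      _ ≤ _ := mul_le_mul_of_nonneg_left (Real.rpow_le_rpow_of_exponent_le hu hs1) (by linarith)
  have hLK : (L : ℝ) ^ (K + 1) ≤ a' ^ (K + 1) * u ^ s := by
    calc (L : ℝ) ^ (K + 1) ≤ (a' * u ^ (1 / m)) ^ (K + 1) :=
          Real.rpow_le_rpow hL0.le hLle (by linarith)
      _ = a' ^ (K + 1) * u ^ ((K + 1) / m) := by
          rw [Real.mul_rpow (by linarith) (Real.rpow_nonneg hu0.le _), ← Real.rpow_mul hu0.le]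
          congr 2
          ring
      _ ≤ _ := mul_le_mul_of_nonneg_left (Real.rpow_le_rpow_of_exponent_le hu hs2)
          (Real.rpow_nonneg (by linarith) _)
  have hC₂0 : 0 ≤ C₂ := by positivity
  have h1 := mul_le_mul_of_nonneg_left hLu hC₂0
  have h2 := mul_le_mul_of_nonneg_left hLK (abs_nonneg B)
  calc 1 + Real.log (1 / η) +
        ∑ l ∈ Finset.Icc 1 L, (1 + Real.log (1 / η) + Real.log l - Real.log (f.1 l))
      ≤ 3 * u ^ s + (C₂ * (a' * u ^ s) + |B| * (a' ^ (K + 1) * u ^ s)) := by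
        linarith
    _ = _ := by ring

lemma exists_hmmPrior_closeParam_ge {priorQ : Measure (TransMat k)}
    {πq : stdSimplex ℝ (Fin k) → ℝ≥0} {θs : Param k}
    (h : HasRowDensity priorQ πq θs.1) (hk : 1 ≤ k) {q : ℝ} (hQ₀ : θs.1 ∈ transMatGE k q)
    (hq : 0 < q) {G : Measure ℕ+} (hG : PolynomialTail G) {m c K : ℝ} (hm : 0 < m) (hK : 0 < K)
    (hfs : ∀ j, θs.2 j ∈ emissionClass m c K) {a : ℝ} (ha : 0 < a)
    {s : ℝ} (hs1 : 1 / m + 1 ≤ s) (hs2 : (K + 1) / m ≤ s) :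
    ∃ C : ℝ, ∀ᶠ n : ℕ in atTop, ENNReal.ofReal (Real.exp (-(C * Real.log n ^ s))) ≤
      hmmPrior priorQ G (closeParam θs (q / (2 * n)) (1 / (2 * n)) (truncLevel a m n)) := by
  have hm' : 0 < 1 / m := by positivity
  obtain ⟨C₀, hC₀⟩ := exists_box_ge_exp h hk hQ₀ hq (by linarith : 1 ≤ s)
  choose C hC using fun j => exists_dirichletProcess_ge_exp hG hm hK (hfs j) ha hs1 hs2
  refine ⟨C₀ + ∑ j, C j, ?_⟩
  filter_upwards [hC₀, eventually_all.2 hC] with n h0 h1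
  rw [closeParam, hmmPrior, Measure.prod_prod, Measure.pi_pi]
  refine le_trans (le_of_eq ?_) (mul_le_mul' h0 (Finset.prod_le_prod' fun j _ => h1 j))
  rw [← ENNReal.ofReal_prod_of_nonneg fun j _ => (Real.exp_pos _).le,
    ← ENNReal.ofReal_mul (Real.exp_pos _).le, ← Real.exp_sum, ← Real.exp_add]
  congr 2
  rw [Finset.sum_neg_distrib, ← Finset.sum_mul]
  ring

end

/-! ### The general rate and the three prior tails -/

section

variable {k : ℕ}

/-! ### Posterior concentration -/

lemma tendsto_mul_rpow_sub_atBot (C : ℝ) {b s w : ℝ} (hb : 0 < b) (hsw : s < w) (hw : 0 < w) :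
    Tendsto (fun u : ℝ => C * u ^ s - b * u ^ w) atTop atBot := by
  have h1 : Tendsto (fun u : ℝ => C * u ^ (-(w - s)) - b) atTop (𝓝 (C * 0 - b)) :=
    ((tendsto_rpow_neg_atTop (by linarith)).const_mul C).sub_const b
  rw [mul_zero, zero_sub] at h1
  have h2 := (tendsto_rpow_atTop hw).atTop_mul_neg (neg_neg_of_pos hb) h1
  refine h2.congr' ?_
  filter_upwards [eventually_gt_atTop 0] with u hu
  have h3 : u ^ w * u ^ (-(w - s)) = u ^ s := by
    rw [← Real.rpow_add hu]; congr 1; ring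
  rw [← h3]
  ring

lemma tendsto_exp_mul_exp_neg (C : ℝ) {b s w : ℝ} (hb : 0 < b) (hsw : s < w) (hw : 0 < w) :
    Tendsto (fun n : ℕ => Real.exp (C * Real.log n ^ s) * Real.exp (-(b * Real.log n ^ w)))
      atTop (𝓝 0) := by
  refine ((Real.tendsto_exp_atBot.comp (tendsto_mul_rpow_sub_atBot C hb hsw hw)).comp
    tendsto_log_natCast).congr fun n => ?_
  simp only [Function.comp]
  rw [← Real.exp_add, sub_eq_add_neg]

lemma measurableSet_transMatGE (q : ℝ) : MeasurableSet (transMatGE k q) := by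
  simp only [transMatGE, Set.ofPred_forall]
  exact MeasurableSet.iInter fun i => MeasurableSet.iInter fun j =>
    measurableSet_le measurable_const (measurable_entry i j)

/-- A gap with q g ≥ 2 log n makes (1 - q)^g at most n^(-2). Dividing by q costs at most n, so each
of the N ≤ n factors is at most 1 + 1/n. -/
lemma one_add_gap_pow_le {n N g : ℕ} {q u : ℝ} (hn : 1 ≤ n) (hu : u = Real.log n) (hq : 0 < q)
    (hq1 : q ≤ 1) (hqn : 1 / q ≤ n) (hg : 2 * u ≤ q * g) (hN : N ≤ n) :
    ENNReal.ofReal (1 + (1 - q) ^ g / q) ^ N ≤ ENNReal.ofReal (Real.exp 1) := by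
  have hn0 : (0 : ℝ) < n := by exact_mod_cast hn
  have h1 : (1 - q) ^ g ≤ 1 / n ^ 2 := by
    calc (1 - q) ^ g ≤ Real.exp (-q) ^ g :=
          pow_le_pow_left₀ (by linarith) (by linarith [Real.add_one_le_exp (-q)]) g
      _ = Real.exp (-(q * g)) := by rw [← Real.exp_nat_mul]; congr 1; ring
      _ ≤ Real.exp (-(2 * u)) := Real.exp_le_exp.2 (by linarith)
      _ = 1 / n ^ 2 := by
          rw [hu, Real.exp_neg, mul_comm, Real.exp_mul, Real.exp_log hn0, one_div]
          norm_num
  have h2 : (1 - q) ^ g / q ≤ 1 / n := by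
    calc (1 - q) ^ g / q = (1 - q) ^ g * (1 / q) := by ring
      _ ≤ 1 / n ^ 2 * n := mul_le_mul h1 hqn (by positivity) (by positivity)
      _ = 1 / n := by field_simp
  have h3 : 0 ≤ (1 - q) ^ g / q := div_nonneg (pow_nonneg (by linarith) g) hq.le
  rw [← ENNReal.ofReal_pow (by linarith)]
  refine ENNReal.ofReal_le_ofReal ?_
  calc (1 + (1 - q) ^ g / q) ^ N ≤ Real.exp (1 / n) ^ N :=
        pow_le_pow_left₀ (by linarith) (by linarith [Real.add_one_le_exp (1 / n : ℝ)]) N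
    _ = Real.exp (N * (1 / n)) := by rw [← Real.exp_nat_mul]
    _ ≤ Real.exp 1 := by
        refine Real.exp_le_exp.2 ?_
        rw [mul_one_div, div_le_one hn0]
        exact_mod_cast hN

lemma eventually_const_mul_log_rpow_le (C r : ℝ) :
    ∀ᶠ n : ℕ in atTop, C * Real.log n ^ r ≤ n := by
  have h := ((isLittleO_log_rpow_rpow_atTop r one_pos).const_mul_left C).comp_tendsto
    tendsto_natCast_atTop_atTop
  filter_upwards [h.bound one_pos] with n hn
  simp only [Function.comp, Real.rpow_one, one_mul, Real.norm_eq_abs, Nat.abs_cast] at hn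
  exact (le_abs_self _).trans hn

/-- Number of separated blocks. -/
lemma div_block_ge {n ℓ : ℕ} {v : ℝ} (hv : 1 ≤ v) (hn : 2 * (ℓ + 3) * v ≤ n) :
    n / (2 * (ℓ + 3) * v) ≤ ((n / (ℓ + ⌈2 * v⌉₊) : ℕ) : ℝ) := by
  set b := ℓ + ⌈2 * v⌉₊ with hb
  have hbv : (b : ℝ) ≤ (ℓ + 3) * v := by
    have h1 := (Nat.ceil_lt_add_one (by linarith : 0 ≤ 2 * v)).le
    rw [hb]
    push_cast
    have h2 : (ℓ : ℝ) ≤ ℓ * v := le_mul_of_one_le_right (Nat.cast_nonneg ℓ) hv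
    nlinarith
  have hb0 : 0 < b := by
    have : 0 < ⌈2 * v⌉₊ := Nat.ceil_pos.2 (by linarith)
    omega
  have hb0' : (0 : ℝ) < b := by exact_mod_cast hb0
  have h3 : (n : ℝ) < b * ((n / b : ℕ) + 1) := by
    exact_mod_cast Nat.lt_mul_div_succ n hb0
  have hw : 0 < (ℓ + 3 : ℝ) * v := by positivity
  have h4 : (n : ℝ) < (ℓ + 3) * v * ((n / b : ℕ) + 1) :=
    h3.trans_le (mul_le_mul_of_nonneg_right hbv (by positivity))
  -- Rounding down loses less than one block, and `hn` makes n at least twice the bound (ℓ + 3) v on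
  -- a block with its gap.
  rw [div_le_iff₀ (by positivity)]
  nlinarith

/-- Concentration of the posterior, for priors that charge the matrices with an entry smaller than
a negative power of `log n` very little. -/
theorem concentratesAtRate_of_prior_tail {θs : Param k} (hk : 1 ≤ k) {qs : ℝ} (hqs : 0 < qs)
    (hQs : θs.1 ∈ transMatGE k qs) {m c K : ℝ} (hm : 0 < m) (hc : 0 < c) (hK : 0 < K)
    (hfs : ∀ j, θs.2 j ∈ emissionClass m c K) {G : Measure ℕ+} (hG : PolynomialTail G)
    {priorQ : Measure (TransMat k)} [IsProbabilityMeasure priorQ]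
    {πq : stdSimplex ℝ (Fin k) → ℝ≥0} (hpriorQ : HasRowDensity priorQ πq θs.1) (ℓ : ℕ)
    {Ω : Type*} [MeasurableSpace Ω] {P : Measure Ω} {X : ℕ → Ω → Fin k} {Y : ℕ → Ω → ℕ+}
    (hXY : IsHiddenMarkovChain P X Y (statDist θs.1) θs) {r s τ : ℝ} (hr : 0 < r)
    (hs1 : 1 / m + 1 ≤ s) (hs2 : (K + 1) / m ≤ s) (hτ : 1 + r + s < 2 * τ)
    (htail : ∀ C : ℝ, Tendsto (fun n : ℕ => ENNReal.ofReal (Real.exp (C * Real.log n ^ s)) *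
      priorQ (transMatGE k (Real.log n ^ (-r)))ᶜ) atTop (𝓝 0)) :
    ConcentratesAtRate P Y (hmmPrior priorQ G) ℓ θs
      fun n : ℕ => 1 / Real.sqrt n * Real.log n ^ τ := by
  have hm' : 0 < 1 / m := by positivity
  have hst := isStationary_statDist hk hqs hQs
  set ν := hmmPrior priorQ G with hν
  have hpos : ∀ᵐ θ ∂ν, ∀ i j, 0 < θ.1.entry i j :=
    Measure.quasiMeasurePreserving_fst.ae (hpriorQ.ae_pos hk)
  obtain ⟨d, hd⟩ : ∃ d : ℝ, ∀ j l, (θs.2 j).1 l ≤ d * Real.exp (-(c * (l : ℝ) ^ m)) := by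
    choose d B N₀ hmem using hfs
    obtain ⟨d₁, hd₁⟩ := Finite.exists_le d
    exact ⟨d₁, fun j l => ((hmem j).2.1 l).trans
      (mul_le_mul_of_nonneg_right (hd₁ j) (Real.exp_pos _).le)⟩
  obtain ⟨C, hC⟩ := exists_hmmPrior_closeParam_ge hpriorQ hk hQs hqs hG hm hK hfs
    (a := 4 / c) (by positivity) hs1 hs2
  refine concentratesAtRate_of_tendsto hXY (M := 4) (by norm_num) fun σ hσ hσ' => ?_
  set Z := ∑' z : Fin ℓ → ℕ+, ENNReal.ofReal √(obsDensity θs ℓ z)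
  have hZ : Z ≠ ∞ := tsum_sqrt_obsDensity_ne_top hst.1 hm hc hd ℓ
  -- N x² is at least of order (log n)^w; s < w lets the test beat the factor exp(C (log n)^s)
  -- coming from the prior mass.
  set w := 2 * τ - 1 - r with hw
  have hw0 : 0 < w := by linarith
  have hsw : s < w := by linarith
  set c₃ : ℝ := 1 / (2 * (ℓ + 3)) with hc₃
  have hc₃0 : 0 < c₃ := by positivity
  set E := ENNReal.ofReal (Real.exp 1)
  set Q₄ := ENNReal.ofReal (qs / 4)
  have hQ₄ : Q₄ ≠ 0 := by simp [Q₄, hqs]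
  -- the three terms of the bound
  let T₁ : ℕ → ℝ≥0∞ := fun n => E * (ENNReal.ofReal (1 / √(c₃ * Real.log n ^ w)) * Z)
  let T₂ : ℕ → ℝ≥0∞ := fun n => obsLaw θs n {y | ∃ i, truncLevel (4 / c) m n < y i}
  let T₃ : ℕ → ℝ≥0∞ := fun n => (σ * Q₄)⁻¹ *
    (E * ENNReal.ofReal (Real.exp (C * Real.log n ^ s) *
      Real.exp (-(2 * c₃ * Real.log n ^ w))) +
    ENNReal.ofReal (Real.exp (C * Real.log n ^ s)) * priorQ (transMatGE k (Real.log n ^ (-r)))ᶜ)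
  have hT₁ : Tendsto T₁ atTop (𝓝 0) := by
    have h1 : Tendsto (fun n : ℕ => 1 / √(c₃ * Real.log n ^ w)) atTop (𝓝 0) := by
      simp_rw [one_div]
      exact tendsto_inv_atTop_zero.comp (Real.tendsto_sqrt_atTop.comp
        (((tendsto_rpow_atTop hw0).comp tendsto_log_natCast).const_mul_atTop hc₃0))
    have h2 := ENNReal.tendsto_ofReal h1
    rw [ENNReal.ofReal_zero] at h2
    have h3 := ENNReal.Tendsto.const_mul (ENNReal.Tendsto.mul_const h2 (Or.inr hZ))
      (Or.inr (ENNReal.ofReal_ne_top (r := Real.exp 1)))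
    rw [zero_mul, mul_zero] at h3
    exact h3
  have hT₂ : Tendsto T₂ atTop (𝓝 0) := tendsto_obsLaw_exists_gt hst.1 hm hc hd
  have hT₃ : Tendsto T₃ atTop (𝓝 0) := by
    have h1 := ENNReal.tendsto_ofReal
      (tendsto_exp_mul_exp_neg C (b := 2 * c₃) (by positivity) hsw hw0)
    rw [ENNReal.ofReal_zero] at h1
    have h2 := ENNReal.Tendsto.const_mul h1 (Or.inr (ENNReal.ofReal_ne_top (r := Real.exp 1)))
    have h3 := ENNReal.Tendsto.const_mul (h2.add (htail C))
      (Or.inr (ENNReal.inv_ne_top.2 (mul_ne_zero hσ hQ₄)))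
    simpa using h3
  have hlim : Tendsto (fun n => T₁ n + T₂ n + T₃ n) atTop (𝓝 0) := by
    simpa using (hT₁.add hT₂).add hT₃
  refine tendsto_of_tendsto_of_tendsto_of_le_of_le' tendsto_const_nhds hlim
    (Eventually.of_forall fun n => zero_le) ?_
  have hqev : ∀ᶠ n : ℕ in atTop, Real.log n ^ (-r) ≤ qs :=
    ((tendsto_rpow_neg_atTop hr).comp tendsto_log_natCast).eventually (ge_mem_nhds hqs)
  filter_upwards [hC, hqev, eventually_ge_atTop 1, tendsto_log_natCast.eventually_ge_atTop 1,
    eventually_const_mul_log_rpow_le 1 r,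
    eventually_const_mul_log_rpow_le (2 * (ℓ + 3)) (1 + r)] with n hCn hqn hn1 hu hun hbn
  have hn0 : (0 : ℝ) < n := by exact_mod_cast hn1
  set u := Real.log n with hudef
  have hu0 : 0 < u := by linarith
  set q := u ^ (-r) with hqdef
  have hq0 : 0 < q := Real.rpow_pos_of_pos hu0 _
  have hq1 : q ≤ 1 := Real.rpow_le_one_of_one_le_of_nonpos hu (by linarith)
  set v := u ^ (1 + r) with hv
  have hv1 : 1 ≤ v := Real.one_le_rpow hu (by linarith)
  -- As q v = log n, this gives q g ≥ 2 log n, and dependence between blocks costs at most the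
  -- factor e.
  set g := ⌈2 * v⌉₊ with hg
  set N := n / (ℓ + g) with hN
  have hNn : N * (ℓ + g) ≤ n := Nat.div_mul_le_self n _
  set x := 1 / √(n : ℝ) * u ^ τ with hx
  have huτ : 0 < u ^ τ := Real.rpow_pos_of_pos hu0 _
  have hx0 : 0 < x := by positivity
  have hN1 : n / (2 * (ℓ + 3) * v) ≤ (N : ℝ) := div_block_ge hv1 hbn
  have hNpos' : (0 : ℝ) < N := lt_of_lt_of_le (by positivity) hN1
  have hNpos : 0 < N := by exact_mod_cast hNpos'
  have hNx : c₃ * u ^ w ≤ N * x ^ 2 := by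
    have h1 : x ^ 2 = u ^ (2 * τ) / n := by
      rw [hx, mul_pow, div_pow, Real.sq_sqrt hn0.le, one_pow, ← Real.rpow_natCast (u ^ τ),
        ← Real.rpow_mul hu0.le]
      rw [show τ * ((2 : ℕ) : ℝ) = 2 * τ by push_cast; ring]
      ring
    have h2 : u ^ (2 * τ) = u ^ w * v := by
      rw [hv, ← Real.rpow_add hu0]; congr 1; rw [hw]; ring
    have h3 := mul_le_mul_of_nonneg_right hN1 (sq_nonneg x)
    refine le_trans (le_of_eq ?_) h3
    rw [h1, h2, hc₃]
    have hv0 : v ≠ 0 := by positivity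
    have hℓ0 : (ℓ : ℝ) + 3 ≠ 0 := by positivity
    field_simp
  have hR : ENNReal.ofReal (1 + (1 - q) ^ g / q) ^ N ≤ E := by
    refine one_add_gap_pow_le hn1 hudef hq0 hq1 ?_ ?_ (Nat.div_le_self n _)
    · rw [hqdef, Real.rpow_neg hu0.le, one_div, inv_inv]
      linarith
    · calc 2 * u = q * (2 * v) := by
            rw [hqdef, hv, ← mul_assoc, mul_comm (u ^ (-r)), mul_assoc, ← Real.rpow_add hu0]
            rw [show -r + (1 + r) = 1 by ring, Real.rpow_one]
        _ ≤ q * g := mul_le_mul_of_nonneg_left (Nat.le_ceil _) hq0.le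
  have hQsq : θs.1 ∈ transMatGE k q := fun i j => hqn.trans (hQs i j)
  set T := blockTest θs (Nat.le_add_right ℓ g) hNn x with hT
  set κ := Q₄ * ENNReal.ofReal (Real.exp (-(C * u ^ s))) with hκ
  have hκ0 : κ ≠ 0 := mul_ne_zero hQ₄ (by simp [Real.exp_pos])
  have hκ' : κ ≠ ∞ := ENNReal.mul_ne_top ENNReal.ofReal_ne_top ENNReal.ofReal_ne_top
  set β := E * ENNReal.ofReal (Real.exp (-(2 * c₃ * u ^ w))) with hβ
  have hA : NullMeasurableSet {θ : Param k | 4 * x ≤ obsDist ℓ θ θs} ν :=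
    nullMeasurableSet_le aemeasurable_const (aemeasurable_obsDist hk hpos ℓ θs)
  have hS : MeasurableSet (Prod.fst ⁻¹' transMatGE k q : Set (Param k)) :=
    (measurableSet_transMatGE q).preimage measurable_fst
  -- The test is needed only for matrices with entries at least q; the rest is left to the prior
  -- tail.
  have hpost := obsLaw_posterior_ge_le (ν := ν) hk hpos (θs := θs) hA hS T hσ hσ' hκ0 hκ'
    (β := β) fun θ hθ => by
      refine (obsLaw_compl_blockTest_le hk hQs hqs hθ.2 hq0 hq1 hNn hNpos hx0 hθ.1).trans
        (mul_le_mul' hR (ENNReal.ofReal_le_ofReal (Real.exp_le_exp.2 ?_)))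
      nlinarith
  refine hpost.trans (add_le_add (add_le_add ?_ ?_) ?_)
  · refine (obsLaw_blockTest_le hk hQsq hq0 hq1 hNn hNpos hx0).trans (mul_le_mul' hR ?_)
    rw [ENNReal.div_eq_inv_mul, ← mul_assoc, ← ENNReal.ofReal_inv_of_pos hx0,
      ← ENNReal.ofReal_mul (by positivity)]
    refine mul_le_mul_left (ENNReal.ofReal_le_ofReal ?_) _
    have h1 : x⁻¹ * (1 / √(N : ℝ)) = 1 / √(N * x ^ 2) := by
      rw [Real.sqrt_mul hNpos'.le, Real.sqrt_sq hx0.le]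
      field_simp
    rw [h1]
    exact one_div_le_one_div_of_le (Real.sqrt_pos.2 (mul_pos hc₃0 (Real.rpow_pos_of_pos hu0 _)))
      (Real.sqrt_le_sqrt hNx)
  -- If no observation exceeds the truncation level, the evidence bound holds deterministically, so
  -- a small denominator forces a large observation.
  · refine measure_mono fun y hy => ?_
    by_contra hcon
    simp only [Set.mem_ofPred_eq, not_exists, not_lt] at hcon
    refine absurd hy (not_lt.2 (le_trans ?_ (lintegral_obsDensity_ge ν hk hqs hQs hn1
      (by positivity : (0 : ℝ) ≤ 1 / (2 * n)) le_rfl hcon)))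
    gcongr
    exact mul_le_mul_right hCn Q₄
  · rw [ENNReal.div_eq_inv_mul, hκ, ← mul_assoc,
      ENNReal.mul_inv (Or.inr ENNReal.ofReal_ne_top) (Or.inr (by simp [Real.exp_pos])),
      ← ENNReal.ofReal_inv_of_pos (Real.exp_pos _), ← Real.exp_neg, neg_neg, mul_assoc]
    refine mul_le_mul_right (le_of_eq ?_) _
    have hνS : ν (Prod.fst ⁻¹' transMatGE k q)ᶜ = priorQ (transMatGE k q)ᶜ := by
      rw [hν, hmmPrior, ← Set.preimage_compl, ← Set.prod_univ, Measure.prod_prod, measure_univ,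
        mul_one]
    rw [hνS, mul_add, hβ, ENNReal.ofReal_mul (Real.exp_pos _).le]
    ring

/-! ### The three tail conditions -/

lemma tendsto_ofReal_exp_mul_of_le {C s : ℝ} {φ : Fin k → ℕ → ℝ} {D : ℝ} {p : ℕ → ℝ≥0∞}
    (hp : ∀ᶠ n in atTop, p n ≤ ENNReal.ofReal (D * ∑ j, Real.exp (-(φ j n))))
    (hφ : ∀ j, Tendsto (fun n : ℕ => Real.exp (C * Real.log n ^ s) * Real.exp (-(φ j n)))
      atTop (𝓝 0)) :
    Tendsto (fun n : ℕ => ENNReal.ofReal (Real.exp (C * Real.log n ^ s)) * p n) atTop (𝓝 0) := by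
  have h1 : Tendsto (fun n : ℕ => ENNReal.ofReal
      (D * ∑ j, Real.exp (C * Real.log n ^ s) * Real.exp (-(φ j n)))) atTop (𝓝 0) := by
    rw [← ENNReal.ofReal_zero]
    refine ENNReal.tendsto_ofReal ?_
    simpa using (tendsto_finsetSum Finset.univ fun j _ => hφ j).const_mul D
  refine tendsto_of_tendsto_of_tendsto_of_le_of_le' tendsto_const_nhds h1
    (Eventually.of_forall fun n => zero_le) ?_
  filter_upwards [hp] with n hn
  refine (mul_le_mul_right hn _).trans (le_of_eq ?_)
  rw [← ENNReal.ofReal_mul (Real.exp_pos _).le, ← Finset.mul_sum]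
  congr 1
  ring

/-- At the threshold (log n)^(-r) the tail is of order exp(-α (log n)^r), which beats exp(C (log
n)^s) because r > s. -/
lemma HasRowDensity.tendsto_of_expTail {priorQ : Measure (TransMat k)}
    {πq : stdSimplex ℝ (Fin k) → ℝ≥0} {Q₀ : TransMat k} (h : HasRowDensity priorQ πq Q₀)
    (hk : 1 ≤ k) (hπ : ExpTail πq) {r s : ℝ} (hr : 0 < r) (hsr : s < r) (C : ℝ) :
    Tendsto (fun n : ℕ => ENNReal.ofReal (Real.exp (C * Real.log n ^ s)) *
      priorQ (transMatGE k (Real.log n ^ (-r)))ᶜ) atTop (𝓝 0) := by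
  obtain ⟨α, D, hα, hle⟩ := hπ
  refine tendsto_ofReal_exp_mul_of_le (φ := fun j n => α j * Real.log n ^ r) (D := k * |D| ^ k)
    ?_ fun j => tendsto_exp_mul_exp_neg C (hα j) hsr hr
  filter_upwards [tendsto_log_natCast.eventually_ge_atTop 1] with n hu
  have hu0 : 0 < Real.log n := by linarith
  refine (h.measure_compl_transMatGE_le hk (φ := fun j x => α j / x)
    (fun j x hx => div_nonneg (hα j).le hx.le)
    (fun j x hx y _ hxy => div_le_div_of_nonneg_left (hα j).le hx hxy) hle
    (Real.rpow_pos_of_pos hu0 (-r))).trans (le_of_eq ?_)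
  congr 3
  funext j
  rw [Real.rpow_neg hu0.le, div_inv_eq_mul]

lemma tendsto_exp_mul_exp_neg_exp (C : ℝ) {b s a : ℝ} (hb : 0 < b) (ha : 0 < a) (hs : 0 ≤ s) :
    Tendsto (fun n : ℕ => Real.exp (C * Real.log n ^ s) *
      Real.exp (-(b * Real.exp (Real.log n ^ a)))) atTop (𝓝 0) := by
  refine tendsto_of_tendsto_of_tendsto_of_le_of_le' tendsto_const_nhds
    (tendsto_exp_mul_exp_neg C hb (lt_add_one s) (by linarith))
    (Eventually.of_forall fun n => by positivity) ?_
  have h1 : ∀ᶠ u : ℝ in atTop, u ^ (s + 1) ≤ Real.exp (u ^ a) := by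
    have h2 := (isLittleO_rpow_exp_atTop ((s + 1) / a)).comp_tendsto (tendsto_rpow_atTop ha)
    filter_upwards [h2.bound one_pos, eventually_gt_atTop 0] with u hu hu0
    simp only [Function.comp, one_mul, Real.norm_eq_abs, Real.abs_exp] at hu
    rw [← Real.rpow_mul hu0.le, mul_div_cancel₀ _ ha.ne'] at hu
    exact (le_abs_self _).trans hu
  filter_upwards [tendsto_log_natCast.eventually h1] with n hn
  gcongr

/-- At the threshold 1/log n the tail is of order exp(-β exp((log n)^α)), and exp((log n)^α)
outgrows every power of log n. Hence r = 1 is enough, whatever the α. -/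
lemma HasRowDensity.tendsto_of_expExpTail {priorQ : Measure (TransMat k)}
    {πq : stdSimplex ℝ (Fin k) → ℝ≥0} {Q₀ : TransMat k} (h : HasRowDensity priorQ πq Q₀)
    (hk : 1 ≤ k) (hπ : ExpExpTail πq) {s : ℝ} (hs : 0 ≤ s) (C : ℝ) :
    Tendsto (fun n : ℕ => ENNReal.ofReal (Real.exp (C * Real.log n ^ s)) *
      priorQ (transMatGE k (Real.log n ^ (-1 : ℝ)))ᶜ) atTop (𝓝 0) := by
  obtain ⟨α, b, D, hα, hb, hle⟩ := hπ
  refine tendsto_ofReal_exp_mul_of_le (φ := fun j n => b j * Real.exp (Real.log n ^ α j))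
    (D := k * |D| ^ k) ?_ fun j => tendsto_exp_mul_exp_neg_exp C (hb j) (hα j) hs
  filter_upwards [tendsto_log_natCast.eventually_ge_atTop 1] with n hu
  have hu0 : 0 < Real.log n := by linarith
  refine (h.measure_compl_transMatGE_le hk (φ := fun j x => b j * Real.exp (x ^ (-α j)))
    (fun j x hx => mul_nonneg (hb j).le (Real.exp_pos _).le)
    (fun j x hx y _ hxy => mul_le_mul_of_nonneg_left (Real.exp_le_exp.2
      (Real.rpow_le_rpow_of_nonpos hx hxy (neg_nonpos.2 (hα j).le))) (hb j).le) hle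
    (Real.rpow_pos_of_pos hu0 (-1))).trans (le_of_eq ?_)
  congr 3
  funext j
  rw [← Real.rpow_mul hu0.le, neg_one_mul, neg_neg]

/-- Once 1/log n is below the truncation bound, the prior tail is exactly 0. -/
lemma TruncatedPrior.tendsto {priorQ : Measure (TransMat k)} [IsProbabilityMeasure priorQ]
    (h : TruncatedPrior priorQ) (s C : ℝ) :
    Tendsto (fun n : ℕ => ENNReal.ofReal (Real.exp (C * Real.log n ^ s)) *
      priorQ (transMatGE k (Real.log n ^ (-1 : ℝ)))ᶜ) atTop (𝓝 0) := by
  obtain ⟨q, hq, hq1⟩ := h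
  refine tendsto_const_nhds.congr' ?_
  have hqev : ∀ᶠ n : ℕ in atTop, Real.log n ^ (-1 : ℝ) ≤ q :=
    ((tendsto_rpow_neg_atTop one_pos).comp tendsto_log_natCast).eventually (ge_mem_nhds hq)
  filter_upwards [hqev] with n hn
  have h0 : priorQ (transMatGE k q)ᶜ = 0 :=
    (prob_compl_eq_zero_iff (measurableSet_transMatGE q)).2 hq1
  have hsub : transMatGE k q ⊆ transMatGE k (Real.log n ^ (-1 : ℝ)) :=
    fun Q hQ i j => hn.trans (hQ i j)
  rw [measure_mono_null (Set.compl_subset_compl.2 hsub) h0, mul_zero]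

end

end BayesHMM

end

/-! ### Choice of the exponents -/

theorem corollary1 (k : ℕ) (hk : 1 ≤ k)
    -- the true parameter
    (θs : BayesHMM.Param k) (qs : ℝ) (hqs : 0 < qs) (hQs : θs.1 ∈ BayesHMM.transMatGE k qs)
    (m c K : ℝ) (hm : 0 < m) (hc : 0 < c) (hK : 0 < K)
    (hfs : ∀ j, θs.2 j ∈ BayesHMM.emissionClass m c K)
    (hlink : BayesHMM.LinkedTails m c θs.2)
    -- the prior
    (G : MeasureTheory.Measure ℕ+) [MeasureTheory.IsFiniteMeasure G]
    (hG : BayesHMM.PolynomialTail G)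
    (priorQ : MeasureTheory.Measure (BayesHMM.TransMat k))
    [MeasureTheory.IsProbabilityMeasure priorQ]
    (πq : stdSimplex ℝ (Fin k) → NNReal) (hpriorQ : BayesHMM.HasRowDensity priorQ πq θs.1)
    -- the exponents
    (t₀ t : ℝ) (ht₀ : 1 / 2 * max (1 / m + 1) (K / m) ≤ t₀) (ht : 4 * t₀ < t)
    -- the loss
    (ℓ : ℕ) (hℓ : 1 ≤ ℓ)
    -- the observed stationary hidden Markov chain
    {Ω : Type*} [MeasurableSpace Ω] (P : MeasureTheory.Measure Ω)
    (X : ℕ → Ω → Fin k) (Y : ℕ → Ω → ℕ+)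
    (hXY : BayesHMM.IsHiddenMarkovChain P X Y (BayesHMM.statDist θs.1) θs) :
    (BayesHMM.ExpTail πq →
      BayesHMM.ConcentratesAtRate P Y (BayesHMM.hmmPrior priorQ G) ℓ θs
        fun n : ℕ => 1 / Real.sqrt n * Real.log n ^ (t + 2 * t₀)) ∧
    (BayesHMM.ExpExpTail πq →
      BayesHMM.ConcentratesAtRate P Y (BayesHMM.hmmPrior priorQ G) ℓ θs
        fun n : ℕ => 1 / Real.sqrt n * Real.log n ^ t) ∧
    (BayesHMM.TruncatedPrior priorQ →
      BayesHMM.ConcentratesAtRate P Y (BayesHMM.hmmPrior priorQ G) ℓ θs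
        fun n : ℕ => 1 / Real.sqrt n * Real.log n ^ t) ∧
    -- no estimator improves on `1 / √n` uniformly over a class that contains the truth
    (∃ (d B : ℝ) (N₀ : ℕ+), θs ∈ BayesHMM.uniformClass k qs m c K d B N₀ ∧
      ∃ c₀ : ℝ, 0 < c₀ ∧ ∀ n : ℕ, 1 ≤ n →
        ENNReal.ofReal (c₀ / Real.sqrt n) ≤
          BayesHMM.obsMinimaxRisk (BayesHMM.uniformClass k qs m c K d B N₀) ℓ n) := by
  have hmax := ht₀
  rw [mul_max_of_nonneg _ _ (by norm_num : (0 : ℝ) ≤ 1 / 2), max_le_iff] at hmax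
  obtain ⟨h1, h2⟩ := hmax
  have hm' : 0 < 1 / m := by positivity
  -- The exponent of the prior mass is s = 4t₀ - 1. Adding 2t₀ ≥ 1/m + 1 and 2t₀ ≥ K/m gives (K +
  -- 1)/m ≤ s.
  have hs1 : 1 / m + 1 ≤ 4 * t₀ - 1 := by linarith
  have hs2 : (K + 1) / m ≤ 4 * t₀ - 1 := by
    rw [add_div]
    linarith
  refine ⟨fun hQ => ?_, fun hQ => ?_, fun hQ => ?_,
    BayesHMM.exists_obsMinimaxRisk_ge hk θs hqs hQs hK hfs hlink hℓ⟩
  -- r has to exceed s = 4t₀ - 1; with r = 4t₀ the condition reads 8t₀ < 2(t + 2t₀).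
  · exact BayesHMM.concentratesAtRate_of_prior_tail hk hqs hQs hm hc hK hfs hG hpriorQ ℓ hXY
      (r := 4 * t₀) (by linarith) hs1 hs2 (by linarith)
      (hpriorQ.tendsto_of_expTail hk hQ (by linarith) (by linarith))
  -- With r = 1 the condition reads 4t₀ + 1 < 2t, which follows from t > 4t₀ and t₀ > 1/2.
  · exact BayesHMM.concentratesAtRate_of_prior_tail hk hqs hQs hm hc hK hfs hG hpriorQ ℓ hXY
      one_pos hs1 hs2 (by linarith) (hpriorQ.tendsto_of_expExpTail hk hQ (by linarith))
  · exact BayesHMM.concentratesAtRate_of_prior_tail hk hqs hQs hm hc hK hfs hG hpriorQ ℓ hXY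
      one_pos hs1 hs2 (by linarith) (hQ.tendsto _)
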